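/- Let $p\ge 2$ and let $I\subseteq\mathbf R$ be a nonempty open interval; everything is of class $C^\infty$. Let $C^\infty(I,\mathbf R\times S^p)$, where $S^p\subset\mathbf R^{1+p}$ is the unit sphere, carry the Whitney $C^\infty$ topology. Terminology. A curve $g:I\to\mathbf R^{1+p}$ is a frontal curve with unit tangent frame $\tau:I\to S^p$ if $g'(t)$ is a multiple of $\tau(t)$ for every $t$; its tangent surface is $\mathrm{Tan}(g)(t,s)=g(t)+s\,\tau(t)$ on $I\times\mathbf R$. A surface $F:I\times\mathbf R\to\mathbf R^{1+p}$ is a proper frontal if locally there are $p-1$ smooth orthonormal vector fields along $F$ that are orthogonal to the image of $dF$ at every point, and the singular points of $F$ are nowhere dense; these fields then span a well-defined normal bundle $N_F$. A smooth section of $N_F$ is normally parallel if all its derivatives are orthogonal to $N_F$, and a Bishop frame is a frame $(\nu_1,\dots,\nu_{p-1})$ of $N_F$ on $I\times\mathbf R$ that is orthonormal and normally parallel. A directrix of a surface $P:I\times\mathbf R\to\mathbf R^{1+p}$ is a frontal curve $g:I\to\mathbf R^{1+p}$ such that $P=\mathrm{Tan}(g)\circ\Phi$ for a diffeomorphism of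 $I\times\mathbf R$ of the form $\Phi(t,s)=(t,\varphi(t,s))$. A curve $g$ is of type $(a_1,\dots,a_{1+p})$ at $t$ if, for $i=1,\dots,1+p$, $a_i$ is the least $k$ for which the matrix $(g'(t),g''(t),\dots,g^{(k)}(t))$ has rank $i$. Theorem. There is an open dense subset $U$ of $C^\infty(I,\mathbf R\times S^p)$ such that for every $(a,\tau)\in U$ and every curve $f:I\to\mathbf R^{1+p}$ with $f'=a\tau$ the following holds. The tangent surface $\mathrm{Tan}(f)(t,s)=f(t)+s\tau(t)$ is a proper frontal and has a Bishop frame on $I\times\mathbf R$. For every Bishop frame $(\nu_1,\dots,\nu_{p-1})$ of it and every generic $R\in\mathbf R^{p-1}$ (that is, all $R$ in a residual subset whose complement has Lebesgue measure zero), put $\nu=\sum_i R_i\nu_i$. Then for every $r\in\mathbf R$ the parallel $\mathrm{Tan}(f)+r\nu$ has a directrix; and for any choice of directrices $g_r$ of $\mathrm{Tan}(f)+r\nu$ $(r\in\mathbf R)$, the type of $g_r$ at $t$ is, for every $(t,r)\in I\times\mathbf R$, one of those in the table $$ \begin{array}{|c|c|} \hline \text{type} & \text{codimension}\\ \hline (1,2,\dots,p,1+p)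 & 0\\ (1,2,\dots,p,2+p) & 1\\ (2,3,\dots,1+p,2+p) & 1\\ (2,3,\dots,1+p,3+p) & 2\\ (3,4,\dots,2+p,3+p) & 2\\ \hline \end{array} $$ Moreover, for each type in the table, the set of all $(t,r)\in I\times\mathbf R$ at which $g_r$ has this type at $t$ is a (possibly empty) embedded submanifold of $I\times\mathbf R$ of the codimension given in the second column. -/

import Mathlib

open Set Filter Topology MeasureTheory
open scoped ContDiff

namespace TangentParallel

/-- The Euclidean space `R^{1+p}`. -/
abbrev E (p : ℕ) : Type := EuclideanSpace ℝ (Fin (1 + p))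

/-! ### The space of smooth maps from `I` to `R × S^p` with the Whitney topology -/

/-- A smooth map `(a, τ) : I → R × S^p`, for `I` an open subset of the line. Only the values on `I`
matter: the topology below does not distinguish two elements that agree on `I`. -/
structure FrontalData (I : Set ℝ) (p : ℕ) where
  a : ℝ → ℝ
  τ : ℝ → E p
  contDiffOn_a : ContDiffOn ℝ ∞ a I
  contDiffOn_τ : ContDiffOn ℝ ∞ τ I
  norm_τ : ∀ t ∈ I, ‖τ t‖ = 1

/-- The basic Whitney neighbourhood of `x`: all `y` whose derivatives up to order `k` differ from
those of `x` by less than `ε t` at every point `t` of `I`. -/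
def whitneyNhd {I : Set ℝ} {p : ℕ} (x : FrontalData I p) (k : ℕ) (ε : ℝ → ℝ) :
    Set (FrontalData I p) :=
  {y | ∀ t ∈ I, ∀ j ≤ k,
    |iteratedDeriv j y.a t - iteratedDeriv j x.a t| < ε t ∧
    ‖iteratedDeriv j y.τ t - iteratedDeriv j x.τ t‖ < ε t}

/-- The Whitney `C^∞` topology: a set is open if with every element it contains a neighbourhood
given by some order `k` and some continuous positive function `ε` on `I`. -/
instance whitneyTopology (I : Set ℝ) (p : ℕ) : TopologicalSpace (FrontalData I p) where
  IsOpen U := ∀ x ∈ U, ∃ (k : ℕ) (ε : ℝ → ℝ),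
    ContinuousOn ε I ∧ (∀ t ∈ I, 0 < ε t) ∧ whitneyNhd x k ε ⊆ U
  isOpen_univ := fun _ _ =>
    ⟨0, fun _ => 1, continuousOn_const, fun _ _ => one_pos, subset_univ _⟩
  isOpen_inter := by
    rintro U V hU hV x ⟨hxU, hxV⟩
    obtain ⟨k, ε, hc, hpos, hsub⟩ := hU x hxU
    obtain ⟨l, δ, hc', hpos', hsub'⟩ := hV x hxV
    refine ⟨max k l, fun t => min (ε t) (δ t), fun t ht => (hc t ht).min (hc' t ht),
      fun t ht => lt_min (hpos t ht) (hpos' t ht), fun y hy => ⟨hsub ?_, hsub' ?_⟩⟩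
    · intro t ht j hj
      have h := hy t ht j (hj.trans (le_max_left _ _))
      exact ⟨h.1.trans_le (min_le_left _ _), h.2.trans_le (min_le_left _ _)⟩
    · intro t ht j hj
      have h := hy t ht j (hj.trans (le_max_right _ _))
      exact ⟨h.1.trans_le (min_le_right _ _), h.2.trans_le (min_le_right _ _)⟩
  isOpen_sUnion := by
    rintro S hS x ⟨U, hU, hx⟩
    obtain ⟨k, ε, hc, hpos, hsub⟩ := hS U hU x hx
    exact ⟨k, ε, hc, hpos, hsub.trans (subset_sUnion_of_mem hU)⟩

/-- `f : I → R^{1+p}` is a frontal curve with `f' = a τ` (hence it is smooth on `I`). -/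
def FrontalData.IsCurve {I : Set ℝ} {p : ℕ} (x : FrontalData I p) (f : ℝ → E p) : Prop :=
  ∀ t ∈ I, HasDerivAt f (x.a t • x.τ t) t

/-! ### Frontals, normal fields, Bishop frames -/

section Frontal

variable {M : Type*} [NormedAddCommGroup M] [NormedSpace ℝ M] {p : ℕ}

/-- `ν` is a smooth vector field along `F : Ω → R^{1+p}` that is orthogonal to the image of the
differential of `F` at every point. For a proper frontal `F` these are exactly the smooth sections
of the normal bundle of `F`, because the regular points of `F` are dense. -/
def IsNormalField (Ω : Set M) (F ν : M → E p) : Prop :=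
  ContDiffOn ℝ ∞ ν Ω ∧ ∀ u ∈ Ω, ∀ v : M, inner ℝ (ν u) (fderiv ℝ F u v) = 0

/-- `F : Ω → R^{1+p}` is a smooth proper frontal of codimension `q`: near every point there is an
orthonormal frame of `q` normal fields, and the singular locus is nowhere dense. -/
def IsProperFrontal (q : ℕ) (Ω : Set M) (F : M → E p) : Prop :=
  ContDiffOn ℝ ∞ F Ω ∧
  (∀ u ∈ Ω, ∃ O ⊆ Ω, IsOpen O ∧ u ∈ O ∧ ∃ ν : Fin q → M → E p,
    (∀ i, IsNormalField O F (ν i)) ∧ ∀ w ∈ O, Orthonormal ℝ (fun i => ν i w)) ∧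
  IsNowhereDense {u | u ∈ Ω ∧ ¬ Function.Injective (fderiv ℝ F u)}

/-- `ν` is a normally parallel normal field along `F`: every derivative of `ν` is orthogonal to
the normal bundle, that is to all local normal fields. -/
def IsNormallyParallel (Ω : Set M) (F ν : M → E p) : Prop :=
  IsNormalField Ω F ν ∧
  ∀ O ⊆ Ω, IsOpen O → ∀ ξ : M → E p, IsNormalField O F ξ →
    ∀ u ∈ O, ∀ v : M, inner ℝ (fderiv ℝ ν u v) (ξ u) = 0

/-- A normally parallel orthonormal frame (Bishop frame) of the normal bundle of `F`. -/
def IsBishopFrame {q : ℕ} (Ω : Set M) (F : M → E p) (ν : Fin q → M → E p) : Prop :=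
  (∀ i, IsNormallyParallel Ω F (ν i)) ∧ ∀ u ∈ Ω, Orthonormal ℝ (fun i => ν i u)

end Frontal

/-- A property of `q` real parameters is generic if the set where it holds is residual and has
a complement of Lebesgue measure zero. -/
def IsGeneric {q : ℕ} (S : Set (Fin q → ℝ)) : Prop :=
  S ∈ residual (Fin q → ℝ) ∧ ∀ᵐ R : Fin q → ℝ, R ∈ S

/-! ### Tangent surfaces and directrices -/

/-- The tangent surface `(t, s) ↦ f t + s τ t` of a frontal curve with unit tangent frame `τ`. -/
noncomputable def tangentSurface {p : ℕ} (f τ : ℝ → E p) (u : ℝ × ℝ) : E p :=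
  f u.1 + u.2 • τ u.1

/-- `g : I → R^{1+p}` is a directrix of the surface `P : I × R → R^{1+p}`: it is a frontal curve,
with unit tangent frame `σ`, whose tangent surface is right equivalent to `P` by a diffeomorphism
`(t, s) ↦ (t, φ (t, s))` of `I × R` over the identity of `I`. -/
def IsDirectrix {p : ℕ} (I : Set ℝ) (P : ℝ × ℝ → E p) (g : ℝ → E p) : Prop :=
  ContDiffOn ℝ ∞ g I ∧ ∃ σ : ℝ → E p,
    ContDiffOn ℝ ∞ σ I ∧ (∀ t ∈ I, ‖σ t‖ = 1) ∧ (∀ t ∈ I, ∃ b : ℝ, deriv g t = b • σ t) ∧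
    ∃ φ : ℝ × ℝ → ℝ, ContDiffOn ℝ ∞ φ (I ×ˢ univ) ∧
      (∀ t ∈ I, Function.Bijective (fun s => φ (t, s))) ∧
      (∀ t ∈ I, ∀ s, deriv (fun s' => φ (t, s')) s ≠ 0) ∧
      ∀ t ∈ I, ∀ s, P (t, s) = tangentSurface g σ (t, φ (t, s))

/-! ### Types of curves and codimension -/

/-- The Wronskian matrix with the columns `f'(t), f''(t), …, f^(k)(t)`. -/
noncomputable def wronskianMatrix {p : ℕ} (f : ℝ → E p) (k : ℕ) (t : ℝ) :
    Matrix (Fin (1 + p)) (Fin k) ℝ :=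
  Matrix.of fun i j => iteratedDeriv (j.val + 1) f t i

/-- `f` is of type `(A 0, …, A p)` at `t`: the number `A i` is the least `k` for which the
Wronskian matrix with `k` columns has rank `i + 1`. -/
def IsOfType {p : ℕ} (f : ℝ → E p) (A : Fin (1 + p) → ℕ) (t : ℝ) : Prop :=
  ∀ i : Fin (1 + p), IsLeast {k : ℕ | (wronskianMatrix f k t).rank = i.val + 1} (A i)

/-- The table of types, each with its codimension:
`(1, 2, …, p, 1+p)`, `(1, 2, …, p, 2+p)`, `(2, 3, …, 1+p, 2+p)`, `(2, 3, …, 1+p, 3+p)`,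
`(3, 4, …, 2+p, 3+p)`. -/
def typeTable (p : ℕ) : List ((Fin (1 + p) → ℕ) × ℕ) :=
  [(fun i => i.val + 1, 0),
   (fun i => if i.val = p then 2 + p else i.val + 1, 1),
   (fun i => i.val + 2, 1),
   (fun i => if i.val = p then 3 + p else i.val + 2, 2),
   (fun i => i.val + 3, 2)]

/-- `L` is an embedded (locally closed, possibly empty) smooth submanifold of codimension `c` of
the plane: near each of its points it is the zero set of a submersion to `R^c`. -/
def IsSubmanifoldOfCodim (c : ℕ) (L : Set (ℝ × ℝ)) : Prop :=
  ∀ x ∈ L, ∃ O : Set (ℝ × ℝ), IsOpen O ∧ x ∈ O ∧ ∃ h : ℝ × ℝ → (Fin c → ℝ),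
    ContDiffOn ℝ ∞ h O ∧ (∀ y ∈ O, Function.Surjective (fderiv ℝ h y)) ∧
    L ∩ O = {y | y ∈ O ∧ h y = 0}

end TangentParallel

/-! Let `τ` be a unit curve with `τ' ≠ 0`. The normal space of the tangent surface at `(t, s)` is
the orthogonal complement of `τ t` and `τ' t`, so a normally parallel field `m` depends on `t` only
and satisfies `m' = -h τ'` with `h = ⟨m, τ''⟩ / ‖τ'‖²`. Hence `f + s τ + r m` is the tangent surface
of `g = f + r m + r h τ`, because `g' = (a + r h') τ`, and no other curve is a directrix
(`isDirectrix_directrix`, `IsDirectrix.eq_directrix`).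

Put `c = h'` and `b = a + r c`. If `b` vanishes exactly to order `d` at `t`, the Leibniz rule makes
the derivatives of `g` a triangular combination of `τ, τ', …`, delayed by `d`. Let `D = det(τ, …,
τ^(p))`; its derivative `D'` has the last column replaced by its successor. Then `D ≠ 0` gives the
type `(1+d, …, 1+p+d)`, and `D = 0 ≠ D'` delays the last entry by one more. The table consists of `d
≤ 2` with `D ≠ 0` and `d ≤ 1` with `D = 0`. What has to be excluded is a common zero of `D` and
`D'`, and a point with `b = b' = 0` at which `D = 0` or `b'' = 0`. Elimination of `r` turns `b = b'
= 0` into `w = a c' - a' c = 0`, and `b = b'' = 0` into `w' = a c'' - a'' c = 0`. So it suffices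
that `c ≠ 0` where `a = 0`, that `w ≠ 0` where `D = 0`, and that `w` has simple zeros
(`types_of_isDirectrix`). The same facts give the Jacobians of the strata
(`isSubmanifoldOfCodim_strata`).

For `m = ∑ R_i ν_i` the functions `c` and `w` are linear in `R`, with coefficients `c_i` and `w_i`.
If `a` and `D` have simple zeros, the vector `(c_i)` is nonzero where `a = 0`, `(w_i)` is nonzero
where `D = 0`, and `(w_i)`, `(w_i')` have no common zero, then the bad `R` lie in countably many
hyperplanes and in critical sets that are null by Sard (`isGeneric_parameters`).

These conditions on `(a, τ)` involve only jets, although `ν` depends on `τ` nonlocally: the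
derivatives of `h` are inner products of `ν` with functions of the jets of `τ` (`normalDeriv`). They
are therefore open. They are dense by a jet transversality argument (`exists_perturbation`): bad
sets of codimension two in `I × jets` are avoided by small perturbations. First `τ` is perturbed for
`D`, then `τ` for `(c_i)` and `(c_i')`, and finally `a` with `τ` fixed (`dense_genericData`). -/

namespace TangentParallel

/-! ### Jets of curves -/

section Jets

variable {V W : Type*} [NormedAddCommGroup V] [NormedSpace ℝ V] [NormedAddCommGroup W]
  [NormedSpace ℝ W] {I : Set ℝ} {K : ℕ} {v : ℝ → V} {t : ℝ}

/-- The `(K-1)`-jet `(v t, v' t, …, v^(K-1) t)` of a curve. -/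
noncomputable def jet (K : ℕ) (v : ℝ → V) (t : ℝ) : Fin K → V := fun i => iteratedDeriv i v t

theorem contDiffOn_deriv (hI : IsOpen I) (hv : ContDiffOn ℝ ∞ v I) :
    ContDiffOn ℝ ∞ (deriv v) I :=
  hv.deriv_of_isOpen hI (by simp)

theorem contDiffOn_iteratedDeriv (hI : IsOpen I) (hv : ContDiffOn ℝ ∞ v I) (j : ℕ) :
    ContDiffOn ℝ ∞ (iteratedDeriv j v) I := by
  induction j with
  | zero => simpa using hv
  | succ j ih => rw [iteratedDeriv_succ]; exact contDiffOn_deriv hI ih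

theorem hasDerivAt_of_contDiffOn (hI : IsOpen I) (hv : ContDiffOn ℝ ∞ v I) (ht : t ∈ I) :
    HasDerivAt v (deriv v t) t :=
  ((hv.contDiffAt (hI.mem_nhds ht)).differentiableAt (by simp)).hasDerivAt

theorem hasDerivAt_iteratedDeriv (hI : IsOpen I) (hv : ContDiffOn ℝ ∞ v I) (ht : t ∈ I) (j : ℕ) :
    HasDerivAt (iteratedDeriv j v) (iteratedDeriv (j + 1) v t) t := by
  rw [iteratedDeriv_succ]
  exact hasDerivAt_of_contDiffOn hI (contDiffOn_iteratedDeriv hI hv j) ht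

theorem contDiffOn_jet (hI : IsOpen I) (hv : ContDiffOn ℝ ∞ v I) (K : ℕ) :
    ContDiffOn ℝ ∞ (jet K v) I :=
  contDiffOn_pi.2 fun i => contDiffOn_iteratedDeriv hI hv i

theorem hasDerivAt_jet (hI : IsOpen I) (hv : ContDiffOn ℝ ∞ v I) (ht : t ∈ I) (K : ℕ) :
    HasDerivAt (jet K v) (fun i : Fin K => jet (K + 1) v t i.succ) t :=
  hasDerivAt_pi.2 fun i => by simpa [jet] using hasDerivAt_iteratedDeriv hI hv ht i

/-- The total derivative of a function of `K`-jets, a function of `(K+1)`-jets. -/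
noncomputable def totalDeriv (T : (Fin K → V) → W) (z : Fin (K + 1) → V) : W :=
  fderiv ℝ T (fun i => z i.castSucc) (fun i => z i.succ)

theorem hasDerivAt_comp_jet (hI : IsOpen I) (hv : ContDiffOn ℝ ∞ v I) (ht : t ∈ I)
    {T : (Fin K → V) → W} (hT : ContDiffAt ℝ ∞ T (jet K v t)) :
    HasDerivAt (fun s => T (jet K v s)) (totalDeriv T (jet (K + 1) v t)) t :=
  (hT.differentiableAt (by simp)).hasFDerivAt.comp_hasDerivAt t (hasDerivAt_jet hI hv ht K)

theorem contDiffAt_totalDeriv [FiniteDimensional ℝ V] {T : (Fin K → V) → W} {z : Fin (K + 1) → V}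
    (hT : ContDiffAt ℝ ∞ T (fun i => z i.castSucc)) : ContDiffAt ℝ ∞ (totalDeriv T) z := by
  have h1 : ContDiff ℝ ∞ (fun z : Fin (K + 1) → V => (fun i : Fin K => z i.castSucc)) :=
    contDiff_pi.2 fun i => contDiff_apply ℝ V i.castSucc
  have h2 : ContDiff ℝ ∞ (fun z : Fin (K + 1) → V => (fun i : Fin K => z i.succ)) :=
    contDiff_pi.2 fun i => contDiff_apply ℝ V i.succ
  have h3 : ContDiffAt ℝ ∞ (fderiv ℝ T) (fun i => z i.castSucc) :=
    hT.fderiv_right (by simp)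
  have h4 : ContDiffAt ℝ ∞ (fun z : Fin (K + 1) → V => fderiv ℝ T (fun i => z i.castSucc)) z :=
    ContDiffAt.comp z h3 h1.contDiffAt
  exact h4.clm_apply h2.contDiffAt

theorem iteratedDeriv_smul_eq {b : ℝ → ℝ} {n : ℕ} (hb : ContDiffAt ℝ n b t)
    (hv : ContDiffAt ℝ n v t) :
    iteratedDeriv n (fun s => b s • v s) t =
      ∑ i ∈ Finset.range (n + 1), n.choose i • iteratedDeriv i b t • iteratedDeriv (n - i) v t := by
  have := iteratedDerivWithin_smul (mem_univ t) uniqueDiffOn_univ hb.contDiffWithinAt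
    hv.contDiffWithinAt
  have e : (fun s => b s • v s) = b • v := rfl
  simpa [iteratedDerivWithin_univ, e] using this

end Jets

/-! ### Tubes around curves -/

/-- A curve inside an open set has a tube of continuous positive radius inside this set. -/
theorem exists_tube {J : Type*} [NormedAddCommGroup J] {I : Set ℝ} {j : ℝ → J}
    (hj : ContinuousOn j I) {O : Set (ℝ × J)} (hO : IsOpen O) (hjO : ∀ t ∈ I, (t, j t) ∈ O) :
    ∃ η : ℝ → ℝ, ContinuousOn η I ∧ (∀ t ∈ I, 0 < η t) ∧
      ∀ t ∈ I, ∀ z, ‖z - j t‖ < η t → (t, z) ∈ O := by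
  rcases (Oᶜ).eq_empty_or_nonempty with h | h
  · refine ⟨fun _ => 1, continuousOn_const, fun _ _ => one_pos, fun t _ z _ => ?_⟩
    rw [compl_empty_iff] at h
    simp [h]
  -- The radius is the distance to the closed complement in the product metric, where two points
  -- over the same `t` are as far apart as their second components.
  · refine ⟨fun t => Metric.infDist (t, j t) Oᶜ, ?_, fun t ht => ?_, fun t ht z hz => ?_⟩
    · exact (Metric.continuous_infDist_pt _).comp_continuousOn (continuousOn_id.prodMk hj)
    · rw [← hO.isClosed_compl.notMem_iff_infDist_pos h]
      simpa using hjO t ht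
    · by_contra hc
      have h1 : Metric.infDist (t, j t) Oᶜ ≤ dist (t, j t) (t, z) :=
        Metric.infDist_le_dist_of_mem hc
      have h2 : dist (t, j t) (t, z) = ‖z - j t‖ := by
        rw [Prod.dist_eq, dist_self, dist_comm, dist_eq_norm]
        simp
      linarith

/-! ### Small smooth functions -/

/-- On an open set there is a smooth positive function whose derivatives up to order `k` are
dominated by a given continuous positive function. -/
theorem exists_small_smooth {I : Set ℝ} (hI : IsOpen I) {ε : ℝ → ℝ} (hε : ContinuousOn ε I)
    (hpos : ∀ t ∈ I, 0 < ε t) (k : ℕ) :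
    ∃ l : ℝ → ℝ, ContDiff ℝ ∞ l ∧ (∀ t ∈ I, 0 < l t) ∧
      ∀ t ∈ I, ∀ j ≤ k, |iteratedDeriv j l t| ≤ ε t := by
  rcases I.eq_empty_or_nonempty with rfl | hne
  · exact ⟨0, contDiff_const, by simp, by simp⟩
  -- The function sought is `∑ r n • g n` for countably many bumps `g n` whose supports cover `I`,
  -- with very small weights `r n`.
  let ι := {f : ℝ → ℝ // tsupport f ⊆ I ∧ HasCompactSupport f ∧ ContDiff ℝ ∞ f ∧
    range f ⊆ Icc 0 1}
  obtain ⟨T, hTc, hT⟩ : ∃ T : Set ι, T.Countable ∧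
      ⋃ f ∈ T, Function.support (f : ℝ → ℝ) = I := by
    have : ⋃ f : ι, Function.support (f : ℝ → ℝ) = I := by
      refine Subset.antisymm (iUnion_subset fun f => (subset_tsupport _).trans f.2.1) ?_
      intro x hx
      rcases exists_contDiff_tsupport_subset (n := ⊤) (hI.mem_nhds hx) with ⟨f, hf⟩
      let g : ι := ⟨f, hf.1, hf.2.1, hf.2.2.1, hf.2.2.2.1⟩
      have : x ∈ Function.support (g : ℝ → ℝ) := by
        simp only [g, hf.2.2.2.2, Function.mem_support, Ne, one_ne_zero, not_false_iff]
      exact mem_iUnion_of_mem _ this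
    simp_rw [← this]
    apply TopologicalSpace.isOpen_iUnion_countable
    rintro ⟨f, hf⟩
    exact hf.2.2.1.continuous.isOpen_support
  obtain ⟨g0, hg⟩ : ∃ g0 : ℕ → ι, T = range g0 := by
    apply hTc.exists_eq_range
    rcases eq_empty_or_nonempty T with (rfl | hT')
    · simp at hT
      exact absurd hT.symm hne.ne_empty
    · exact hT'
  let g : ℕ → ℝ → ℝ := fun n => (g0 n).1
  have g_s : ∀ n, tsupport (g n) ⊆ I := fun n => (g0 n).2.1
  have s_g : ∀ x ∈ I, ∃ n, x ∈ Function.support (g n) := fun x hx ↦ by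
    rw [← hT] at hx
    simp only [mem_iUnion] at hx
    obtain ⟨i, iT, hi⟩ := hx
    obtain ⟨n, hn⟩ := hg ▸ iT
    exact ⟨n, by simpa [g, hn] using hi⟩
  have g_smooth : ∀ n, ContDiff ℝ ∞ (g n) := fun n => (g0 n).2.2.2.1
  have g_comp : ∀ n, HasCompactSupport (g n) := fun n => (g0 n).2.2.1
  have g_nonneg : ∀ n x, 0 ≤ g n x := fun n x => ((g0 n).2.2.2.2 (mem_range_self x)).1
  obtain ⟨δ, δpos, c, δc, c_lt⟩ := NNReal.exists_pos_sum_of_countable one_ne_zero ℕ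
  -- Order `n` is what termwise differentiation of the series to every order needs; order `k`, with
  -- the extra factor `ε x`, gives the domination.
  have key : ∀ n : ℕ, ∃ r : ℝ, 0 < r ∧ ∀ i ≤ max n k, ∀ x,
      ‖iteratedFDeriv ℝ i (r • g n) x‖ ≤ δ n ∧
      (x ∈ I → ‖iteratedFDeriv ℝ i (r • g n) x‖ ≤ δ n * ε x) := by
    intro n
    have : ∀ i, ∃ R, ∀ x, ‖iteratedFDeriv ℝ i (fun x => g n x) x‖ ≤ R := by
      intro i
      have : BddAbove (range fun x => ‖iteratedFDeriv ℝ i (fun x : ℝ => g n x) x‖) := by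
        apply ((g_smooth n).continuous_iteratedFDeriv
          (mod_cast le_top)).norm.bddAbove_range_of_hasCompactSupport
        apply HasCompactSupport.comp_left _ norm_zero
        apply (g_comp n).iteratedFDeriv
      rcases this with ⟨R, hR⟩
      exact ⟨R, fun x => hR (mem_range_self _)⟩
    choose R hR using this
    let M := max (((Finset.range (max n k + 1)).image R).max' (by simp)) 1
    have δnpos : 0 < δ n := δpos n
    have IR : ∀ i ≤ max n k, R i ≤ M := by
      intro i hi
      refine le_trans ?_ (le_max_left _ _)
      apply Finset.le_max'
      apply Finset.mem_image_of_mem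
      simp only [Finset.mem_range]
      lia
    -- On the compact support of the bump, `ε` has a positive lower bound; off the support all
    -- derivatives vanish and the bound is trivial.
    obtain ⟨e, he, he1, heε⟩ : ∃ e : ℝ, 0 < e ∧ e ≤ 1 ∧ ∀ x ∈ tsupport (g n), e ≤ ε x := by
      rcases (tsupport (g n)).eq_empty_or_nonempty with h | h
      · exact ⟨1, one_pos, le_rfl, by simp [h]⟩
      · obtain ⟨x, hx, hmin⟩ := (g_comp n).isCompact.exists_isMinOn h (hε.mono (g_s n))
        exact ⟨min (ε x) 1, lt_min (hpos x (g_s n hx)) one_pos, min_le_right _ _,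
          fun y hy => (min_le_left _ _).trans (hmin hy)⟩
    have hMpos : 0 < M := lt_max_of_lt_right one_pos
    have eq : ∀ i x, ‖iteratedFDeriv ℝ i ((M⁻¹ * δ n * e) • g n) x‖ =
        M⁻¹ * δ n * e * ‖iteratedFDeriv ℝ i (g n) x‖ := by
      intro i x
      rw [iteratedFDeriv_const_smul_apply, norm_smul _ (iteratedFDeriv ℝ i (g n) x),
        Real.norm_of_nonneg (by positivity)]
      exact (g_smooth n).contDiffAt.of_le (mod_cast le_top)
    have bd : ∀ i ≤ max n k, ∀ x, ‖iteratedFDeriv ℝ i ((M⁻¹ * δ n * e) • g n) x‖ ≤ δ n * e := by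
      intro i hi x
      rw [eq]
      calc M⁻¹ * δ n * e * ‖iteratedFDeriv ℝ i (g n) x‖ ≤ M⁻¹ * δ n * e * M := by
            gcongr; exact (hR i x).trans (IR i hi)
        _ = δ n * e := by field_simp
    refine ⟨M⁻¹ * δ n * e, by positivity, fun i hi x => ⟨(bd i hi x).trans ?_, fun hx => ?_⟩⟩
    · exact mul_le_of_le_one_right δnpos.le he1
    · by_cases hxs : x ∈ tsupport (g n)
      · exact (bd i hi x).trans (by gcongr; exact heε x hxs)
      · have h0 : iteratedFDeriv ℝ i (g n) x = 0 := by
          by_contra hne0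
          exact hxs (support_iteratedFDeriv_subset i hne0)
        rw [eq, h0]
        simp only [norm_zero, mul_zero]
        exact mul_nonneg δnpos.le (hpos x hx).le
  choose r rpos hr using key
  have hδs : Summable (fun n => (δ n : ℝ)) := (NNReal.hasSum_coe.2 δc).summable
  have S : ∀ x, Summable fun n => (r n • g n) x := fun x ↦ by
    refine .of_norm_bounded hδs fun n => ?_
    simpa only [norm_iteratedFDeriv_zero] using! (hr n 0 (Nat.zero_le _) x).1
  refine ⟨fun x => ∑' n, (r n • g n) x, ?_, fun x hx => ?_, fun x hx j hj => ?_⟩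
  · refine contDiff_tsum_of_eventually (fun k => (g_smooth k).const_smul (r k))
        (fun k _ => hδs) ?_
    intro i _
    simp only [Nat.cofinite_eq_atTop, Filter.eventually_atTop]
    exact ⟨i, fun n hn x => (hr _ _ (hn.trans (le_max_left _ _)) _).1⟩
  · obtain ⟨n, hn⟩ := s_g x hx
    have I : 0 < r n * g n x := mul_pos (rpos n) (lt_of_le_of_ne (g_nonneg n x) (Ne.symm hn))
    exact (S x).tsum_pos (fun i => mul_nonneg (rpos i).le (g_nonneg i x)) n I
  · have h1 := iteratedFDeriv_tsum_apply (N := k) (𝕜 := ℝ) (f := fun n => r n • g n)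
      (v := fun _ n => (δ n : ℝ))
      (fun i => ((g_smooth i).const_smul (r i)).of_le (mod_cast le_top)) (fun _ _ => hδs)
      (fun m i x hm => (hr i m ((Nat.cast_le.1 hm).trans (le_max_right _ _)) x).1)
      (k := j) (by exact_mod_cast hj) x
    have h2 : |iteratedDeriv j (fun x => ∑' n, (r n • g n) x) x| =
        ‖iteratedFDeriv ℝ j (fun x => ∑' n, (r n • g n) x) x‖ := by
      rw [norm_iteratedFDeriv_eq_norm_iteratedDeriv, Real.norm_eq_abs]
    rw [h2, h1]
    have h3 : ∀ n, ‖iteratedFDeriv ℝ j (r n • g n) x‖ ≤ δ n * ε x := fun n =>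
      (hr n j (hj.trans (le_max_right _ _)) x).2 hx
    have h4 : HasSum (fun n => (δ n : ℝ) * ε x) (c * ε x) :=
      (NNReal.hasSum_coe.2 δc).mul_right _
    calc _ ≤ (c : ℝ) * ε x := tsum_of_norm_bounded h4 h3
      _ ≤ 1 * ε x := by
        gcongr
        · exact (hpos x hx).le
        · exact_mod_cast c_lt.le
      _ = ε x := one_mul _

section Transversality

variable {V : Type*} [NormedAddCommGroup V] [NormedSpace ℝ V] {I : Set ℝ} {K : ℕ}

/-! ### Exponential sums and their jets -/

/-- The exponential sum `∑ exp (m s) q_m`. -/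
noncomputable def expSum (q : Fin K → V) (s : ℝ) : V := ∑ m : Fin K, Real.exp (m * s) • q m

theorem contDiff_expSum (q : Fin K → V) : ContDiff ℝ ∞ (expSum q) := by
  unfold expSum
  fun_prop

theorem iteratedDeriv_expSum (q : Fin K → V) (i : ℕ) (s : ℝ) :
    iteratedDeriv i (expSum q) s = ∑ m : Fin K, ((m : ℝ) ^ i * Real.exp (m * s)) • q m := by
  induction i generalizing s with
  | zero => simp [expSum]
  | succ i ih =>
    rw [iteratedDeriv_succ, funext ih]
    refine HasDerivAt.deriv ?_
    have : ∀ m : Fin K, HasDerivAt (fun s : ℝ => ((m : ℝ) ^ i * Real.exp (m * s)) • q m)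
        (((m : ℝ) ^ (i + 1) * Real.exp (m * s)) • q m) s := by
      intro m
      have h : HasDerivAt (fun s : ℝ => (m : ℝ) * s) (m : ℝ) s := by
        simpa using (hasDerivAt_id s).const_mul (m : ℝ)
      have := ((h.exp).const_mul ((m : ℝ) ^ i)).smul_const (q m)
      convert this using 2
      ring
    exact HasDerivAt.fun_sum fun m _ => this m

/-- The coefficients of an exponential sum recovered from the jet at `t` of its product with `l`. -/
noncomputable def expCoeff (l : ℝ → ℝ) (t : ℝ) (y : Fin K → V) (m : Fin K) : V :=
  Real.exp (-(m * t)) • ∑ i : Fin K, (Matrix.vandermonde (fun m : Fin K => (m : ℝ)))⁻¹ i m •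
    ∑ j ∈ Finset.range (i.val + 1), i.val.choose j •
      iteratedDeriv j (fun s => (l s)⁻¹) t • y ⟨i.val - j, (Nat.sub_le _ _).trans_lt i.2⟩

theorem contDiffOn_expCoeff (hI : IsOpen I) {l : ℝ → ℝ} (hl : ContDiff ℝ ∞ l)
    (hpos : ∀ t ∈ I, 0 < l t) :
    ContDiffOn ℝ ∞ (fun u : ℝ × (Fin K → V) => expCoeff l u.1 u.2) (I ×ˢ univ) := by
  have hinv : ContDiffOn ℝ ∞ (fun s => (l s)⁻¹) I := hl.contDiffOn.inv fun t ht => (hpos t ht).ne'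
  refine contDiffOn_pi.2 fun m => ?_
  unfold expCoeff
  refine ContDiffOn.smul (by fun_prop) (ContDiffOn.sum fun i _ => ContDiffOn.const_smul _ <|
    ContDiffOn.sum fun j _ => ContDiffOn.const_smul _ <| ContDiffOn.smul ?_ ?_)
  · exact (contDiffOn_iteratedDeriv hI hinv j).comp contDiffOn_fst fun u hu => hu.1
  · exact ((contDiff_apply ℝ V _).comp contDiff_snd).contDiffOn

/-- Multiplication by `1 / l` turns the jet of the product into the jet of the sum. The latter has
the entries `∑ m^i exp(m t) q_m`, a Vandermonde system in `exp(m t) q_m` with distinct nodes,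
invertible at every `t`. Hence these finitely many perturbations realise every jet at every point.
-/
theorem expCoeff_jet (hI : IsOpen I) {l : ℝ → ℝ} (hl : ContDiff ℝ ∞ l)
    (hpos : ∀ t ∈ I, 0 < l t) {t : ℝ} (ht : t ∈ I) (q : Fin K → V) :
    expCoeff l t (jet K (fun s => l s • expSum q s) t) = q := by
  have hinv : ContDiffOn ℝ ∞ (fun s => (l s)⁻¹) I := hl.contDiffOn.inv fun t ht => (hpos t ht).ne'
  have h1 : ∀ i : Fin K, ∑ j ∈ Finset.range (i.val + 1), i.val.choose j •
      iteratedDeriv j (fun s => (l s)⁻¹) t •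
        jet K (fun s => l s • expSum q s) t ⟨i.val - j, (Nat.sub_le _ _).trans_lt i.2⟩ =
      ∑ m : Fin K, (Matrix.vandermonde (fun m : Fin K => (m : ℝ)) m i * Real.exp (m * t)) • q m := by
    intro i
    have e := iteratedDeriv_smul_eq (n := i.val) (t := t) (b := fun s => (l s)⁻¹)
      (v := fun s => l s • expSum q s)
      ((hinv.contDiffAt (hI.mem_nhds ht)).of_le (mod_cast le_top))
      ((hl.smul (contDiff_expSum q)).contDiffAt.of_le (mod_cast le_top))
    unfold jet
    rw [← e]
    have e2 : EqOn (fun s => (l s)⁻¹ • l s • expSum q s) (expSum q) I := fun s hs => by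
      simp [smul_smul, inv_mul_cancel₀ (hpos s hs).ne']
    rw [e2.iteratedDeriv_of_isOpen hI _ ht, iteratedDeriv_expSum]
    rfl
  have hdet : IsUnit (Matrix.vandermonde (fun m : Fin K => (m : ℝ))).det := by
    rw [isUnit_iff_ne_zero, Matrix.det_vandermonde_ne_zero_iff]
    intro a b hab
    simp only [Nat.cast_inj] at hab
    exact Fin.ext hab
  funext m
  unfold expCoeff
  simp_rw [h1, Finset.smul_sum]
  rw [Finset.sum_comm]
  have h2 : ∀ n : Fin K, ∑ i : Fin K, Real.exp (-(m * t)) •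
      (Matrix.vandermonde (fun m : Fin K => (m : ℝ)))⁻¹ i m •
      (Matrix.vandermonde (fun m : Fin K => (m : ℝ)) n i * Real.exp (n * t)) • q n =
      if n = m then q n else 0 := by
    intro n
    have h3 : ∑ i, Matrix.vandermonde (fun m : Fin K => (m : ℝ)) n i *
        (Matrix.vandermonde (fun m : Fin K => (m : ℝ)))⁻¹ i m = (1 : Matrix _ _ ℝ) n m := by
      rw [← Matrix.mul_nonsing_inv _ hdet, Matrix.mul_apply]
    rw [← Finset.smul_sum]
    simp_rw [smul_smul]
    rw [← Finset.sum_smul, smul_smul]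
    have h4 : ∑ i, (Matrix.vandermonde (fun m : Fin K => (m : ℝ)))⁻¹ i m *
        (Matrix.vandermonde (fun m : Fin K => (m : ℝ)) n i * Real.exp (n * t)) =
        (1 : Matrix _ _ ℝ) n m * Real.exp (n * t) := by
      rw [← h3, Finset.sum_mul]
      exact Finset.sum_congr rfl fun i _ => by ring
    rw [h4]
    by_cases hnm : n = m
    · subst hnm
      simp [← Real.exp_add]
    · simp [hnm]
  simp_rw [h2]
  simp

/-! ### Thin sets of jets and transversality -/

/-- A set of `K`-jets at varying points of `I` is thin if its smooth images in the space of jets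
have codimension at least one. -/
def IsThin (I : Set ℝ) (B : Set (ℝ × (Fin K → V))) : Prop :=
  ∀ Ψ : ℝ × (Fin K → V) → (Fin K → V), ContDiffOn ℝ ∞ Ψ (I ×ˢ univ) →
    dimH (Ψ '' (B ∩ I ×ˢ univ)) ≤ (Module.finrank ℝ (Fin K → V) - 1 : ℕ)

theorem IsThin.iUnion {ι : Type*} [Countable ι] {B : ι → Set (ℝ × (Fin K → V))}
    (h : ∀ i, IsThin I (B i)) : IsThin I (⋃ i, B i) := by
  intro Ψ hΨ
  rw [iUnion_inter, image_iUnion, dimH_iUnion]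
  exact iSup_le fun i => h i Ψ hΨ

theorem IsThin.mono {B C : Set (ℝ × (Fin K → V))} (h : IsThin I B) (hCB : C ∩ I ×ˢ univ ⊆ B) :
    IsThin I C :=
  fun Ψ hΨ => (dimH_mono (image_mono (subset_inter hCB inter_subset_right))).trans (h Ψ hΨ)

theorem IsThin.union {B C : Set (ℝ × (Fin K → V))} (hB : IsThin I B) (hC : IsThin I C) :
    IsThin I (B ∪ C) := by
  intro Ψ hΨ
  rw [union_inter_distrib_right, image_union, dimH_union]
  exact max_le (hB Ψ hΨ) (hC Ψ hΨ)

/-- The image of a smooth map from a space of small dimension is thin. -/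
theorem IsThin.of_image {F : Type*} [NormedAddCommGroup F] [NormedSpace ℝ F]
    [FiniteDimensional ℝ F] (hI : IsOpen I) {S : Set F} (hS : IsOpen S)
    {φ : F → ℝ × (Fin K → V)} (hφ : ContDiffOn ℝ ∞ φ S) {B : Set (ℝ × (Fin K → V))}
    (hB : B ∩ I ×ˢ univ ⊆ φ '' S)
    (hd : Module.finrank ℝ F + 1 ≤ Module.finrank ℝ (Fin K → V)) : IsThin I B := by
  intro Ψ hΨ
  have hO : IsOpen (S ∩ φ ⁻¹' (I ×ˢ univ)) :=
    hφ.continuousOn.isOpen_inter_preimage hS (hI.prod isOpen_univ)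
  have hsub : Ψ '' (B ∩ I ×ˢ univ) ⊆ (Ψ ∘ φ) '' (S ∩ φ ⁻¹' (I ×ˢ univ)) := by
    rintro _ ⟨z, hz, rfl⟩
    obtain ⟨u, hu, rfl⟩ := hB hz
    exact ⟨u, ⟨hu, hz.2⟩, rfl⟩
  have hc : ContDiffOn ℝ ∞ (Ψ ∘ φ) (S ∩ φ ⁻¹' (I ×ˢ univ)) :=
    hΨ.comp (hφ.mono inter_subset_left) fun u hu => hu.2
  calc dimH (Ψ '' (B ∩ I ×ˢ univ)) ≤ dimH ((Ψ ∘ φ) '' (S ∩ φ ⁻¹' (I ×ˢ univ))) := dimH_mono hsub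
    -- Smooth maps are locally Lipschitz, so they do not raise the Hausdorff dimension.
    _ ≤ dimH (S ∩ φ ⁻¹' (I ×ˢ univ)) := by
      refine dimH_image_le_of_locally_lipschitzOn fun x hx => ?_
      obtain ⟨C, t, ht, hL⟩ :=
        ((hc.contDiffAt (hO.mem_nhds hx)).of_le (by simp : (1 : WithTop ℕ∞) ≤ ∞)
          ).exists_lipschitzOnWith
      exact ⟨C, t, mem_nhdsWithin_of_mem_nhds ht, hL⟩
    _ ≤ dimH (univ : Set F) := dimH_mono (subset_univ _)
    _ = Module.finrank ℝ F := Real.dimH_univ_eq_finrank F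
    _ ≤ _ := by exact_mod_cast Nat.le_sub_one_of_lt hd

/-- Every smooth curve has arbitrarily small perturbations in the strong topology whose jets avoid
a given thin set. -/
theorem exists_perturbation [FiniteDimensional ℝ V] (hI : IsOpen I) {v : ℝ → V}
    (hv : ContDiffOn ℝ ∞ v I) {B : Set (ℝ × (Fin K → V))} (hB : IsThin I B) (hK : 0 < Module.finrank ℝ (Fin K → V))
    {ε : ℝ → ℝ} (hε : ContinuousOn ε I) (hpos : ∀ t ∈ I, 0 < ε t) (k : ℕ) :
    ∃ w : ℝ → V, ContDiffOn ℝ ∞ w I ∧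
      (∀ t ∈ I, ∀ j ≤ k, ‖iteratedDeriv j w t - iteratedDeriv j v t‖ < ε t) ∧
      ∀ t ∈ I, (t, jet K w t) ∉ B := by
  -- The correction of `ε` absorbs the growth of the exponential sum: its `i`-th derivative is at
  -- most `K^i exp(K|t|) ∑ ‖q m‖`, and the Leibniz rule adds the powers up to `(1 + K)^j`.
  obtain ⟨l, hl, hlpos, hlε⟩ := exists_small_smooth hI
    (ε := fun t => ε t * (((1 : ℝ) + K) ^ k)⁻¹ * Real.exp (-(K * |t|))) (by fun_prop)
    (fun t ht => by have := hpos t ht; positivity) k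
  let w : (Fin K → V) → ℝ → V := fun q s => v s + l s • expSum q s
  have hp : ∀ q : Fin K → V, ContDiff ℝ ∞ (fun s => l s • expSum q s) := fun q =>
    hl.smul (contDiff_expSum q)
  have hder : ∀ q, ∀ t ∈ I, ∀ j, iteratedDeriv j (w q) t =
      iteratedDeriv j v t + iteratedDeriv j (fun s => l s • expSum q s) t := by
    intro q t ht j
    exact iteratedDeriv_add ((hv.contDiffAt (hI.mem_nhds ht)).of_le (mod_cast le_top))
      ((hp q).contDiffAt.of_le (mod_cast le_top))
  -- `Ψ (t, z)` is the only parameter `q` whose perturbed curve has the jet `z` at `t`. The bad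
  -- parameters thus lie in the image of the thin set, their dimension is too small to fill a ball,
  -- and a good `q` exists arbitrarily close to zero.
  let Ψ : ℝ × (Fin K → V) → (Fin K → V) := fun u => expCoeff l u.1 (u.2 - jet K v u.1)
  have hΨ : ContDiffOn ℝ ∞ Ψ (I ×ˢ univ) := by
    have h1 : ContDiffOn ℝ ∞ (fun u : ℝ × (Fin K → V) => (u.1, u.2 - jet K v u.1)) (I ×ˢ univ) :=
      contDiffOn_fst.prodMk (contDiffOn_snd.sub
        ((contDiffOn_jet hI hv K).comp contDiffOn_fst fun u hu => hu.1))
    have h2 := contDiffOn_expCoeff (K := K) (V := V) hI hl hlpos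
    exact ContDiffOn.comp (f := fun u : ℝ × (Fin K → V) => (u.1, u.2 - jet K v u.1)) h2 h1
      fun u hu => ⟨hu.1, mem_univ _⟩
  have hbad : {q | ∃ t ∈ I, (t, jet K (w q) t) ∈ B} ⊆ Ψ '' (B ∩ I ×ˢ univ) := by
    rintro q ⟨t, ht, hq⟩
    refine ⟨_, ⟨hq, ht, mem_univ _⟩, ?_⟩
    have : jet K (w q) t - jet K v t = jet K (fun s => l s • expSum q s) t := by
      funext i
      simp [jet, hder q t ht]
    simp only [Ψ, this]
    exact expCoeff_jet hI hl hlpos ht q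
  have hdim : dimH {q | ∃ t ∈ I, (t, jet K (w q) t) ∈ B} < Module.finrank ℝ (Fin K → V) :=
    ((dimH_mono hbad).trans (hB Ψ hΨ)).trans_lt (by exact_mod_cast Nat.sub_lt hK one_pos)
  obtain ⟨q, hq, hqs⟩ := (dense_compl_of_dimH_lt_finrank hdim).exists_dist_lt 0
    (show (0 : ℝ) < 1 / (K + 1) by positivity)
  refine ⟨w q, hv.add (hp q).contDiffOn, fun t ht j hj => ?_, fun t ht h => hq ⟨t, ht, h⟩⟩
  have hqn : ‖q‖ < 1 / (K + 1) := by simpa using hqs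
  have hsum : ∑ m, ‖q m‖ < 1 := by
    calc ∑ m, ‖q m‖ ≤ ∑ _m : Fin K, ‖q‖ := Finset.sum_le_sum fun m _ => norm_le_pi_norm q m
      _ = K * ‖q‖ := by simp
      _ ≤ (K + 1) * ‖q‖ := by nlinarith [norm_nonneg q]
      _ < 1 := by rw [lt_div_iff₀ (by positivity)] at hqn; linarith
  rw [hder q t ht, add_sub_cancel_left, iteratedDeriv_smul_eq
    (hl.contDiffAt.of_le (mod_cast le_top))
    ((contDiff_expSum q).contDiffAt.of_le (mod_cast le_top))]
  set e : ℝ := ε t * (((1 : ℝ) + K) ^ k)⁻¹ * Real.exp (-(K * |t|)) with he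
  have he0 : 0 < e := by have := hpos t ht; positivity
  have hterm : ∀ i, ‖iteratedDeriv i (expSum q) t‖ ≤
      (K : ℝ) ^ i * (Real.exp (K * |t|) * ∑ m, ‖q m‖) := by
    intro i
    rw [iteratedDeriv_expSum, Finset.mul_sum, Finset.mul_sum]
    refine (norm_sum_le _ _).trans (Finset.sum_le_sum fun m _ => ?_)
    rw [norm_smul, Real.norm_of_nonneg (by positivity), ← mul_assoc]
    have hm : (m : ℝ) ≤ K := by exact_mod_cast m.2.le
    have hmt : (m : ℝ) * t ≤ K * |t| :=
      (mul_le_mul_of_nonneg_left (le_abs_self t) m.val.cast_nonneg).trans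
        (mul_le_mul_of_nonneg_right hm (abs_nonneg t))
    gcongr
  calc ‖∑ i ∈ Finset.range (j + 1), j.choose i • iteratedDeriv i l t •
        iteratedDeriv (j - i) (expSum q) t‖
      ≤ ∑ i ∈ Finset.range (j + 1), (j.choose i : ℝ) * (e *
          ((K : ℝ) ^ (j - i) * (Real.exp (K * |t|) * ∑ m, ‖q m‖))) := by
        refine (norm_sum_le _ _).trans (Finset.sum_le_sum fun i hi => ?_)
        rw [← Nat.cast_smul_eq_nsmul ℝ, norm_smul, norm_smul, Real.norm_of_nonneg (by positivity)]
        have := hlε t ht i ((Nat.lt_succ_iff.1 (Finset.mem_range.1 hi)).trans hj)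
        gcongr
        · exact this
        · exact hterm _
    _ = e * ((1 + K : ℝ) ^ j * (Real.exp (K * |t|) * ∑ m, ‖q m‖)) := by
        generalize Real.exp (K * |t|) * ∑ m, ‖q m‖ = S
        rw [add_pow, Finset.sum_mul, Finset.mul_sum]
        exact Finset.sum_congr rfl fun i _ => by ring
    _ ≤ e * ((1 + K : ℝ) ^ k * (Real.exp (K * |t|) * ∑ m, ‖q m‖)) := by
        gcongr
        linarith [(Nat.cast_nonneg K : (0 : ℝ) ≤ K)]
    _ = ε t * ∑ m, ‖q m‖ := by
        rw [he, Real.exp_neg]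
        field_simp
    _ < ε t := by
        have := hpos t ht
        nlinarith

end Transversality

/-! ### Linear differential equations on an interval -/

section LinearODE

variable {V : Type*} [NormedAddCommGroup V] [NormedSpace ℝ V]

/-- The terms of the Peano–Baker series. -/
noncomputable def picardTerm (A : ℝ → V →L[ℝ] V) (t₀ : ℝ) (x₀ : V) : ℕ → ℝ → V
  | 0 => fun _ => x₀
  | n + 1 => fun t => ∫ s in t₀..t, A s (picardTerm A t₀ x₀ n s)

variable {A : ℝ → V →L[ℝ] V} {I : Set ℝ} {t₀ : ℝ}

theorem hasDerivAt_picardTerm_succ [CompleteSpace V] (hI : IsOpen I) (hIc : I.OrdConnected)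
    (hA : ContinuousOn A I)
    (ht₀ : t₀ ∈ I) (x₀ : V) {n : ℕ} (hn : ContinuousOn (picardTerm A t₀ x₀ n) I) {t : ℝ}
    (ht : t ∈ I) :
    HasDerivAt (picardTerm A t₀ x₀ (n + 1)) (A t (picardTerm A t₀ x₀ n t)) t := by
  have hc : ContinuousOn (fun s => A s (picardTerm A t₀ x₀ n s)) I := hA.clm_apply hn
  exact intervalIntegral.integral_hasDerivAt_right
    ((hc.mono (hIc.uIcc_subset ht₀ ht)).intervalIntegrable)
    (hc.stronglyMeasurableAtFilter hI t ht) (hc.continuousAt (hI.mem_nhds ht))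

theorem continuousOn_picardTerm [CompleteSpace V] (hI : IsOpen I) (hIc : I.OrdConnected)
    (hA : ContinuousOn A I)
    (ht₀ : t₀ ∈ I) (x₀ : V) (n : ℕ) : ContinuousOn (picardTerm A t₀ x₀ n) I := by
  induction n with
  | zero => exact continuousOn_const
  | succ n ih => exact fun t ht =>
      (hasDerivAt_picardTerm_succ hI hIc hA ht₀ x₀ ih ht).continuousAt.continuousWithinAt

/-- Each iterated integral of a power of `|s - t₀|` contributes a factor to the factorial, which
makes the series converge whatever the bound on `A`. -/
theorem norm_picardTerm_le (x₀ : V) {S : Set ℝ} (hS : S.OrdConnected)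
    (ht₀ : t₀ ∈ S) {C : ℝ} (hC : 0 ≤ C) (hAC : ∀ t ∈ S, ‖A t‖ ≤ C) (n : ℕ) {t : ℝ} (ht : t ∈ S) :
    ‖picardTerm A t₀ x₀ n t‖ ≤ ‖x₀‖ * (C * |t - t₀|) ^ n / n.factorial := by
  induction n generalizing t with
  | zero => simp [picardTerm]
  | succ n ih =>
    have hsub : uIoc t₀ t ⊆ S := uIoc_subset_uIcc.trans (hS.uIcc_subset ht₀ ht)
    have hgc : Continuous fun s : ℝ => C * ‖x₀‖ * C ^ n / n.factorial * |s - t₀| ^ n := by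
      fun_prop
    calc ‖picardTerm A t₀ x₀ (n + 1) t‖
        ≤ |∫ s in t₀..t, C * ‖x₀‖ * C ^ n / n.factorial * |s - t₀| ^ n| := by
          refine intervalIntegral.norm_integral_le_abs_of_norm_le ?_ (hgc.intervalIntegrable _ _)
          refine (ae_restrict_iff' measurableSet_uIoc).2 (ae_of_all _ fun s hs => ?_)
          calc _ ≤ ‖A s‖ * ‖picardTerm A t₀ x₀ n s‖ := (A s).le_opNorm _
            _ ≤ C * (‖x₀‖ * (C * |s - t₀|) ^ n / n.factorial) :=
              mul_le_mul (hAC s (hsub hs)) (ih (hsub hs)) (norm_nonneg _) hC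
            _ = _ := by rw [mul_pow]; ring
      _ = C * ‖x₀‖ * C ^ n / n.factorial * (|t - t₀| ^ (n + 1) / (n + 1)) := by
          rw [intervalIntegral.integral_const_mul, abs_mul, intervalIntegral.abs_intervalIntegral_eq,
            integral_pow_abs_sub_uIoc, abs_of_nonneg (by positivity), abs_of_nonneg (by positivity)]
      _ = ‖x₀‖ * (C * |t - t₀|) ^ (n + 1) / (n + 1).factorial := by
          rw [Nat.factorial_succ]
          push_cast
          field_simp
          ring

/-- Solutions of linear differential equations exist on the whole interval of definition. -/
theorem exists_linear_solution [CompleteSpace V] (hI : IsOpen I) (hIc : I.OrdConnected)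
    (hA : ContinuousOn A I)
    (ht₀ : t₀ ∈ I) (x₀ : V) :
    ∃ x : ℝ → V, x t₀ = x₀ ∧ ∀ t ∈ I, HasDerivAt x (A t (x t)) t := by
  have hc := continuousOn_picardTerm hI hIc hA ht₀ x₀
  have h0 : ∀ n, picardTerm A t₀ x₀ (n + 1) t₀ = 0 := fun n => by simp [picardTerm]
  refine ⟨fun t => x₀ + ∑' n, picardTerm A t₀ x₀ (n + 1) t, by simp [h0], fun t ht => ?_⟩
  -- `A` need not be bounded on `I`. It is bounded on a compact interval containing `t₀` and `t` in
  -- its interior, and there the series can be differentiated term by term.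
  obtain ⟨a, b, hab, ht₀ab, htab⟩ : ∃ a b, Icc a b ⊆ I ∧ t₀ ∈ Ioo a b ∧ t ∈ Ioo a b := by
    have hmin : min t₀ t ∈ I := by rcases min_choice t₀ t with h | h <;> rw [h] <;> assumption
    have hmax : max t₀ t ∈ I := by rcases max_choice t₀ t with h | h <;> rw [h] <;> assumption
    obtain ⟨d, hd, hdI⟩ := Metric.isOpen_iff.1 hI _ hmin
    obtain ⟨e, he, heI⟩ := Metric.isOpen_iff.1 hI _ hmax
    refine ⟨min t₀ t - d / 2, max t₀ t + e / 2, hIc.out (hdI ?_) (heI ?_), ⟨?_, ?_⟩, ⟨?_, ?_⟩⟩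
    · simp [abs_of_pos hd, hd]
    · simp [abs_of_pos he, he]
    · linarith [min_le_left t₀ t]
    · linarith [le_max_left t₀ t]
    · linarith [min_le_right t₀ t]
    · linarith [le_max_right t₀ t]
  obtain ⟨C, hC⟩ := isCompact_Icc.exists_bound_of_continuousOn (hA.mono hab)
  have hC0 : 0 ≤ C := (norm_nonneg _).trans (hC t₀ (Ioo_subset_Icc_self ht₀ab))
  have hle := fun n (y : ℝ) (hy : y ∈ Ioo a b) => norm_picardTerm_le (A := A) x₀ ordConnected_Icc
    (Ioo_subset_Icc_self ht₀ab) hC0 hC n (Ioo_subset_Icc_self hy)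
  let u : ℕ → ℝ := fun n => ‖x₀‖ * ((C * (b - a)) ^ n / n.factorial)
  have hu : Summable u := (Real.summable_pow_div_factorial _).mul_left _
  have hlu : ∀ n, ∀ y ∈ Ioo a b, ‖picardTerm A t₀ x₀ n y‖ ≤ u n := by
    intro n y hy
    refine (hle n y hy).trans ?_
    have : |y - t₀| ≤ b - a := by
      rw [abs_le]
      constructor <;> linarith [hy.1, hy.2, ht₀ab.1, ht₀ab.2]
    simp only [u]
    rw [← mul_div_assoc]
    gcongr
  have hs : ∀ y ∈ Ioo a b, Summable fun n => picardTerm A t₀ x₀ n y := fun y hy =>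
    .of_norm_bounded hu fun n => hlu n y hy
  have hder := hasDerivAt_tsum_of_isPreconnected (𝕜 := ℝ) (hu.mul_left C) isOpen_Ioo
    isPreconnected_Ioo (g := fun n => picardTerm A t₀ x₀ (n + 1))
    (g' := fun n y => A y (picardTerm A t₀ x₀ n y))
    (fun n y hy => hasDerivAt_picardTerm_succ hI hIc hA ht₀ x₀ (hc n)
      (hab (Ioo_subset_Icc_self hy)))
    (fun n y hy => ((A y).le_opNorm _).trans (mul_le_mul (hC y (Ioo_subset_Icc_self hy))
      (hlu n y hy) (norm_nonneg _) hC0)) ht₀ab (by simp [h0, summable_zero]) htab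
  have hsum : ∑' n, A t (picardTerm A t₀ x₀ n t) =
      A t (x₀ + ∑' n, picardTerm A t₀ x₀ (n + 1) t) := by
    rw [← (A t).map_tsum (hs t htab), (hs t htab).tsum_eq_zero_add]
    rfl
  rw [← hsum]
  exact hder.const_add x₀

/-- Bootstrapping: a solution of class `C^n` has a derivative `A x` of class `C^n`. -/
theorem contDiffOn_linear_solution (hI : IsOpen I) (hA : ContDiffOn ℝ ∞ A I) {x : ℝ → V}
    (hx : ∀ t ∈ I, HasDerivAt x (A t (x t)) t) : ContDiffOn ℝ ∞ x I := by
  rw [contDiffOn_infty]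
  intro n
  induction n with
  | zero => exact contDiffOn_zero.2 fun t ht => (hx t ht).continuousAt.continuousWithinAt
  | succ n ih =>
    rw [Nat.cast_add, Nat.cast_one, contDiffOn_succ_iff_deriv_of_isOpen hI]
    refine ⟨fun t ht => (hx t ht).differentiableAt.differentiableWithinAt, by simp, ?_⟩
    exact ((hA.of_le (mod_cast le_top)).clm_apply ih).congr fun t ht => (hx t ht).deriv

end LinearODE

/-- A function with vanishing derivative on an open interval is constant. -/
theorem eq_of_hasDerivAt_zero {W : Type*} [NormedAddCommGroup W] [NormedSpace ℝ W] {I : Set ℝ}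
    (hI : IsOpen I) (hIc : I.OrdConnected) {f : ℝ → W} (hf : ∀ t ∈ I, HasDerivAt f 0 t) {s t : ℝ}
    (hs : s ∈ I) (ht : t ∈ I) : f s = f t :=
  hI.is_const_of_deriv_eq_zero hIc.isPreconnected
    (fun x hx => (hf x hx).differentiableAt.differentiableWithinAt) (fun x hx => (hf x hx).deriv)
    hs ht

/-! ### Initial spans of sequences of vectors -/

section InitialSpan

variable {V : Type*} [AddCommGroup V] [Module ℝ V]

/-- The span of the first `k` vectors of a sequence. -/
def initSpan (v : ℕ → V) (k : ℕ) : Submodule ℝ V := Submodule.span ℝ (v '' Iio k)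

theorem initSpan_zero (v : ℕ → V) : initSpan v 0 = ⊥ := by simp [initSpan]

theorem initSpan_succ (v : ℕ → V) (k : ℕ) :
    initSpan v (k + 1) = initSpan v k ⊔ Submodule.span ℝ {v k} := by
  rw [initSpan, initSpan, ← Submodule.span_union, ← image_singleton, ← image_union]
  congr 2
  ext i
  simp

theorem initSpan_mono (v : ℕ → V) {k l : ℕ} (h : k ≤ l) : initSpan v k ≤ initSpan v l :=
  Submodule.span_mono (image_mono (Iio_subset_Iio h))

theorem mem_initSpan (v : ℕ → V) {i k : ℕ} (h : i < k) : v i ∈ initSpan v k :=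
  Submodule.subset_span ⟨i, h, rfl⟩

/-- After the `d` leading zeros, the passage from `v` to `u` is triangular with nonzero diagonal
entries, hence invertible on each initial span. -/
theorem initSpan_eq_of_triangular {u v : ℕ → V} {d : ℕ} (h0 : ∀ j < d, u j = 0)
    (h : ∀ j, ∃ c : ℝ, c ≠ 0 ∧ u (j + d) - c • v j ∈ initSpan v j) (k : ℕ) :
    initSpan u (k + d) = initSpan v k := by
  induction k with
  | zero =>
    rw [zero_add, initSpan_zero, initSpan, Submodule.span_eq_bot]
    rintro _ ⟨j, hj, rfl⟩
    exact h0 j hj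
  | succ k ih =>
    rw [Nat.add_right_comm, initSpan_succ, initSpan_succ, ih]
    obtain ⟨c, hc, hm⟩ := h k
    refine le_antisymm (sup_le le_sup_left ?_) (sup_le le_sup_left ?_) <;>
      rw [Submodule.span_singleton_le_iff_mem]
    · rw [← sub_add_cancel (u (k + d)) (c • v k)]
      exact add_mem (Submodule.mem_sup_left hm) (Submodule.mem_sup_right
        (Submodule.smul_mem _ _ (Submodule.mem_span_singleton_self _)))
    · have : v k = c⁻¹ • (u (k + d) - (u (k + d) - c • v k)) := by
        rw [sub_sub_cancel, smul_smul, inv_mul_cancel₀ hc, one_smul]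
      rw [this]
      exact Submodule.smul_mem _ _ (sub_mem (Submodule.mem_sup_right
        (Submodule.mem_span_singleton_self _)) (Submodule.mem_sup_left hm))

theorem finrank_sup_span_singleton_le [FiniteDimensional ℝ V] (S : Submodule ℝ V) (x : V) :
    Module.finrank ℝ (S ⊔ Submodule.span ℝ {x} : Submodule ℝ V) ≤ Module.finrank ℝ S + 1 :=
  (Submodule.finrank_add_le_finrank_add_finrank _ _).trans
    (Nat.add_le_add_left ((finrank_span_le_card {x}).trans (by simp)) _)

theorem finrank_initSpan_add_le [FiniteDimensional ℝ V] (v : ℕ → V) (k m : ℕ) :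
    Module.finrank ℝ (initSpan v (k + m)) ≤ Module.finrank ℝ (initSpan v k) + m := by
  induction m with
  | zero => rfl
  | succ m ih =>
    rw [← add_assoc, initSpan_succ]
    exact (finrank_sup_span_singleton_le _ _).trans (by omega)

theorem finrank_initSpan_le [FiniteDimensional ℝ V] (v : ℕ → V) (k : ℕ) :
    Module.finrank ℝ (initSpan v k) ≤ k := by
  have := finrank_initSpan_add_le v 0 k
  rwa [initSpan_zero, finrank_bot, zero_add] at this

/-- A new vector raises the dimension by at most one, so maximal dimension at `n` leaves no room for
a defect at an earlier stage. -/
theorem finrank_initSpan_of_le [FiniteDimensional ℝ V] {v : ℕ → V} {n : ℕ}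
    (h : n ≤ Module.finrank ℝ (initSpan v n)) {k : ℕ}
    (hk : k ≤ n) : Module.finrank ℝ (initSpan v k) = k := by
  have h1 := finrank_initSpan_add_le v k (n - k)
  rw [Nat.add_sub_cancel' hk] at h1
  have := finrank_initSpan_le v k
  omega

end InitialSpan

/-! ### The determinant of a curve -/

section FrameForm

/-- The determinant of `1 + p` vectors of `R^{1+p}`. -/
noncomputable def frameForm (p : ℕ) : ContinuousMultilinearMap ℝ (fun _ : Fin (1 + p) => E p) ℝ where
  toMultilinearMap := (EuclideanSpace.basisFun (Fin (1 + p)) ℝ).toBasis.det.toMultilinearMap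
  cont := by
    change Continuous fun w => (EuclideanSpace.basisFun (Fin (1 + p)) ℝ).toBasis.det w
    simp_rw [Module.Basis.det_apply]
    refine Continuous.matrix_det (continuous_matrix fun i j => ?_)
    simp only [Module.Basis.toMatrix_apply, OrthonormalBasis.coe_toBasis_repr_apply,
      EuclideanSpace.basisFun_repr]
    fun_prop

theorem frameForm_apply {p : ℕ} (w : Fin (1 + p) → E p) :
    frameForm p w = (EuclideanSpace.basisFun (Fin (1 + p)) ℝ).toBasis.det w := rfl

theorem frameForm_ne_zero_iff {p : ℕ} (w : Fin (1 + p) → E p) :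
    frameForm p w ≠ 0 ↔ Submodule.span ℝ (range w) = ⊤ := by
  rw [frameForm_apply, ← isUnit_iff_ne_zero, ← Module.Basis.is_basis_iff_det]
  refine ⟨fun h => h.2, fun h => ⟨?_, h⟩⟩
  exact linearIndependent_of_top_le_span_of_card_eq_finrank h.ge (by simp)

/-- The determinant of the first `1 + p` vectors of a sequence. -/
noncomputable def frameDet {p : ℕ} (v : ℕ → E p) : ℝ := frameForm p fun j => v j

/-- The determinant of the first `1 + p` vectors of a sequence with the last one replaced by its
successor. -/
noncomputable def frameDetSucc {p : ℕ} (v : ℕ → E p) : ℝ :=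
  frameForm p fun j => v (if j.val = p then p + 1 else j)

theorem frameDet_ne_zero_iff {p : ℕ} (v : ℕ → E p) :
    frameDet v ≠ 0 ↔ initSpan v (1 + p) = ⊤ := by
  rw [frameDet, frameForm_ne_zero_iff, initSpan]
  have : range (fun j : Fin (1 + p) => v j) = v '' Iio (1 + p) := by
    ext x
    constructor
    · rintro ⟨j, rfl⟩
      exact ⟨j, j.2, rfl⟩
    · rintro ⟨j, hj, rfl⟩
      exact ⟨⟨j, hj⟩, rfl⟩
  rw [this]

theorem frameDetSucc_ne_zero_iff {p : ℕ} (v : ℕ → E p) :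
    frameDetSucc v ≠ 0 ↔ initSpan v p ⊔ Submodule.span ℝ {v (p + 1)} = ⊤ := by
  rw [frameDetSucc, frameForm_ne_zero_iff, initSpan, ← Submodule.span_union]
  have : range (fun j : Fin (1 + p) => v (if j.val = p then p + 1 else j)) =
      v '' Iio p ∪ {v (p + 1)} := by
    ext x
    constructor
    · rintro ⟨j, rfl⟩
      by_cases h : j.val = p
      · simp [h]
      · left
        simp only [h, if_false]
        exact ⟨j, by simp; omega, rfl⟩
    · rintro (⟨j, hj, rfl⟩ | rfl)
      · have hj : j < p := hj
        exact ⟨⟨j, by omega⟩, by simp [hj.ne]⟩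
      · exact ⟨⟨p, by omega⟩, by simp⟩
  rw [this]

/-- Differentiating any column but the last one produces a copy of the next column, and the
determinant vanishes; only the last column contributes. -/
theorem hasDerivAt_frameDet {p : ℕ} {I : Set ℝ} (hI : IsOpen I) {τ : ℝ → E p}
    (hτ : ContDiffOn ℝ ∞ τ I) {t : ℝ} (ht : t ∈ I) :
    HasDerivAt (fun s => frameDet fun j => iteratedDeriv j τ s)
      (frameDetSucc fun j => iteratedDeriv j τ t) t := by
  have h1 : HasDerivAt (fun s => fun j : Fin (1 + p) => iteratedDeriv j τ s)
      (fun j : Fin (1 + p) => iteratedDeriv (j + 1) τ t) t :=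
    hasDerivAt_pi.2 fun j => hasDerivAt_iteratedDeriv hI hτ ht j
  have h2 := ((frameForm p).hasFDerivAt (fun j : Fin (1 + p) => iteratedDeriv j τ t)).comp_hasDerivAt
    t h1
  refine HasDerivAt.congr_deriv h2 ?_
  rw [ContinuousMultilinearMap.linearDeriv_apply, frameDetSucc,
    Finset.sum_eq_single (⟨p, by omega⟩ : Fin (1 + p))]
  · congr 1
    funext j
    by_cases h : j.val = p
    · have : j = ⟨p, by omega⟩ := Fin.ext h
      simp [this]
    · have : j ≠ ⟨p, by omega⟩ := fun h' => h (by rw [h'])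
      simp [h, Function.update_of_ne this]
  · intro j _ hj
    have hjp : j.val ≠ p := fun h => hj (Fin.ext h)
    rw [frameForm_apply]
    refine AlternatingMap.map_eq_zero_of_eq _ _ (i := j) (j := ⟨j + 1, by omega⟩) ?_ ?_
    · rw [Function.update_self, Function.update_of_ne]
      simp [Fin.ext_iff]
    · simp [Fin.ext_iff]
  · simp

end FrameForm

/-! ### Types of curves -/

theorem rank_wronskianMatrix {p : ℕ} (f : ℝ → E p) (k : ℕ) (t : ℝ) :
    (wronskianMatrix f k t).rank =
      Module.finrank ℝ (initSpan (fun j => iteratedDeriv (j + 1) f t) k) := by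
  let e := WithLp.linearEquiv 2 ℝ (Fin (1 + p) → ℝ)
  have h : range (wronskianMatrix f k t).col =
      e '' ((fun j => iteratedDeriv (j + 1) f t) '' Iio k) := by
    ext x
    constructor
    · rintro ⟨j, rfl⟩
      exact ⟨_, ⟨j, j.2, rfl⟩, rfl⟩
    · rintro ⟨_, ⟨j, hj, rfl⟩, rfl⟩
      exact ⟨⟨j, hj⟩, rfl⟩
  rw [Matrix.rank_eq_finrank_span_cols, h, initSpan]
  have := LinearEquiv.finrank_map_eq e
    (Submodule.span ℝ ((fun j => iteratedDeriv (j + 1) f t) '' Iio k))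
  rw [← this, Submodule.map_span]
  rfl

/-! ### Derivatives of the product of a function and a curve -/

section TypeOfProduct

variable {V : Type*} [NormedAddCommGroup V] [NormedSpace ℝ V] {I : Set ℝ} {t : ℝ} {b : ℝ → ℝ}
  {τ : ℝ → V} {d : ℕ}

/-- In the Leibniz formula for order `j + d`, the terms with fewer than `d` derivatives on `b`
vanish, the term with exactly `d` is a nonzero multiple of `τ^(j)`, and the others contain lower
derivatives of `τ`. The case `d = 0` shows that rescaling a curve preserves the initial spans. -/
theorem initSpan_smul (hI : IsOpen I) (ht : t ∈ I) (hb : ContDiffOn ℝ ∞ b I)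
    (hτ : ContDiffOn ℝ ∞ τ I) (h0 : ∀ i < d, iteratedDeriv i b t = 0)
    (hd : iteratedDeriv d b t ≠ 0) (k : ℕ) :
    initSpan (fun j => iteratedDeriv j (fun s => b s • τ s) t) (k + d) =
      initSpan (fun j => iteratedDeriv j τ t) k := by
  have hL : ∀ n, iteratedDeriv n (fun s => b s • τ s) t = ∑ i ∈ Finset.range (n + 1),
      n.choose i • iteratedDeriv i b t • iteratedDeriv (n - i) τ t := fun n =>
    iteratedDeriv_smul_eq ((hb.contDiffAt (hI.mem_nhds ht)).of_le (mod_cast le_top))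
      ((hτ.contDiffAt (hI.mem_nhds ht)).of_le (mod_cast le_top))
  refine initSpan_eq_of_triangular (fun j hj => ?_) (fun j => ?_) k
  · rw [hL]
    refine Finset.sum_eq_zero fun i hi => ?_
    rw [h0 i ((Nat.lt_succ_iff.1 (Finset.mem_range.1 hi)).trans_lt hj)]
    simp
  · refine ⟨(j + d).choose d * iteratedDeriv d b t, mul_ne_zero ?_ hd, ?_⟩
    · exact_mod_cast (Nat.choose_pos (Nat.le_add_left d j)).ne'
    · have hmem : d ∈ Finset.range (j + d + 1) := by simp
      rw [hL, ← Finset.add_sum_erase _ _ hmem, Nat.add_sub_cancel, ← Nat.cast_smul_eq_nsmul ℝ,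
        smul_smul, add_sub_cancel_left]
      refine Submodule.sum_mem _ fun i hi => ?_
      rw [Finset.mem_erase] at hi
      rcases hi.1.lt_or_gt with h | h
      · rw [h0 i h]
        simp
      · refine Submodule.smul_of_tower_mem _ _ (Submodule.smul_mem _ _ ?_)
        have := Finset.mem_range.1 hi.2
        exact mem_initSpan (fun j => iteratedDeriv j τ t) (by omega)

theorem iteratedDeriv_succ_of_hasDerivAt (hI : IsOpen I) (ht : t ∈ I) {g : ℝ → V} {w : ℝ → V}
    (hg : ∀ s ∈ I, HasDerivAt g (w s) s) (j : ℕ) :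
    iteratedDeriv (j + 1) g t = iteratedDeriv j w t := by
  rw [iteratedDeriv_succ']
  exact EqOn.iteratedDeriv_of_isOpen (fun s hs => (hg s hs).deriv) hI j ht

end TypeOfProduct

section Types

variable {p : ℕ} {I : Set ℝ} {t : ℝ} {b : ℝ → ℝ} {τ g : ℝ → E p} {d : ℕ}

/-- The truncated subtraction is intended: for `k ≤ d` the first `k` derivatives of `g` vanish and
the rank is zero. -/
theorem rank_wronskianMatrix_of_hasDerivAt (hI : IsOpen I) (ht : t ∈ I) (hb : ContDiffOn ℝ ∞ b I)
    (hτ : ContDiffOn ℝ ∞ τ I) (hg : ∀ s ∈ I, HasDerivAt g (b s • τ s) s)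
    (h0 : ∀ i < d, iteratedDeriv i b t = 0) (hd : iteratedDeriv d b t ≠ 0) (k : ℕ) :
    (wronskianMatrix g k t).rank =
      Module.finrank ℝ (initSpan (fun j => iteratedDeriv j τ t) (k - d)) := by
  have h := initSpan_smul hI ht hb hτ h0 hd
  rw [rank_wronskianMatrix, funext (iteratedDeriv_succ_of_hasDerivAt hI ht hg)]
  rcases le_total d k with hk | hk
  · rw [← h (k - d), Nat.sub_add_cancel hk]
  · have h1 := h 0
    rw [zero_add, initSpan_zero] at h1
    have h2 := initSpan_mono (fun j => iteratedDeriv j (fun s => b s • τ s) t) hk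
    rw [h1, le_bot_iff] at h2
    rw [h2, Nat.sub_eq_zero_of_le hk, initSpan_zero]

theorem isOfType_of_initSpan_eq_top {v : ℕ → E p}
    (h : ∀ k, (wronskianMatrix g k t).rank = Module.finrank ℝ (initSpan v (k - d)))
    (htop : initSpan v (1 + p) = ⊤) : IsOfType g (fun i => i.val + 1 + d) t := by
  intro i
  have hn : 1 + p ≤ Module.finrank ℝ (initSpan v (1 + p)) := by rw [htop]; simp
  refine ⟨?_, fun k hk => ?_⟩
  · rw [mem_ofPred_eq, h, Nat.add_sub_cancel, finrank_initSpan_of_le hn (by omega)]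
  · rw [mem_ofPred_eq, h] at hk
    have := finrank_initSpan_le v (k - d)
    change i.val + 1 + d ≤ k
    omega

/-- The first `p` vectors are independent, the next one adds nothing, and the one after it completes
the space: the rank stalls at `p` for exactly one step. -/
theorem isOfType_of_initSpan_sup_eq_top {v : ℕ → E p}
    (h : ∀ k, (wronskianMatrix g k t).rank = Module.finrank ℝ (initSpan v (k - d)))
    (htop : initSpan v p ⊔ Submodule.span ℝ {v (p + 1)} = ⊤) (hne : initSpan v (1 + p) ≠ ⊤) :
    IsOfType g (fun i => if i.val = p then p + 2 + d else i.val + 1 + d) t := by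
  intro i
  have hn : p ≤ Module.finrank ℝ (initSpan v p) := by
    have := finrank_sup_span_singleton_le (initSpan v p) (v (p + 1))
    rw [htop, finrank_top, finrank_euclideanSpace_fin] at this
    omega
  have htop' : initSpan v (p + 2) = ⊤ := by
    rw [eq_top_iff, ← htop]
    refine sup_le (initSpan_mono v (by omega)) ?_
    rw [Submodule.span_singleton_le_iff_mem]
    exact mem_initSpan v (by omega)
  by_cases hi : i.val = p
  · simp only [hi, if_true]
    refine ⟨?_, fun k hk => ?_⟩
    · rw [mem_ofPred_eq, h, Nat.add_sub_cancel, htop', finrank_top, finrank_euclideanSpace_fin,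
        add_comm]
    · rw [mem_ofPred_eq, h] at hk
      by_contra hlt
      have hle : initSpan v (k - d) ≤ initSpan v (1 + p) := initSpan_mono v (by omega)
      have h2 := Submodule.finrank_mono hle
      refine hne (Submodule.eq_top_of_finrank_eq (le_antisymm (Submodule.finrank_le _) ?_))
      rw [finrank_euclideanSpace_fin]
      omega
  · simp only [hi, if_false]
    refine ⟨?_, fun k hk => ?_⟩
    · rw [mem_ofPred_eq, h, Nat.add_sub_cancel, finrank_initSpan_of_le hn (by omega)]
    · rw [mem_ofPred_eq, h] at hk
      have := finrank_initSpan_le v (k - d)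
      omega

theorem IsOfType.unique {A B : Fin (1 + p) → ℕ} (hA : IsOfType g A t) (hB : IsOfType g B t) :
    A = B :=
  funext fun i => (hA i).unique (hB i)

end Types

/-! ### Normal derivatives in terms of jets -/

section NormalDerivatives

variable {V : Type*} [NormedAddCommGroup V] [InnerProductSpace ℝ V] {K : ℕ}

/-- The derivative of the normalisation `σ / ‖σ‖` in terms of `σ` and `σ'`. -/
noncomputable def unitDeriv (x y : V) : V := ‖x‖⁻¹ • y - (inner ℝ x y * ‖x‖⁻¹ ^ 3) • x

/-- The scale of `σ''` with respect to the normal curvature, in terms of `σ` and `σ'`. -/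
noncomputable def curvScale (x y : V) : ℝ := ‖x‖ * ‖unitDeriv x y‖ ^ 2

theorem hasDerivAt_normalize {σ : ℝ → V} {σ' : V} {t : ℝ} (h : HasDerivAt σ σ' t) (h0 : σ t ≠ 0) :
    HasDerivAt (fun s => ‖σ s‖⁻¹ • σ s) (unitDeriv (σ t) σ') t := by
  have hn : ‖σ t‖ ≠ 0 := norm_ne_zero_iff.2 h0
  have h1 : HasDerivAt (fun s => ‖σ s‖) (inner ℝ (σ t) σ' / ‖σ t‖) t := by
    have h2 := (h.norm_sq).sqrt (by positivity)
    simp only [Real.sqrt_sq (norm_nonneg _)] at h2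
    convert h2 using 1
    field_simp
  refine ((h1.fun_inv hn).fun_smul h).congr_deriv ?_
  rw [unitDeriv, sub_eq_add_neg, ← neg_smul]
  congr 2
  field_simp

theorem inner_unitDeriv_left {x : V} (hx : x ≠ 0) (y : V) : inner ℝ x (unitDeriv x y) = 0 := by
  have hn : ‖x‖ ≠ 0 := norm_ne_zero_iff.2 hx
  rw [unitDeriv, inner_sub_right, inner_smul_right, inner_smul_right, real_inner_self_eq_norm_sq]
  field_simp
  ring

theorem eq_unitDeriv {x : V} (hx : x ≠ 0) (y : V) :
    y = ‖x‖ • unitDeriv x y + (inner ℝ x y * ‖x‖⁻¹ ^ 2) • x := by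
  have hn : ‖x‖ ≠ 0 := norm_ne_zero_iff.2 hx
  rw [unitDeriv, smul_sub, smul_smul, smul_smul, mul_inv_cancel₀ hn, one_smul]
  have : ‖x‖ * (inner ℝ x y * ‖x‖⁻¹ ^ 3) = inner ℝ x y * ‖x‖⁻¹ ^ 2 := by field_simp
  rw [this, sub_add_cancel]

/-- Positivity of this number allows solving `⟨ν, σ'⟩' = 0` for the coefficient of the derivative of
a parallel normal `ν`. -/
theorem inner_unitDeriv_right {x : V} (hx : x ≠ 0) (y : V) :
    inner ℝ (unitDeriv x y) y = curvScale x y := by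
  conv_lhs => rw [eq_unitDeriv hx y]
  have h1 : unitDeriv x (‖x‖ • unitDeriv x y + (inner ℝ x y * ‖x‖⁻¹ ^ 2) • x) = unitDeriv x y := by
    rw [← eq_unitDeriv hx y]
  have h2 : inner ℝ (unitDeriv x y) x = 0 := by
    rw [real_inner_comm, inner_unitDeriv_left hx]
  rw [h1, inner_add_right, inner_smul_right, inner_smul_right, real_inner_self_eq_norm_sq, h2,
    curvScale]
  ring

/-- The open set of jets whose two first entries are linearly independent. -/
def IsRegularJet (z : Fin (K + 2) → V) : Prop := z 0 ≠ 0 ∧ unitDeriv (z 0) (z 1) ≠ 0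

theorem curvScale_pos {x y : V} (hx : x ≠ 0) (hy : unitDeriv x y ≠ 0) : 0 < curvScale x y := by
  unfold curvScale
  positivity

theorem contDiffAt_unitDeriv {u : V × V} (hu : u.1 ≠ 0) :
    ContDiffAt ℝ ∞ (fun u : V × V => unitDeriv u.1 u.2) u := by
  unfold unitDeriv
  have h1 : ContDiffAt ℝ ∞ (fun u : V × V => ‖u.1‖⁻¹) u :=
    (contDiffAt_fst.norm ℝ hu).inv (norm_ne_zero_iff.2 hu)
  exact (h1.smul contDiffAt_snd).sub
    (((contDiffAt_fst.inner ℝ contDiffAt_snd).mul (h1.pow 3)).smul contDiffAt_fst)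

theorem contDiffAt_curvScale_inv {u : V × V} (hu : u.1 ≠ 0) (hu' : unitDeriv u.1 u.2 ≠ 0) :
    ContDiffAt ℝ ∞ (fun u : V × V => (curvScale u.1 u.2)⁻¹) u := by
  refine ContDiffAt.inv ?_ (curvScale_pos hu hu').ne'
  exact (contDiffAt_fst.norm ℝ hu).mul ((contDiffAt_unitDeriv hu).norm_sq ℝ)

theorem contDiff_entries (i j : Fin K) :
    ContDiff ℝ ∞ (fun z : Fin K → V => (z i, z j)) :=
  (contDiff_apply ℝ V i).prodMk (contDiff_apply ℝ V j)

theorem isOpen_isRegularJet (K : ℕ) : IsOpen {z : Fin (K + 2) → V | IsRegularJet z} := by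
  have h0 : IsOpen {u : V × V | u.1 ≠ 0} := isOpen_ne_fun continuous_fst continuous_const
  have h1 : IsOpen ({u : V × V | u.1 ≠ 0} ∩ (fun u : V × V => unitDeriv u.1 u.2) ⁻¹' {0}ᶜ) :=
    ContinuousOn.isOpen_inter_preimage
      (fun u hu => (contDiffAt_unitDeriv hu).continuousAt.continuousWithinAt) h0
      isOpen_compl_singleton
  exact h1.preimage (contDiff_entries (K := K + 2) (V := V) 0 1).continuous

/-- The second derivative, scaled so that its normal part is the normal curvature divided by the
speed. -/
noncomputable def normalCurv (z : Fin 3 → V) : V := (curvScale (z 0) (z 1))⁻¹ • z 2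

/-- The normal derivative of a function of jets with values in the ambient space. -/
noncomputable def normalDeriv (T : (Fin (K + 3) → V) → V) (z : Fin (K + 4) → V) : V :=
  totalDeriv T z - inner ℝ (unitDeriv (z 0) (z 1)) (T fun i => z i.castSucc) •
    (curvScale (z 0) (z 1))⁻¹ • z 2

theorem IsRegularJet.init {z : Fin (K + 3) → V} (hz : IsRegularJet z) :
    IsRegularJet (fun i : Fin (K + 2) => z i.castSucc) := hz

theorem contDiffAt_unitDeriv_jet {z : Fin (K + 2) → V} (hz : IsRegularJet z) :
    ContDiffAt ℝ ∞ (fun z : Fin (K + 2) → V => unitDeriv (z 0) (z 1)) z :=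
  ContDiffAt.comp z (g := fun u : V × V => unitDeriv u.1 u.2)
    (contDiffAt_unitDeriv (u := (z 0, z 1)) hz.1) (contDiff_entries 0 1).contDiffAt

theorem contDiffAt_curvScale_inv_jet {z : Fin (K + 2) → V} (hz : IsRegularJet z) :
    ContDiffAt ℝ ∞ (fun z : Fin (K + 2) → V => (curvScale (z 0) (z 1))⁻¹) z :=
  ContDiffAt.comp z (g := fun u : V × V => (curvScale u.1 u.2)⁻¹)
    (contDiffAt_curvScale_inv (u := (z 0, z 1)) hz.1 hz.2) (contDiff_entries 0 1).contDiffAt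

theorem contDiffAt_normalCurv {z : Fin 3 → V} (hz : IsRegularJet z) :
    ContDiffAt ℝ ∞ (normalCurv (V := V)) z :=
  (contDiffAt_curvScale_inv_jet hz).smul (contDiff_apply ℝ V 2).contDiffAt

theorem contDiff_init (K : ℕ) :
    ContDiff ℝ ∞ (fun (z : Fin (K + 1) → V) (i : Fin K) => z i.castSucc) :=
  contDiff_pi.2 fun i => contDiff_apply ℝ V i.castSucc

theorem contDiffAt_normalDeriv [FiniteDimensional ℝ V] {T : (Fin (K + 3) → V) → V}
    (hT : ∀ z, IsRegularJet z → ContDiffAt ℝ ∞ T z) {z : Fin (K + 4) → V} (hz : IsRegularJet z) :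
    ContDiffAt ℝ ∞ (normalDeriv T) z := by
  have h1 : ContDiffAt ℝ ∞ (fun z : Fin (K + 4) → V => T fun i => z i.castSucc) z :=
    ContDiffAt.comp z (hT _ hz.init) (contDiff_init (K + 3)).contDiffAt
  exact (contDiffAt_totalDeriv (hT _ hz.init)).sub
    (((contDiffAt_unitDeriv_jet hz).inner ℝ h1).smul
      ((contDiffAt_curvScale_inv_jet hz).smul (contDiff_apply ℝ V 2).contDiffAt))

/-- `T` is, up to a smooth function of the jet of lower order, the derivative of top order with
the factor of `normalCurv`. -/
def HasTopTerm (T : (Fin (K + 3) → V) → V) : Prop :=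
  ∃ L : (Fin (K + 2) → V) → V, (∀ z, IsRegularJet z → ContDiffAt ℝ ∞ L z) ∧
    ∀ z, IsRegularJet z →
      T z = (curvScale (z 0) (z 1))⁻¹ • z (Fin.last _) + L fun i => z i.castSucc

theorem hasTopTerm_normalCurv : HasTopTerm (K := 0) (normalCurv (V := V)) :=
  ⟨0, fun _ _ => contDiffAt_const, fun z _ => by simp [normalCurv]⟩

/-- The total derivative replaces the top entry by the next one with the same factor. The derivative
of the factor, the total derivative of `L` and the correction along `normalCurv` involve only lower
entries. This makes each condition on a normal derivative solvable for the highest derivative of the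
curve. -/
theorem HasTopTerm.normalDeriv [FiniteDimensional ℝ V] {T : (Fin (K + 3) → V) → V}
    (h : HasTopTerm T) : HasTopTerm (K := K + 1) (normalDeriv T) := by
  obtain ⟨L, hL, hT⟩ := h
  let F : V × V → ℝ := fun u => (curvScale u.1 u.2)⁻¹
  refine ⟨fun y => fderiv ℝ F (y 0, y 1) (y 1, y 2) • y (Fin.last _) + totalDeriv L y -
    inner ℝ (unitDeriv (y 0) (y 1)) ((curvScale (y 0) (y 1))⁻¹ • y (Fin.last _) +
      L fun i => y i.castSucc) • (curvScale (y 0) (y 1))⁻¹ • y 2, fun y hy => ?_, fun z hz => ?_⟩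
  · have h1 : ContDiffAt ℝ ∞ (fun z : Fin (K + 3) → V => L fun i => z i.castSucc) y :=
      ContDiffAt.comp y (hL _ hy.init) (contDiff_init (K + 2)).contDiffAt
    have h2 : ContDiffAt ℝ ∞ (fderiv ℝ F) (y 0, y 1) :=
      (contDiffAt_curvScale_inv (u := (y 0, y 1)) hy.1 hy.2).fderiv_right (by simp)
    have h3 : ContDiffAt ℝ ∞ (fun y : Fin (K + 3) → V => fderiv ℝ F (y 0, y 1)) y :=
      ContDiffAt.comp y h2 (contDiff_entries 0 1).contDiffAt
    have h4 : ContDiffAt ℝ ∞ (fun y : Fin (K + 3) → V => y (Fin.last _)) y :=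
      (contDiff_apply ℝ V _).contDiffAt
    have h5 := contDiffAt_curvScale_inv_jet hy
    exact (((h3.clm_apply (contDiff_entries 1 2).contDiffAt).smul h4).add
      (contDiffAt_totalDeriv (hL _ hy.init))).sub
      (((contDiffAt_unitDeriv_jet hy).inner ℝ ((h5.smul h4).add h1)).smul
        (h5.smul (contDiff_apply ℝ V 2).contDiffAt))
  · have hz' : IsRegularJet (fun i : Fin (K + 3) => z i.castSucc) := hz
    have hev : T =ᶠ[𝓝 fun i : Fin (K + 3) => z i.castSucc] fun y =>
        F (y 0, y 1) • y (Fin.last _) + L fun i => y i.castSucc :=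
      Filter.eventually_of_mem ((isOpen_isRegularJet (K + 1)).mem_nhds hz') fun y hy => hT y hy
    have d1 : HasFDerivAt (fun y : Fin (K + 3) → V => (y 0, y 1))
        ((ContinuousLinearMap.proj (R := ℝ) (φ := fun _ : Fin (K + 3) => V) 0).prod
          (ContinuousLinearMap.proj (R := ℝ) (φ := fun _ : Fin (K + 3) => V) 1))
        (fun i : Fin (K + 3) => z i.castSucc) :=
      (hasFDerivAt_apply 0 _).prodMk (hasFDerivAt_apply 1 _)
    have d2 : HasFDerivAt F (fderiv ℝ F (z 0, z 1)) (z 0, z 1) :=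
      ((contDiffAt_curvScale_inv (u := (z 0, z 1)) hz.1 hz.2).differentiableAt
        (by simp)).hasFDerivAt
    have d3 := HasFDerivAt.comp (fun i : Fin (K + 3) => z i.castSucc)
      (f := fun y : Fin (K + 3) → V => (y 0, y 1)) (g := F) d2 d1
    have d4 : HasFDerivAt (fun y : Fin (K + 3) → V => y (Fin.last (K + 2)))
        (ContinuousLinearMap.proj (R := ℝ) (φ := fun _ : Fin (K + 3) => V) (Fin.last (K + 2)))
        (fun i : Fin (K + 3) => z i.castSucc) := hasFDerivAt_apply _ _
    have d5 : HasFDerivAt (fun (y : Fin (K + 3) → V) (i : Fin (K + 2)) => y i.castSucc)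
        (ContinuousLinearMap.pi fun i : Fin (K + 2) =>
          ContinuousLinearMap.proj (R := ℝ) (φ := fun _ : Fin (K + 3) => V) i.castSucc)
        (fun i : Fin (K + 3) => z i.castSucc) :=
      hasFDerivAt_pi.2 fun i => hasFDerivAt_apply _ _
    have d6 := HasFDerivAt.comp (fun i : Fin (K + 3) => z i.castSucc)
      (f := fun (y : Fin (K + 3) → V) (i : Fin (K + 2)) => y i.castSucc) (g := L)
      ((hL _ hz'.init).differentiableAt (by simp)).hasFDerivAt d5
    have d7 := ((d3.smul d4).add d6).congr_of_eventuallyEq hev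
    rw [TangentParallel.normalDeriv, totalDeriv, d7.fderiv, hT _ hz']
    simp only [add_apply, smul_apply,
      ContinuousLinearMap.smulRight_apply, ContinuousLinearMap.comp_apply,
      ContinuousLinearMap.prod_apply, ContinuousLinearMap.proj_apply, Function.comp]
    have e : (fderiv ℝ L fun i => z i.castSucc.castSucc)
        ((ContinuousLinearMap.pi fun i : Fin (K + 2) =>
          ContinuousLinearMap.proj (R := ℝ) (φ := fun _ : Fin (K + 3) => V) i.castSucc)
          fun i => z i.succ) = totalDeriv L fun i => z i.castSucc := rfl
    rw [e]
    simp only [Fin.succ_last, Fin.succ_zero_eq_one, F, Fin.succ_one_eq_two]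
    have e0 : z (Fin.castSucc 0) = z 0 := rfl
    have e1 : z (Fin.castSucc 1) = z 1 := rfl
    have e2 : z (Fin.castSucc 2) = z 2 := rfl
    rw [e0, e1, e2]
    abel

end NormalDerivatives

/-! ### Parallel normal curves -/

section ParallelNormal

variable {V : Type*} [NormedAddCommGroup V] [InnerProductSpace ℝ V] {K : ℕ} {I : Set ℝ}
  {σ ν : ℝ → V} {t : ℝ}

/-- The curve `σ` and its derivative are linearly independent at `t`. -/
def IsRegularAt (σ : ℝ → V) (t : ℝ) : Prop := σ t ≠ 0 ∧ unitDeriv (σ t) (deriv σ t) ≠ 0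

theorem jet_zero (K : ℕ) (σ : ℝ → V) (t : ℝ) : jet (K + 2) σ t 0 = σ t := by simp [jet]

theorem jet_one (K : ℕ) (σ : ℝ → V) (t : ℝ) : jet (K + 2) σ t 1 = deriv σ t := by
  simp [jet]

theorem IsRegularAt.isRegularJet (h : IsRegularAt σ t) (K : ℕ) :
    IsRegularJet (jet (K + 2) σ t) := by
  rwa [IsRegularJet, jet_zero, jet_one]

/-- A smooth normal field `ν` along the tangent planes `span (σ, σ')` which is parallel for the
normal connection. -/
structure IsParallelNormal (I : Set ℝ) (σ ν : ℝ → V) : Prop where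
  contDiffOn : ContDiffOn ℝ ∞ ν I
  inner_curve : ∀ t ∈ I, inner ℝ (ν t) (σ t) = 0
  inner_deriv : ∀ t ∈ I, inner ℝ (ν t) (deriv σ t) = 0
  exists_hasDerivAt : ∀ t ∈ I, ∃ x : ℝ, HasDerivAt ν (x • unitDeriv (σ t) (deriv σ t)) t

/-- The component in the direction of `ν` of a vector-valued function `T` of the jets of `σ`. -/
noncomputable def normalComp (T : (Fin K → V) → V) (σ ν : ℝ → V) (t : ℝ) : ℝ :=
  inner ℝ (ν t) (T (jet K σ t))

/-- Differentiating `⟨ν, σ'⟩ = 0` determines the unknown coefficient of `ν'`. -/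
theorem IsParallelNormal.hasDerivAt (h : IsParallelNormal I σ ν) (hI : IsOpen I)
    (hσ : ContDiffOn ℝ ∞ σ I) (ht : t ∈ I) (hreg : IsRegularAt σ t) :
    HasDerivAt ν (-normalComp normalCurv σ ν t • unitDeriv (σ t) (deriv σ t)) t := by
  obtain ⟨x, hx⟩ := h.exists_hasDerivAt t ht
  have h1 := hx.inner ℝ (hasDerivAt_of_contDiffOn hI (contDiffOn_deriv hI hσ) ht)
  have h2 : HasDerivAt (fun s => inner ℝ (ν s) (deriv σ s)) 0 t :=
    (hasDerivAt_const t (0 : ℝ)).congr_of_eventuallyEq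
      (Filter.eventually_of_mem (hI.mem_nhds ht) fun s hs => h.inner_deriv s hs)
  have h3 := h1.unique h2
  have hpos := curvScale_pos hreg.1 hreg.2
  rw [inner_smul_left, inner_unitDeriv_right hreg.1] at h3
  have h4 : normalComp normalCurv σ ν t =
      (curvScale (σ t) (deriv σ t))⁻¹ * inner ℝ (ν t) (deriv (deriv σ) t) := by
    have e : jet 3 σ t 2 = deriv (deriv σ) t := by
      simp [jet, iteratedDeriv_succ]
    rw [normalComp, normalCurv, inner_smul_right, e]
    rw [jet_zero 1, jet_one 1]
  have h5 : x = -normalComp normalCurv σ ν t := by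
    rw [h4, eq_neg_iff_add_eq_zero]
    simp only [conj_trivial] at h3
    field_simp
    linarith
  rwa [← h5]

/-- Since `ν' = -⟨ν, normalCurv⟩ u` with `u = unitDeriv σ σ'`, the term `⟨ν', T⟩` equals `-⟨u, T⟩
⟨ν, normalCurv⟩`, again the component along `ν` of a function of jets. This explains the correction
term in `normalDeriv` and frees all derivatives of the curvature from the jets of `ν`. -/
theorem IsParallelNormal.hasDerivAt_normalComp (h : IsParallelNormal I σ ν) (hI : IsOpen I)
    (hσ : ContDiffOn ℝ ∞ σ I) (ht : t ∈ I) (hreg : IsRegularAt σ t) {T : (Fin (K + 3) → V) → V}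
    (hT : ∀ z, IsRegularJet z → ContDiffAt ℝ ∞ T z) :
    HasDerivAt (normalComp T σ ν) (normalComp (normalDeriv T) σ ν t) t := by
  have h1 := (h.hasDerivAt hI hσ ht hreg).inner ℝ
    (hasDerivAt_comp_jet hI hσ ht (hT _ (hreg.isRegularJet (K + 1))))
  refine HasDerivAt.congr_deriv h1 ?_
  have e : (fun i : Fin (K + 3) => jet (K + 4) σ t i.castSucc) = jet (K + 3) σ t := rfl
  have e0 := jet_zero (K + 2) σ t
  have e1 := jet_one (K + 2) σ t
  have e2 : jet (K + 4) σ t 2 = jet 3 σ t 2 := by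
    simp [jet, Nat.mod_eq_of_lt (show 2 < K + 4 by omega)]
  have e3 := jet_zero 1 σ t
  have e4 := jet_one 1 σ t
  rw [normalComp, normalComp, normalDeriv, normalCurv, e, e0, e1, e2, e3, e4, inner_sub_right,
    inner_smul_left]
  simp only [conj_trivial, inner_smul_right]
  ring

theorem contDiffOn_normalComp (hν : ContDiffOn ℝ ∞ ν I) (hI : IsOpen I)
    (hσ : ContDiffOn ℝ ∞ σ I) (hreg : ∀ t ∈ I, IsRegularAt σ t) {T : (Fin (K + 2) → V) → V}
    (hT : ∀ z, IsRegularJet z → ContDiffAt ℝ ∞ T z) : ContDiffOn ℝ ∞ (normalComp T σ ν) I :=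
  hν.inner ℝ fun t ht => (ContDiffAt.comp t (hT _ ((hreg t ht).isRegularJet K))
    ((contDiffOn_jet hI hσ (K + 2)).contDiffAt (hI.mem_nhds ht))).contDiffWithinAt

/-- The first normal derivative of `normalCurv`. -/
noncomputable def normalCurvDeriv : (Fin 4 → V) → V := normalDeriv (K := 0) normalCurv

/-- The second normal derivative of `normalCurv`. -/
noncomputable def normalCurvDeriv₂ : (Fin 5 → V) → V := normalDeriv (K := 1) normalCurvDeriv

/-- The third normal derivative of `normalCurv`. -/
noncomputable def normalCurvDeriv₃ : (Fin 6 → V) → V := normalDeriv (K := 2) normalCurvDeriv₂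

variable [FiniteDimensional ℝ V]

theorem contDiffAt_normalCurvDeriv (z : Fin 4 → V) (hz : IsRegularJet z) :
    ContDiffAt ℝ ∞ (normalCurvDeriv (V := V)) z :=
  contDiffAt_normalDeriv (K := 0) (fun _ => contDiffAt_normalCurv) hz

theorem contDiffAt_normalCurvDeriv₂ (z : Fin 5 → V) (hz : IsRegularJet z) :
    ContDiffAt ℝ ∞ (normalCurvDeriv₂ (V := V)) z :=
  contDiffAt_normalDeriv (K := 1) contDiffAt_normalCurvDeriv hz

theorem contDiffAt_normalCurvDeriv₃ (z : Fin 6 → V) (hz : IsRegularJet z) :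
    ContDiffAt ℝ ∞ (normalCurvDeriv₃ (V := V)) z :=
  contDiffAt_normalDeriv (K := 2) contDiffAt_normalCurvDeriv₂ hz

theorem hasTopTerm_normalCurvDeriv : HasTopTerm (K := 1) (normalCurvDeriv (V := V)) :=
  hasTopTerm_normalCurv.normalDeriv

theorem hasTopTerm_normalCurvDeriv₂ : HasTopTerm (K := 2) (normalCurvDeriv₂ (V := V)) :=
  hasTopTerm_normalCurvDeriv.normalDeriv

end ParallelNormal

/-! ### Orthonormal frames of the normal spaces -/

section NormalFrames

variable {p : ℕ}

theorem finrank_span_pair {a b : E p} (ha : a ≠ 0) (hb : b ≠ 0) (hab : inner ℝ a b = 0) :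
    Module.finrank ℝ (Submodule.span ℝ {a, b}) = 2 := by
  have h : LinearIndependent ℝ ![a, b] := by
    refine linearIndependent_of_ne_zero_of_inner_eq_zero (𝕜 := ℝ) (fun i => ?_) fun i j hij => ?_
    · fin_cases i
      · exact ha
      · exact hb
    · fin_cases i <;> fin_cases j
      · exact absurd rfl hij
      · exact hab
      · exact (real_inner_comm _ _).trans hab
      · exact absurd rfl hij
  have hr : range ![a, b] = {a, b} := by
    rw [Matrix.range_cons, Matrix.range_cons, Matrix.range_empty, union_empty, singleton_union]
  rw [← hr, finrank_span_eq_card h, Fintype.card_fin]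

theorem finrank_orthogonal_pair {a b : E p} (ha : a ≠ 0) (hb : b ≠ 0) (hab : inner ℝ a b = 0) :
    Module.finrank ℝ (Submodule.span ℝ {a, b})ᗮ = p - 1 := by
  have h1 := Submodule.finrank_add_finrank_orthogonal (Submodule.span ℝ {a, b})
  rw [finrank_span_pair ha hb hab, finrank_euclideanSpace_fin] at h1
  omega

theorem mem_orthogonal_pair {a b x : E p} :
    x ∈ (Submodule.span ℝ {a, b})ᗮ ↔ inner ℝ x a = 0 ∧ inner ℝ x b = 0 := by
  rw [Submodule.mem_orthogonal']
  refine ⟨fun h => ⟨h a (Submodule.subset_span (by simp)), h b (Submodule.subset_span (by simp))⟩,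
    fun h u hu => ?_⟩
  obtain ⟨c, d, rfl⟩ := Submodule.mem_span_pair.1 hu
  rw [inner_add_right, inner_smul_right, inner_smul_right, h.1, h.2]
  simp

theorem exists_orthonormal_orthogonal_pair {a b : E p} (ha : a ≠ 0) (hb : b ≠ 0)
    (hab : inner ℝ a b = 0) :
    ∃ n : Fin (p - 1) → E p, Orthonormal ℝ n ∧ ∀ i, inner ℝ (n i) a = 0 ∧ inner ℝ (n i) b = 0 := by
  let B := (stdOrthonormalBasis ℝ (Submodule.span ℝ {a, b})ᗮ).reindex
    (finCongr (finrank_orthogonal_pair ha hb hab))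
  refine ⟨fun i => B i, ?_, fun i => mem_orthogonal_pair.1 (B i).2⟩
  exact B.orthonormal.comp_linearIsometry (Submodule.span ℝ {a, b})ᗮ.subtypeₗᵢ

/-- By dimension the `p - 1` orthonormal vectors span the whole orthogonal complement of the plane,
and the double orthogonal complement is the plane. -/
theorem mem_span_pair_of_orthogonal {a b : E p} (ha : a ≠ 0) (hb : b ≠ 0) (hab : inner ℝ a b = 0)
    {n : Fin (p - 1) → E p} (hn : Orthonormal ℝ n)
    (hnab : ∀ i, inner ℝ (n i) a = 0 ∧ inner ℝ (n i) b = 0) {x : E p}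
    (hx : ∀ i, inner ℝ (n i) x = 0) : x ∈ Submodule.span ℝ {a, b} := by
  have h1 : Submodule.span ℝ (range n) = (Submodule.span ℝ {a, b})ᗮ := by
    refine Submodule.eq_of_le_of_finrank_eq ?_ ?_
    · rw [Submodule.span_le]
      rintro _ ⟨i, rfl⟩
      exact mem_orthogonal_pair.2 (hnab i)
    · rw [finrank_span_eq_card hn.linearIndependent, finrank_orthogonal_pair ha hb hab,
        Fintype.card_fin]
  rw [← Submodule.orthogonal_orthogonal (Submodule.span ℝ {a, b}), ← h1,
    Submodule.mem_orthogonal]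
  intro u hu
  induction hu using Submodule.span_induction with
  | mem u hu => obtain ⟨i, rfl⟩ := hu; exact hx i
  | zero => simp
  | add u v _ _ hu hv => rw [inner_add_left, hu, hv, add_zero]
  | smul c u _ hu => rw [inner_smul_left, hu, mul_zero]

/-- Frames of parallel normal curves along a regular unit curve. -/
theorem exists_parallel_frame {I : Set ℝ} (hI : IsOpen I) (hIc : I.OrdConnected)
    (hne : I.Nonempty) {τ : ℝ → E p} (hτ : ContDiffOn ℝ ∞ τ I) (hn : ∀ t ∈ I, ‖τ t‖ = 1)
    (hd : ∀ t ∈ I, deriv τ t ≠ 0) :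
    ∃ ν : Fin (p - 1) → ℝ → E p, (∀ i, IsParallelNormal I τ (ν i)) ∧
      ∀ t ∈ I, Orthonormal ℝ fun i => ν i t := by
  obtain ⟨t₀, ht₀⟩ := hne
  have hder := fun t ht => hasDerivAt_of_contDiffOn hI hτ (t := t) ht
  have hder2 := fun t ht => hasDerivAt_of_contDiffOn hI (contDiffOn_deriv hI hτ) (t := t) ht
  have horth : ∀ t ∈ I, inner ℝ (τ t) (deriv τ t) = 0 := by
    intro t ht
    have h1 := (hder t ht).norm_sq
    have h2 : HasDerivAt (fun s => ‖τ s‖ ^ 2) 0 t :=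
      (hasDerivAt_const t (1 : ℝ)).congr_of_eventuallyEq
        (Filter.eventually_of_mem (hI.mem_nhds ht) fun s hs => by simp [hn s hs])
    have := h1.unique h2
    linarith
  have h0 : ∀ t ∈ I, τ t ≠ 0 := fun t ht h => by simpa [h] using hn t ht
  have hunit : ∀ t ∈ I, unitDeriv (τ t) (deriv τ t) = deriv τ t := by
    intro t ht
    simp [unitDeriv, hn t ht, horth t ht]
  -- The equation is `ν' = -‖τ'‖⁻² ⟨ν, τ''⟩ τ'`, which is forced if `ν'` is to be parallel to `τ'`
  -- and `ν` orthogonal to `τ'`. Along solutions `⟨ν, τ'⟩` is constant, hence zero; then so is `⟨ν,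
  -- τ⟩`; and then the inner products of two solutions are constant.
  let A : ℝ → E p →L[ℝ] E p := fun t =>
    (-(‖deriv τ t‖ ^ 2)⁻¹) • (innerSL ℝ (deriv (deriv τ) t)).smulRight (deriv τ t)
  have hA : ContDiffOn ℝ ∞ A I := by
    have h1 := contDiffOn_deriv hI hτ
    have h2 := contDiffOn_deriv hI h1
    refine ContDiffOn.smul (((h1.norm_sq ℝ).inv fun t ht => ?_).neg) ?_
    · have := norm_pos_iff.2 (hd t ht)
      positivity
    · exact ((innerSL ℝ).contDiff.comp_contDiffOn h2).smulRight h1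
  obtain ⟨n, hno, hnt⟩ := exists_orthonormal_orthogonal_pair (h0 t₀ ht₀) (hd t₀ ht₀) (horth t₀ ht₀)
  choose ν hν0 hν using fun i => exists_linear_solution hI hIc hA.continuousOn ht₀ (n i)
  have hAν : ∀ i t, A t (ν i t) =
      (-(‖deriv τ t‖ ^ 2)⁻¹ * inner ℝ (ν i t) (deriv (deriv τ) t)) • deriv τ t := by
    intro i t
    simp only [A, smul_apply, ContinuousLinearMap.smulRight_apply, innerSL_apply_apply, smul_smul]
    rw [real_inner_comm]
  have hder1 : ∀ i, ∀ t ∈ I, inner ℝ (ν i t) (deriv τ t) = 0 := by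
    intro i t ht
    have : ∀ t ∈ I, HasDerivAt (fun s => inner ℝ (ν i s) (deriv τ s)) 0 t := by
      intro t ht
      refine ((hν i t ht).inner ℝ (hder2 t ht)).congr_deriv ?_
      have := norm_pos_iff.2 (hd t ht)
      rw [hAν, inner_smul_left, real_inner_self_eq_norm_sq]
      simp only [conj_trivial]
      field_simp
      ring
    rw [eq_of_hasDerivAt_zero hI hIc this ht ht₀, hν0]
    exact (hnt i).2
  have hcur : ∀ i, ∀ t ∈ I, inner ℝ (ν i t) (τ t) = 0 := by
    intro i t ht
    have : ∀ t ∈ I, HasDerivAt (fun s => inner ℝ (ν i s) (τ s)) 0 t := by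
      intro t ht
      refine ((hν i t ht).inner ℝ (hder t ht)).congr_deriv ?_
      rw [hAν, inner_smul_left, hder1 i t ht,
        real_inner_comm (τ t) (deriv τ t), horth t ht]
      simp
    rw [eq_of_hasDerivAt_zero hI hIc this ht ht₀, hν0]
    exact (hnt i).1
  refine ⟨ν, fun i => ⟨contDiffOn_linear_solution hI hA (hν i), hcur i, hder1 i, fun t ht => ?_⟩,
    fun t ht => ?_⟩
  · refine ⟨-(‖deriv τ t‖ ^ 2)⁻¹ * inner ℝ (ν i t) (deriv (deriv τ) t), ?_⟩
    rw [hunit t ht, ← hAν]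
    exact hν i t ht
  · rw [orthonormal_iff_ite]
    intro i j
    have : ∀ t ∈ I, HasDerivAt (fun s => inner ℝ (ν i s) (ν j s)) 0 t := by
      intro t ht
      refine ((hν i t ht).inner ℝ (hν j t ht)).congr_deriv ?_
      rw [hAν, hAν, inner_smul_left, inner_smul_right, hder1 i t ht,
        real_inner_comm (ν j t) (deriv τ t), hder1 j t ht]
      simp
    have h2 := eq_of_hasDerivAt_zero hI hIc this ht ht₀
    simp only [hν0] at h2
    rw [h2]
    exact orthonormal_iff_ite.1 hno i j

end NormalFrames

/-! ### Normalisation of curves -/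

section Normalisation

variable {V : Type*} [NormedAddCommGroup V] [InnerProductSpace ℝ V]
  {I : Set ℝ}

/-- The normalisation `σ / ‖σ‖` of a curve. -/
noncomputable def normalize (σ : ℝ → V) (t : ℝ) : V := ‖σ t‖⁻¹ • σ t

/-- The derivative of order `j` of the normalisation as a function of the jet. -/
noncomputable def normalizeJet : (j : ℕ) → (Fin (j + 1) → V) → V
  | 0 => fun z => ‖z 0‖⁻¹ • z 0
  | j + 1 => totalDeriv (normalizeJet j)

theorem contDiffAt_normalizeJet [FiniteDimensional ℝ V] (j : ℕ)
    {z : Fin (j + 1) → V} (hz : z 0 ≠ 0) :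
    ContDiffAt ℝ ∞ (normalizeJet j) z := by
  induction j with
  | zero =>
    have h : ContDiffAt ℝ ∞ (fun z : Fin 1 → V => z 0) z := (contDiff_apply ℝ V 0).contDiffAt
    exact ((h.norm ℝ hz).inv (norm_ne_zero_iff.2 hz)).smul h
  | succ j ih => exact contDiffAt_totalDeriv (ih hz)

theorem contDiffOn_normalize {σ : ℝ → V} (hσ : ContDiffOn ℝ ∞ σ I) (h0 : ∀ t ∈ I, σ t ≠ 0) :
    ContDiffOn ℝ ∞ (normalize σ) I :=
  ((hσ.norm ℝ h0).inv fun t ht => norm_ne_zero_iff.2 (h0 t ht)).smul hσ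

theorem iteratedDeriv_normalize [FiniteDimensional ℝ V] (hI : IsOpen I) {σ : ℝ → V}
    (hσ : ContDiffOn ℝ ∞ σ I)
    (h0 : ∀ t ∈ I, σ t ≠ 0) (j : ℕ) {t : ℝ} (ht : t ∈ I) :
    iteratedDeriv j (normalize σ) t = normalizeJet j (jet (j + 1) σ t) := by
  induction j generalizing t with
  | zero => simp [normalizeJet, normalize, jet]
  | succ j ih =>
    have h1 : EqOn (iteratedDeriv j (normalize σ)) (fun s => normalizeJet j (jet (j + 1) σ s)) I :=
      fun s hs => ih hs
    have h2 : jet (j + 1) σ t 0 ≠ 0 := by simpa [jet] using h0 t ht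
    have h3 := hasDerivAt_comp_jet hI hσ ht (contDiffAt_normalizeJet j h2)
    rw [iteratedDeriv_succ, (h3.congr_of_eventuallyEq
      (h1.eventuallyEq_of_mem (hI.mem_nhds ht))).deriv]
    rfl

/-- The normalisation is continuous at unit curves for the strong topology. -/
theorem exists_normalize_tube [FiniteDimensional ℝ V] (hI : IsOpen I) {τ : ℝ → V}
    (hτ : ContDiffOn ℝ ∞ τ I)
    (hn : ∀ t ∈ I, ‖τ t‖ = 1) {ε : ℝ → ℝ} (hε : ContinuousOn ε I) (hpos : ∀ t ∈ I, 0 < ε t)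
    (k : ℕ) :
    ∃ η : ℝ → ℝ, ContinuousOn η I ∧ (∀ t ∈ I, 0 < η t) ∧ ∀ σ : ℝ → V, ContDiffOn ℝ ∞ σ I →
      (∀ t ∈ I, ∀ j ≤ k, ‖iteratedDeriv j σ t - iteratedDeriv j τ t‖ < η t) →
      (∀ t ∈ I, σ t ≠ 0) ∧
      ∀ t ∈ I, ∀ j ≤ k, ‖iteratedDeriv j (normalize σ) t - iteratedDeriv j τ t‖ < ε t := by
  let r : (j : Fin (k + 1)) → (Fin (k + 1) → V) → (Fin (j.val + 1) → V) :=
    fun j z i => z (Fin.castLE (by omega) i)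
  have hr : ∀ j, Continuous (r j) := fun j => by fun_prop
  let S : Set (ℝ × (Fin (k + 1) → V)) := {u | u.1 ∈ I ∧ u.2 0 ≠ 0}
  have hS : IsOpen S := (hI.preimage continuous_fst).inter
    (isOpen_ne_fun ((continuous_apply 0).comp continuous_snd) continuous_const)
  -- Positivity of `G j` says that the `j`-th derivative of the normalisation is within `ε` of that
  -- of `τ`. This is an open condition on the jet, and the jet of `τ` satisfies it because a unit
  -- curve is its own normalisation.
  let G : Fin (k + 1) → ℝ × (Fin (k + 1) → V) → ℝ := fun j u =>
    ε u.1 - ‖normalizeJet j (r j u.2) - iteratedDeriv j τ u.1‖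
  have hG : ∀ j, ContinuousOn (G j) S := by
    intro j
    have h1 : ContinuousOn (fun u : ℝ × (Fin (k + 1) → V) => normalizeJet j (r j u.2)) S := by
      intro u hu
      have h2 : (r j u.2) 0 ≠ 0 := hu.2
      exact (ContinuousAt.comp (f := fun u : ℝ × (Fin (k + 1) → V) => r j u.2)
        (contDiffAt_normalizeJet j h2).continuousAt
        ((hr j).comp continuous_snd).continuousAt).continuousWithinAt
    have h3 : ContinuousOn (fun u : ℝ × (Fin (k + 1) → V) => iteratedDeriv j τ u.1) S :=
      (contDiffOn_iteratedDeriv hI hτ j).continuousOn.comp continuousOn_fst fun u hu => hu.1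
    exact (hε.comp continuousOn_fst fun u hu => hu.1).sub (h1.sub h3).norm
  have hO : IsOpen (⋂ j, S ∩ G j ⁻¹' Ioi 0) :=
    isOpen_iInter_of_finite fun j => (hG j).isOpen_inter_preimage hS isOpen_Ioi
  have h0 : ∀ t ∈ I, τ t ≠ 0 := fun t ht h => by simpa [h] using hn t ht
  have hid : EqOn (normalize τ) τ I := fun t ht => by simp [normalize, hn t ht]
  obtain ⟨η, hηc, hηp, hη⟩ := exists_tube (contDiffOn_jet hI hτ (k + 1)).continuousOn hO
    (fun t ht => by
      refine mem_iInter.2 fun j => ⟨⟨ht, by simpa [jet] using h0 t ht⟩, ?_⟩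
      have h1 := iteratedDeriv_normalize hI hτ h0 j.val ht
      rw [hid.iteratedDeriv_of_isOpen hI _ ht] at h1
      have h2 : r j (jet (k + 1) τ t) = jet (j.val + 1) τ t := rfl
      simp only [G, mem_preimage, mem_Ioi, h2, ← h1, sub_self, norm_zero, sub_zero]
      exact hpos t ht)
  refine ⟨η, hηc, hηp, fun σ hσ hclose => ?_⟩
  have hmem : ∀ t ∈ I, ∀ j : Fin (k + 1), (t, jet (k + 1) σ t) ∈ S ∩ G j ⁻¹' Ioi 0 := by
    intro t ht
    refine mem_iInter.1 (hη t ht _ ((pi_norm_lt_iff (hηp t ht)).2 fun i => ?_))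
    exact hclose t ht i (by omega)
  have hσ0 : ∀ t ∈ I, σ t ≠ 0 := fun t ht => by simpa [jet] using (hmem t ht 0).1.2
  refine ⟨hσ0, fun t ht j hj => ?_⟩
  have h1 := (hmem t ht ⟨j, by omega⟩).2
  have h2 : r ⟨j, by omega⟩ (jet (k + 1) σ t) = jet (j + 1) σ t := rfl
  simp only [G, mem_preimage, mem_Ioi, h2, sub_pos] at h1
  rwa [iteratedDeriv_normalize hI hσ hσ0 j ht]

end Normalisation

/-! ### Open sets and perturbations for the Whitney topology -/

section Whitney

variable {I : Set ℝ} {p : ℕ}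

/-- The graph of the jet lies in an open set, so it has a tube in it whose radius varies
continuously over `I`; such radii are exactly what the strong topology allows. -/
theorem isOpen_setOf_jet_mem (hI : IsOpen I) {K : ℕ} {O : Set ((Fin K → ℝ) × (Fin K → E p))}
    (hO : IsOpen O) :
    IsOpen {x : FrontalData I p | ∀ t ∈ I, (jet K x.a t, jet K x.τ t) ∈ O} := by
  intro x hx
  obtain ⟨η, hηc, hηp, hη⟩ := exists_tube (I := I)
    (j := fun t => (jet K x.a t, jet K x.τ t))
    ((contDiffOn_jet hI x.contDiffOn_a K).continuousOn.prodMk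
      (contDiffOn_jet hI x.contDiffOn_τ K).continuousOn)
    (O := {u | u.2 ∈ O}) (hO.preimage continuous_snd) hx
  refine ⟨K, η, hηc, hηp, fun y hy t ht => hη t ht _ ?_⟩
  have h1 : ‖jet K y.a t - jet K x.a t‖ < η t :=
    (pi_norm_lt_iff (hηp t ht)).2 fun i => (hy t ht i i.2.le).1
  have h2 : ‖jet K y.τ t - jet K x.τ t‖ < η t :=
    (pi_norm_lt_iff (hηp t ht)).2 fun i => (hy t ht i i.2.le).2
  exact max_lt h1 h2

/-- Made for successive perturbations: `W` collects the open conditions already achieved, and they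
persist under a perturbation that is small enough to stay in `W`. -/
theorem dense_of_forall_whitneyNhd {U W : Set (FrontalData I p)} (hW : IsOpen W) (hWd : Dense W)
    (h : ∀ x ∈ W, ∀ (k : ℕ) (ε : ℝ → ℝ), ContinuousOn ε I → (∀ t ∈ I, 0 < ε t) →
      whitneyNhd x k ε ⊆ W → ∃ y ∈ whitneyNhd x k ε, y ∈ U) : Dense U := by
  rw [dense_iff_inter_open]
  intro O hO hne
  obtain ⟨x, hxO, hxW⟩ := hWd.inter_open_nonempty O hO hne
  obtain ⟨k, ε, hc, hpos, hsub⟩ := (hO.inter hW) x ⟨hxO, hxW⟩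
  obtain ⟨y, hy, hyU⟩ := h x hxW k ε hc hpos fun y hy => (hsub hy).2
  exact ⟨y, (hsub hy).1, hyU⟩

/-- Perturbation of the unit tangent: its jets are those of the normalisation of a curve whose
jets avoid a given thin set. -/
theorem exists_perturbation_tangent (hI : IsOpen I) {K : ℕ} (hK : 0 < K)
    {B : Set (ℝ × (Fin K → E p))} (hB : IsThin I B) (x : FrontalData I p) (k : ℕ) {ε : ℝ → ℝ}
    (hε : ContinuousOn ε I) (hpos : ∀ t ∈ I, 0 < ε t) :
    ∃ y ∈ whitneyNhd x k ε, ∃ σ : ℝ → E p, ContDiffOn ℝ ∞ σ I ∧ (∀ t ∈ I, σ t ≠ 0) ∧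
      y.τ = normalize σ ∧ ∀ t ∈ I, (t, jet K σ t) ∉ B := by
  obtain ⟨η, hηc, hηp, hη⟩ := exists_normalize_tube hI x.contDiffOn_τ x.norm_τ hε hpos k
  obtain ⟨σ, hσ, hclose, hav⟩ := exists_perturbation hI x.contDiffOn_τ hB
    (by rw [Module.finrank_pi_fintype]; simp; omega) hηc hηp k
  obtain ⟨h0, hc⟩ := hη σ hσ hclose
  refine ⟨⟨x.a, normalize σ, x.contDiffOn_a, contDiffOn_normalize hσ h0, fun t ht => ?_⟩,
    fun t ht j hj => ⟨by simpa using hpos t ht, hc t ht j hj⟩, σ, hσ, h0, rfl, hav⟩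
  rw [normalize, norm_smul, norm_inv, norm_norm, inv_mul_cancel₀ (norm_ne_zero_iff.2 (h0 t ht))]

theorem exists_perturbation_factor (hI : IsOpen I) {K : ℕ} (hK : 0 < K)
    {B : Set (ℝ × (Fin K → ℝ))} (hB : IsThin I B) (x : FrontalData I p) (k : ℕ) {ε : ℝ → ℝ}
    (hε : ContinuousOn ε I) (hpos : ∀ t ∈ I, 0 < ε t) :
    ∃ y ∈ whitneyNhd x k ε, y.τ = x.τ ∧ ∀ t ∈ I, (t, jet K y.a t) ∉ B := by
  obtain ⟨a, ha, hclose, hav⟩ := exists_perturbation hI x.contDiffOn_a hB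
    (by simpa using hK) hε hpos k
  exact ⟨⟨a, x.τ, ha, x.contDiffOn_τ, x.norm_τ⟩,
    fun t ht j hj => ⟨hclose t ht j hj, by simpa using hpos t ht⟩, rfl, hav⟩

end Whitney

/-! ### Generic conditions on the unit tangent -/

section FinSnoc

variable {V F : Type*} [NormedAddCommGroup V] [NormedSpace ℝ V] [NormedAddCommGroup F]
  [NormedSpace ℝ F] {n : ℕ}

theorem contDiffOn_snoc {f : F → Fin n → V} {g : F → V} {S : Set F} (hf : ContDiffOn ℝ ∞ f S)
    (hg : ContDiffOn ℝ ∞ g S) :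
    ContDiffOn ℝ ∞ (fun u => (Fin.snoc (f u) (g u) : Fin (n + 1) → V)) S := by
  refine contDiffOn_pi.2 fun i => ?_
  refine Fin.lastCases ?_ (fun i => ?_) i
  · simpa using hg
  · simpa using contDiffOn_pi.1 hf i

theorem contDiffOn_insertNth {f : F → Fin n → V} {g : F → V} {S : Set F} (m : Fin (n + 1))
    (hf : ContDiffOn ℝ ∞ f S) (hg : ContDiffOn ℝ ∞ g S) :
    ContDiffOn ℝ ∞ (fun u => (m.insertNth (g u) (f u) : Fin (n + 1) → V)) S := by
  refine contDiffOn_pi.2 fun i => ?_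
  refine Fin.succAboveCases m ?_ (fun i => ?_) i
  · simpa using hg
  · simpa using contDiffOn_pi.1 hf i

end FinSnoc

/-- The sequence with the entries of a jet, continued by zero. -/
def ofJet {V : Type*} [Zero V] {K : ℕ} (z : Fin K → V) (n : ℕ) : V :=
  if h : n < K then z ⟨n, h⟩ else 0

theorem ofJet_of_lt {V : Type*} [Zero V] {K : ℕ} (z : Fin K → V) {n : ℕ} (h : n < K) :
    ofJet z n = z ⟨n, h⟩ := dif_pos h

theorem frameDet_congr {p : ℕ} {v w : ℕ → E p} (h : ∀ j ≤ p, v j = w j) :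
    frameDet v = frameDet w := by
  unfold frameDet
  congr 1
  funext j
  exact h j (by omega)

theorem frameDetSucc_congr {p : ℕ} {v w : ℕ → E p} (h : ∀ j ≤ p + 1, v j = w j) :
    frameDetSucc v = frameDetSucc w := by
  unfold frameDetSucc
  congr 1
  funext j
  exact h _ (by split_ifs <;> omega)

theorem ofJet_jet {p K : ℕ} (τ : ℝ → E p) (t : ℝ) {j : ℕ} (hj : j < K) :
    ofJet (jet K τ t) j = iteratedDeriv j τ t := ofJet_of_lt _ hj

theorem continuous_ofJet {p K : ℕ} (n : ℕ) : Continuous fun z : Fin K → E p => ofJet z n := by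
  unfold ofJet
  split_ifs with h
  · exact continuous_apply _
  · exact continuous_const

theorem continuous_frameDet {p K : ℕ} : Continuous fun z : Fin K → E p => frameDet (ofJet z) :=
  (frameForm p).cont.comp (continuous_pi fun _ => continuous_ofJet _)

theorem continuous_frameDetSucc {p K : ℕ} :
    Continuous fun z : Fin K → E p => frameDetSucc (ofJet z) :=
  (frameForm p).cont.comp (continuous_pi fun _ => continuous_ofJet _)

/-! ### Dimension counts for degenerate jets -/

section ThinDegenerate

variable {I : Set ℝ}

/-- The jets with two vanishing determinants form a set of codimension two. -/
theorem isThin_frameDet (hI : IsOpen I) (k : ℕ) :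
    IsThin I {u : ℝ × (Fin (k + 3) → E (k + 1)) |
      frameDet (ofJet u.2) = 0 ∧ frameDetSucc (ofJet u.2) = 0} := by
  -- Either the first `k + 1` entries are dependent, and one of them is a combination of the other
  -- `k`, or both remaining entries lie in the span of the first `k + 1`. With `n = k + 2` the
  -- dimension of the space, the parameters number `1 + n(k + 2) + k` and `1 + n(k + 1) + 2(k + 1)`.
  -- Both are `n(k + 3) - 1`, one less than the dimension of the jets.
  let B₁ : Fin (k + 1) → Set (ℝ × (Fin (k + 3) → E (k + 1))) := fun m =>
    {u | u.2 (Fin.castLE (by omega) m) ∈ Submodule.span ℝ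
      ((fun i : Fin (k + 1) => u.2 (Fin.castLE (by omega) i)) '' (univ \ {m}))}
  let B₂ : Set (ℝ × (Fin (k + 3) → E (k + 1))) :=
    {u | ofJet u.2 (k + 1) ∈ initSpan (ofJet u.2) (k + 1) ∧
      ofJet u.2 (k + 2) ∈ initSpan (ofJet u.2) (k + 1)}
  have h₁ : ∀ m, IsThin I (B₁ m) := by
    intro m
    let m' : Fin (k + 3) := Fin.castLE (by omega) m
    let φ : ℝ × (Fin (k + 2) → E (k + 1)) × (Fin k → ℝ) → ℝ × (Fin (k + 3) → E (k + 1)) :=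
      fun q => (q.1, m'.insertNth (∑ i, q.2.2 i • q.2.1 (Fin.castLE (by omega) i)) q.2.1)
    refine IsThin.of_image hI isOpen_univ (φ := φ) ?_ ?_ ?_
    · refine contDiffOn_fst.prodMk (contDiffOn_insertNth _
        (contDiff_snd.fst.contDiffOn) (ContDiff.contDiffOn ?_))
      fun_prop
    · rintro ⟨t, z⟩ ⟨hz, -⟩
      have hz : z m' ∈ Submodule.span ℝ
        ((fun i : Fin (k + 1) => z (Fin.castLE (by omega) i)) '' (univ \ {m})) := hz
      let y : Fin (k + 2) → E (k + 1) := m'.removeNth z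
      have hsub : (fun i : Fin (k + 1) => z (Fin.castLE (by omega) i)) '' (univ \ {m}) ⊆
          range fun i : Fin k => y (Fin.castLE (by omega) i) := by
        rintro _ ⟨i, hi, rfl⟩
        have him : i ≠ m := hi.2
        have hne : (Fin.castLE (by omega) i : Fin (k + 3)) ≠ m' := fun h =>
          him (Fin.ext (by simpa [m', Fin.ext_iff] using h))
        obtain ⟨j, hj⟩ := Fin.exists_succAbove_eq hne
        have hjk : j.val < k := by
          have h1 : (m'.succAbove j).val = i.val := by rw [hj]; rfl
          rw [Fin.succAbove] at h1
          have h2 := i.2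
          have h3 := m.2
          have h4 : i.val ≠ m.val := fun h => him (Fin.ext h)
          split_ifs at h1 with hlt
          · have : j.val < m.val := hlt
            simp at h1
            omega
          · simp at h1
            omega
        exact ⟨⟨j, hjk⟩, by simp only [y, Fin.removeNth]; rw [← hj]; rfl⟩
      obtain ⟨c, hc⟩ := (Submodule.mem_span_range_iff_exists_fun ℝ).1 (Submodule.span_mono hsub hz)
      refine ⟨(t, y, c), mem_univ _, ?_⟩
      simp only [φ, hc, y]
      rw [Fin.insertNth_self_removeNth]
    · simp only [Module.finrank_prod, Module.finrank_pi_fintype, Module.finrank_self,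
        finrank_euclideanSpace_fin, Finset.sum_const, Finset.card_univ, Fintype.card_fin,
        smul_eq_mul]
      ring_nf
      omega
  have h₂ : IsThin I B₂ := by
    let φ : ℝ × (Fin (k + 1) → E (k + 1)) × (Fin (k + 1) → ℝ) × (Fin (k + 1) → ℝ) →
        ℝ × (Fin (k + 3) → E (k + 1)) :=
      fun q => (q.1, Fin.snoc (Fin.snoc q.2.1 (∑ i, q.2.2.1 i • q.2.1 i) :
        Fin (k + 2) → E (k + 1)) (∑ i, q.2.2.2 i • q.2.1 i))
    refine IsThin.of_image hI isOpen_univ (φ := φ) ?_ ?_ ?_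
    · refine contDiffOn_fst.prodMk (contDiffOn_snoc (contDiffOn_snoc
        (contDiff_snd.fst.contDiffOn) (ContDiff.contDiffOn ?_)) (ContDiff.contDiffOn ?_)) <;>
      fun_prop
    · rintro ⟨t, z⟩ ⟨⟨hz1, hz2⟩, -⟩
      let y : Fin (k + 1) → E (k + 1) := fun i => z (Fin.castLE (by omega) i)
      have hsub : ofJet z '' Iio (k + 1) ⊆ range y := by
        rintro _ ⟨i, hi, rfl⟩
        have hi : i < k + 1 := hi
        exact ⟨⟨i, hi⟩, (ofJet_of_lt z (by omega)).symm⟩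
      obtain ⟨c, hc⟩ :=
        (Submodule.mem_span_range_iff_exists_fun ℝ).1 (Submodule.span_mono hsub hz1)
      obtain ⟨d, hd⟩ :=
        (Submodule.mem_span_range_iff_exists_fun ℝ).1 (Submodule.span_mono hsub hz2)
      refine ⟨(t, y, c, d), mem_univ _, ?_⟩
      simp only [φ, hc, hd]
      rw [ofJet_of_lt z (by omega), ofJet_of_lt z (by omega)]
      congr 1
      funext i
      refine Fin.lastCases ?_ (fun i => ?_) i
      · simp; rfl
      · refine Fin.lastCases ?_ (fun i => ?_) i
        · simp; rfl
        · simp; rfl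
    · simp only [Module.finrank_prod, Module.finrank_pi_fintype, Module.finrank_self,
        finrank_euclideanSpace_fin, Finset.sum_const, Finset.card_univ, Fintype.card_fin,
        smul_eq_mul]
      ring_nf
      omega
  refine ((IsThin.iUnion h₁).union h₂).mono ?_
  rintro ⟨t, z⟩ ⟨⟨hD, hD'⟩, -⟩
  by_cases hli : LinearIndependent ℝ fun i : Fin (k + 1) => z (Fin.castLE (by omega) i)
  · right
    have hspan : initSpan (ofJet z) (k + 1) =
        Submodule.span ℝ (range fun i : Fin (k + 1) => z (Fin.castLE (by omega) i)) := by
      rw [initSpan]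
      congr 1
      ext x
      constructor
      · rintro ⟨i, hi, rfl⟩
        have hi : i < k + 1 := hi
        exact ⟨⟨i, hi⟩, (ofJet_of_lt z (by omega)).symm⟩
      · rintro ⟨i, rfl⟩
        exact ⟨i, i.2, ofJet_of_lt z (by omega)⟩
    have hfr : Module.finrank ℝ (initSpan (ofJet z) (k + 1)) = k + 1 := by
      rw [hspan, finrank_span_eq_card hli, Fintype.card_fin]
    have key : ∀ x : E (k + 1), initSpan (ofJet z) (k + 1) ⊔ Submodule.span ℝ {x} ≠ ⊤ →
        x ∈ initSpan (ofJet z) (k + 1) := by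
      intro x hx
      by_contra hmem
      refine hx (Submodule.eq_top_of_finrank_eq ?_)
      have hlt : initSpan (ofJet z) (k + 1) < initSpan (ofJet z) (k + 1) ⊔ Submodule.span ℝ {x} :=
        lt_of_le_of_ne le_sup_left fun h => hmem (by
          rw [h]; exact Submodule.mem_sup_right (Submodule.mem_span_singleton_self x))
      have h1 := Submodule.finrank_lt_finrank_of_lt hlt
      have h2 := Submodule.finrank_le (initSpan (ofJet z) (k + 1) ⊔ Submodule.span ℝ {x})
      rw [finrank_euclideanSpace_fin] at h2 ⊢
      omega
    refine ⟨key _ fun h => ?_, key _ fun h => ?_⟩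
    · rw [← initSpan_succ] at h
      exact (frameDet_ne_zero_iff (p := k + 1) _).2
        ((congrArg (initSpan (ofJet z)) (by omega : 1 + (k + 1) = k + 1 + 1)).trans h) hD
    · exact (frameDetSucc_ne_zero_iff (p := k + 1) _).2 h hD'
  · left
    rw [linearIndependent_iff_notMem_span] at hli
    push Not at hli
    obtain ⟨m, hm⟩ := hli
    exact mem_iUnion.2 ⟨m, hm⟩

/-- The regular jets for which the first two normal derivatives of the normal curvature vanish form
a set of codimension two. -/
theorem isThin_normalCurvDeriv (hI : IsOpen I) {p : ℕ} (hp : 2 ≤ p) :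
    IsThin I {u : ℝ × (Fin 5 → E p) | IsRegularJet (K := 3) u.2 ∧
      normalCurvDeriv (fun i : Fin 4 => u.2 i.castSucc) ∈
        Submodule.span ℝ {u.2 0, unitDeriv (u.2 0) (u.2 1)} ∧
      normalCurvDeriv₂ u.2 ∈ Submodule.span ℝ {u.2 0, unitDeriv (u.2 0) (u.2 1)}} := by
  obtain ⟨L₁, hL₁, hT₁⟩ := hasTopTerm_normalCurvDeriv (V := E p)
  obtain ⟨L₂, hL₂, hT₂⟩ := hasTopTerm_normalCurvDeriv₂ (V := E p)
  -- The factor `s` inverts the coefficient of the top terms. Given the first three entries and the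
  -- four coefficients expressing the memberships in the plane, one solves for entry `3` and then
  -- for entry `4`. The count `1 + 3(1 + p) + 4 < 5(1 + p)` holds exactly for `2 ≤ p`.
  let s : (Fin 3 → E p) → ℝ := fun y => (curvScale (y 0) (y 1))⁻¹⁻¹
  let w : (Fin 3 → E p) → E p := fun y => unitDeriv (y 0) (y 1)
  let y₃ : ℝ × (Fin 3 → E p) × (Fin 4 → ℝ) → Fin 4 → E p := fun q =>
    Fin.snoc q.2.1 (s q.2.1 • (q.2.2 0 • q.2.1 0 + q.2.2 1 • w q.2.1 - L₁ q.2.1))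
  let φ : ℝ × (Fin 3 → E p) × (Fin 4 → ℝ) → ℝ × (Fin 5 → E p) := fun q =>
    (q.1, Fin.snoc (y₃ q) (s q.2.1 • (q.2.2 2 • q.2.1 0 + q.2.2 3 • w q.2.1 - L₂ (y₃ q))))
  let S : Set (ℝ × (Fin 3 → E p) × (Fin 4 → ℝ)) := {q | IsRegularJet (K := 1) q.2.1}
  have hS : IsOpen S := (isOpen_isRegularJet 1).preimage continuous_snd.fst
  refine IsThin.of_image hI hS (φ := φ) ?_ ?_ ?_
  · have hy : ContDiff ℝ ∞ (fun q : ℝ × (Fin 3 → E p) × (Fin 4 → ℝ) => q.2.1) := contDiff_snd.fst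
    have hy0 : ContDiff ℝ ∞ (fun q : ℝ × (Fin 3 → E p) × (Fin 4 → ℝ) => q.2.1 0) := by fun_prop
    have hc : ∀ i, ContDiff ℝ ∞ (fun q : ℝ × (Fin 3 → E p) × (Fin 4 → ℝ) => q.2.2 i) := by fun_prop
    have hs : ContDiffOn ℝ ∞ (fun q : ℝ × (Fin 3 → E p) × (Fin 4 → ℝ) => s q.2.1) S := by
      intro q hq
      have h1 : ContDiffAt ℝ ∞ s q.2.1 := (contDiffAt_curvScale_inv_jet (K := 1) hq).inv
        (inv_ne_zero (curvScale_pos hq.1 hq.2).ne')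
      exact (ContDiffAt.comp q h1 hy.contDiffAt).contDiffWithinAt
    have hw : ContDiffOn ℝ ∞ (fun q : ℝ × (Fin 3 → E p) × (Fin 4 → ℝ) => w q.2.1) S := fun q hq =>
      (ContDiffAt.comp q (g := w) (f := fun q : ℝ × (Fin 3 → E p) × (Fin 4 → ℝ) => q.2.1)
        (contDiffAt_unitDeriv_jet (K := 1) hq) hy.contDiffAt).contDiffWithinAt
    have hL₁' : ContDiffOn ℝ ∞ (fun q : ℝ × (Fin 3 → E p) × (Fin 4 → ℝ) => L₁ q.2.1) S := fun q hq =>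
      (ContDiffAt.comp q (g := L₁) (f := fun q : ℝ × (Fin 3 → E p) × (Fin 4 → ℝ) => q.2.1)
        (hL₁ _ hq) hy.contDiffAt).contDiffWithinAt
    have hy₃ : ContDiffOn ℝ ∞ y₃ S := contDiffOn_snoc hy.contDiffOn (hs.smul
      ((((hc 0).smul hy0).contDiffOn.add ((hc 1).contDiffOn.smul hw)).sub hL₁'))
    have hreg : ∀ q ∈ S, IsRegularJet (K := 2) (y₃ q) := fun q hq => hq
    have hL₂' : ContDiffOn ℝ ∞ (fun q => L₂ (y₃ q)) S := fun q hq =>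
      (ContDiffAt.comp_contDiffWithinAt q (hL₂ _ (hreg q hq)) (hy₃ q hq))
    exact contDiffOn_fst.prodMk (contDiffOn_snoc hy₃ (hs.smul
      ((((hc 2).smul hy0).contDiffOn.add ((hc 3).contDiffOn.smul hw)).sub hL₂')))
  · rintro ⟨t, z⟩ ⟨⟨hreg, h1, h2⟩, -⟩
    simp only at hreg h1 h2
    have hpos := curvScale_pos hreg.1 hreg.2
    have hreg' : IsRegularJet (K := 2) (fun i : Fin 4 => z i.castSucc) := hreg
    rw [hT₁ _ hreg', Submodule.mem_span_pair] at h1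
    rw [hT₂ _ hreg, Submodule.mem_span_pair] at h2
    obtain ⟨c₀, c₁, hc⟩ := h1
    obtain ⟨c₂, c₃, hd⟩ := h2
    let y : Fin 3 → E p := fun i => z i.castSucc.castSucc
    refine ⟨(t, y, ![c₀, c₁, c₂, c₃]), hreg, ?_⟩
    have hs : s y = curvScale (z 0) (z 1) := inv_inv _
    have e₃ : y₃ (t, y, ![c₀, c₁, c₂, c₃]) = fun i : Fin 4 => z i.castSucc := by
      have hw : c₀ • y 0 + c₁ • w y - L₁ y = (curvScale (z 0) (z 1))⁻¹ • z 3 := by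
        have : c₀ • y 0 + c₁ • w y = (curvScale (z 0) (z 1))⁻¹ • z 3 + L₁ y := hc
        rw [this, add_sub_cancel_right]
      have : y₃ (t, y, ![c₀, c₁, c₂, c₃]) =
          Fin.snoc y (s y • (c₀ • y 0 + c₁ • w y - L₁ y)) := rfl
      rw [this, hw, hs, smul_smul, mul_inv_cancel₀ hpos.ne', one_smul]
      exact Fin.snoc_init_self (α := fun _ => E p) (fun i : Fin 4 => z i.castSucc)
    have hw : c₂ • y 0 + c₃ • w y - L₂ (fun i : Fin 4 => z i.castSucc) =
        (curvScale (z 0) (z 1))⁻¹ • z 4 := by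
      have : c₂ • y 0 + c₃ • w y = (curvScale (z 0) (z 1))⁻¹ • z 4 +
        L₂ (fun i : Fin 4 => z i.castSucc) := hd
      rw [this, add_sub_cancel_right]
    have : φ (t, y, ![c₀, c₁, c₂, c₃]) = (t, Fin.snoc (y₃ (t, y, ![c₀, c₁, c₂, c₃]))
        (s y • (c₂ • y 0 + c₃ • w y - L₂ (y₃ (t, y, ![c₀, c₁, c₂, c₃]))))) := rfl
    rw [this, e₃, hw, hs, smul_smul, mul_inv_cancel₀ hpos.ne', one_smul]
    exact congrArg _ (Fin.snoc_init_self (α := fun _ => E p) z)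
  · simp only [Module.finrank_prod, Module.finrank_pi_fintype, Module.finrank_self,
      finrank_euclideanSpace_fin, Finset.sum_const, Finset.card_univ, Fintype.card_fin,
      smul_eq_mul]
    omega

end ThinDegenerate

/-! ### The generic open dense sets -/

section Generic

variable {I : Set ℝ} {p : ℕ} {t : ℝ}

/-- The part of `X` normal to the orthogonal vectors `x`, `y`, where `x` is a unit vector. -/
noncomputable def normalPart (x y X : E p) : E p :=
  X - inner ℝ x X • x - (inner ℝ y X * (‖y‖ ^ 2)⁻¹) • y

/-- The beginning of a jet. -/
def subJet {V : Type*} {K : ℕ} (m : ℕ) (h : m ≤ K) (z : Fin K → V) : Fin m → V :=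
  fun i => z (Fin.castLE h i)

/-- The sequence of derivatives of a curve at a point. -/
noncomputable def derivSeq {V : Type*} [NormedAddCommGroup V] [NormedSpace ℝ V] (τ : ℝ → V) (t : ℝ)
    (j : ℕ) : V := iteratedDeriv j τ t

theorem frameDet_ofJet_jet (τ : ℝ → E p) (t : ℝ) {K : ℕ} (hK : p + 2 ≤ K) :
    frameDet (ofJet (jet K τ t)) = frameDet (derivSeq τ t) :=
  frameDet_congr fun _ hj => ofJet_jet τ t (by omega)

theorem frameDetSucc_ofJet_jet (τ : ℝ → E p) (t : ℝ) {K : ℕ} (hK : p + 2 ≤ K) :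
    frameDetSucc (ofJet (jet K τ t)) = frameDetSucc (derivSeq τ t) :=
  frameDetSucc_congr fun _ hj => ofJet_jet τ t (by omega)

/-- The determinant of the derivatives of `τ` has only simple zeros. -/
def detGeneric (I : Set ℝ) (p : ℕ) : Set (FrontalData I p) :=
  {x | ∀ t ∈ I, frameDet (derivSeq x.τ t) ≠ 0 ∨ frameDetSucc (derivSeq x.τ t) ≠ 0}

/-- The jets at which `τ` and `τ'` are linearly independent. -/
def regularJets (p : ℕ) : Set ((Fin (p + 6) → ℝ) × (Fin (p + 6) → E p)) :=
  {u | IsRegularJet (K := p + 4) u.2 ∧ u.2 1 ≠ 0}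

/-- The normal part of the first normal derivative of the curvature. -/
noncomputable def normalJet₁ (z : Fin (p + 6) → E p) : E p :=
  normalPart (z 0) (z 1) (normalCurvDeriv (subJet 4 (by omega) z))

/-- The normal part of the second normal derivative of the curvature. -/
noncomputable def normalJet₂ (z : Fin (p + 6) → E p) : E p :=
  normalPart (z 0) (z 1) (normalCurvDeriv₂ (subJet 5 (by omega) z))

/-- The normal part of the third normal derivative of the curvature. -/
noncomputable def normalJet₃ (z : Fin (p + 6) → E p) : E p :=
  normalPart (z 0) (z 1) (normalCurvDeriv₃ (subJet 6 (by omega) z))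

/-- The normal derivative of the curvature has only simple zeros. -/
def curvGeneric (I : Set ℝ) (p : ℕ) : Set (FrontalData I p) :=
  {x | ∀ t ∈ I, (jet (p + 6) x.a t, jet (p + 6) x.τ t) ∈ {u | u ∈ regularJets p ∧
    (normalJet₁ u.2 ≠ 0 ∨ normalJet₂ u.2 ≠ 0)}}

/-- The conditions on `a`, given `τ`. -/
def factorGeneric (I : Set ℝ) (p : ℕ) : Set (FrontalData I p) :=
  {x | ∀ t ∈ I, (jet (p + 6) x.a t, jet (p + 6) x.τ t) ∈
    {u | u ∈ regularJets p ∧ (frameDet (ofJet u.2) ≠ 0 ∨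
      u.1 0 • normalJet₂ u.2 - u.1 1 • normalJet₁ u.2 ≠ 0)} ∩
    {u | u ∈ regularJets p ∧ (u.1 0 ≠ 0 ∨ u.1 1 ≠ 0)} ∩
    {u | u ∈ regularJets p ∧ (u.1 0 ≠ 0 ∨ normalJet₁ u.2 ≠ 0)} ∩
    {u | u ∈ regularJets p ∧ (u.1 0 • normalJet₂ u.2 - u.1 1 • normalJet₁ u.2 ≠ 0 ∨
      u.1 0 • normalJet₃ u.2 - u.1 2 • normalJet₁ u.2 ≠ 0)}}

theorem isOpen_ne_or_ne {X Y Z : Type*} [TopologicalSpace X] [TopologicalSpace Y]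
    [TopologicalSpace Z] [T1Space Y] [T1Space Z] [Zero Y] [Zero Z] {S : Set X} (hS : IsOpen S)
    {F : X → Y} {G : X → Z} (hF : ContinuousOn F S) (hG : ContinuousOn G S) :
    IsOpen {u | u ∈ S ∧ (F u ≠ 0 ∨ G u ≠ 0)} := by
  have := (hF.isOpen_inter_preimage hS (isOpen_compl_singleton (x := 0))).union
    (hG.isOpen_inter_preimage hS (isOpen_compl_singleton (x := 0)))
  convert this using 1
  ext u
  simp only [ne_eq, mem_ofPred_eq, mem_union, mem_inter_iff, mem_preimage, mem_compl_iff,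
    mem_singleton_iff]
  tauto

theorem isOpen_regularJets (p : ℕ) : IsOpen (regularJets p) :=
  ((isOpen_isRegularJet (p + 4)).preimage continuous_snd).inter
    (isOpen_ne_fun ((continuous_apply 1).comp continuous_snd) continuous_const)

/-- The common jet length `p + 6` leaves room both for the six entries of `normalJet₃` and for the
`p + 1` columns of `frameDet`. -/
theorem continuousOn_normalPart_comp {m : ℕ} (h : m + 2 ≤ p + 6) {T : (Fin (m + 2) → E p) → E p}
    (hT : ∀ z, IsRegularJet z → ContDiffAt ℝ ∞ T z) :
    ContinuousOn (fun u : (Fin (p + 6) → ℝ) × (Fin (p + 6) → E p) =>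
      normalPart (u.2 0) (u.2 1) (T (subJet (m + 2) h u.2))) (regularJets p) := by
  have h0 : ContinuousOn (fun u : (Fin (p + 6) → ℝ) × (Fin (p + 6) → E p) => u.2 0)
    (regularJets p) := by fun_prop
  have h1 : ContinuousOn (fun u : (Fin (p + 6) → ℝ) × (Fin (p + 6) → E p) => u.2 1)
    (regularJets p) := by fun_prop
  have h2 : ContinuousOn (fun u : (Fin (p + 6) → ℝ) × (Fin (p + 6) → E p) =>
      T (subJet (m + 2) h u.2)) (regularJets p) := by
    intro u hu
    have hr : IsRegularJet (subJet (m + 2) h u.2) := hu.1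
    have hc : Continuous fun u : (Fin (p + 6) → ℝ) × (Fin (p + 6) → E p) =>
      subJet (m + 2) h u.2 := by unfold subJet; fun_prop
    exact (ContinuousAt.comp (f := fun u : (Fin (p + 6) → ℝ) × (Fin (p + 6) → E p) =>
      subJet (m + 2) h u.2) (hT _ hr).continuousAt hc.continuousAt).continuousWithinAt
  have h3 : ContinuousOn (fun u : (Fin (p + 6) → ℝ) × (Fin (p + 6) → E p) => (‖u.2 1‖ ^ 2)⁻¹)
      (regularJets p) := (h1.norm.pow 2).inv₀ fun u hu => (pow_pos (norm_pos_iff.2 hu.2) 2).ne'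
  unfold normalPart
  exact (h2.sub ((ContinuousOn.inner (𝕜 := ℝ) h0 h2).smul h0)).sub
    (((ContinuousOn.inner (𝕜 := ℝ) h1 h2).mul h3).smul h1)

theorem continuousOn_normalJet₁ :
    ContinuousOn (fun u : (Fin (p + 6) → ℝ) × (Fin (p + 6) → E p) => normalJet₁ u.2)
      (regularJets p) :=
  continuousOn_normalPart_comp (m := 2) _ contDiffAt_normalCurvDeriv

theorem continuousOn_normalJet₂ :
    ContinuousOn (fun u : (Fin (p + 6) → ℝ) × (Fin (p + 6) → E p) => normalJet₂ u.2)
      (regularJets p) :=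
  continuousOn_normalPart_comp (m := 3) _ contDiffAt_normalCurvDeriv₂

theorem continuousOn_normalJet₃ :
    ContinuousOn (fun u : (Fin (p + 6) → ℝ) × (Fin (p + 6) → E p) => normalJet₃ u.2)
      (regularJets p) :=
  continuousOn_normalPart_comp (m := 4) _ contDiffAt_normalCurvDeriv₃

theorem isOpen_detGeneric (hI : IsOpen I) : IsOpen (detGeneric I p) := by
  have h := isOpen_setOf_jet_mem (p := p) hI (K := p + 2) (O := {u | u ∈ univ ∧
    (frameDet (ofJet u.2) ≠ 0 ∨ frameDetSucc (ofJet u.2) ≠ 0)})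
    (isOpen_ne_or_ne isOpen_univ (continuous_frameDet.comp continuous_snd).continuousOn
      (continuous_frameDetSucc.comp continuous_snd).continuousOn)
  simpa only [mem_ofPred_eq, mem_univ, true_and, frameDet_ofJet_jet _ _ le_rfl,
    frameDetSucc_ofJet_jet _ _ le_rfl] using! h

theorem isOpen_curvGeneric (hI : IsOpen I) : IsOpen (curvGeneric I p) :=
  isOpen_setOf_jet_mem hI (isOpen_ne_or_ne (isOpen_regularJets p) continuousOn_normalJet₁
    continuousOn_normalJet₂)

theorem isOpen_factorGeneric (hI : IsOpen I) : IsOpen (factorGeneric I p) := by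
  have hα : ∀ i, ContinuousOn (fun u : (Fin (p + 6) → ℝ) × (Fin (p + 6) → E p) => u.1 i)
    (regularJets p) := fun i => by fun_prop
  have h1 := (hα 0).smul (continuousOn_normalJet₂ (p := p))
  have h2 := (hα 1).smul (continuousOn_normalJet₁ (p := p))
  have h3 := (hα 0).smul (continuousOn_normalJet₃ (p := p))
  have h4 := (hα 2).smul (continuousOn_normalJet₁ (p := p))
  have hS := isOpen_regularJets p
  exact isOpen_setOf_jet_mem hI ((((isOpen_ne_or_ne hS
    (continuous_frameDet.comp continuous_snd).continuousOn (h1.sub h2)).inter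
    (isOpen_ne_or_ne hS (hα 0) (hα 1))).inter
    (isOpen_ne_or_ne hS (hα 0) continuousOn_normalJet₁)).inter
    (isOpen_ne_or_ne hS (h1.sub h2) (h3.sub h4)))

/-! ### Unit curves -/

theorem inner_deriv_of_norm_eq_one (hI : IsOpen I) {τ : ℝ → E p} (hτ : ContDiffOn ℝ ∞ τ I)
    (hn : ∀ t ∈ I, ‖τ t‖ = 1) (ht : t ∈ I) : inner ℝ (τ t) (deriv τ t) = 0 := by
  have h1 := (hasDerivAt_of_contDiffOn hI hτ ht).norm_sq
  have h2 : HasDerivAt (fun s => ‖τ s‖ ^ 2) 0 t :=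
    (hasDerivAt_const t (1 : ℝ)).congr_of_eventuallyEq
      (Filter.eventually_of_mem (hI.mem_nhds ht) fun s hs => by simp [hn s hs])
  have := h1.unique h2
  linarith

theorem unitDeriv_of_norm_eq_one (hI : IsOpen I) {τ : ℝ → E p} (hτ : ContDiffOn ℝ ∞ τ I)
    (hn : ∀ t ∈ I, ‖τ t‖ = 1) (ht : t ∈ I) : unitDeriv (τ t) (deriv τ t) = deriv τ t := by
  simp [unitDeriv, hn t ht, inner_deriv_of_norm_eq_one hI hτ hn ht]

theorem isRegularAt_of_norm_eq_one (hI : IsOpen I) {τ : ℝ → E p} (hτ : ContDiffOn ℝ ∞ τ I)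
    (hn : ∀ t ∈ I, ‖τ t‖ = 1) (ht : t ∈ I) (hd : deriv τ t ≠ 0) : IsRegularAt τ t :=
  ⟨fun h => by simpa [h] using hn t ht, by rwa [unitDeriv_of_norm_eq_one hI hτ hn ht]⟩

/-- Since `2 ≤ p`, the vector `τ'` is not the last column, so it is a column of both determinants.
-/
theorem deriv_ne_zero_of_detGeneric (hp : 2 ≤ p) {x : FrontalData I p} (hx : x ∈ detGeneric I p)
    (ht : t ∈ I) : deriv x.τ t ≠ 0 := by
  intro h
  have h1 : derivSeq x.τ t 1 = 0 := by rw [derivSeq, iteratedDeriv_one, h]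
  rcases hx t ht with h2 | h2
  · exact h2 ((frameForm p).map_coord_zero (⟨1, by omega⟩ : Fin (1 + p)) h1)
  · refine h2 ((frameForm p).map_coord_zero (⟨1, by omega⟩ : Fin (1 + p)) ?_)
    rw [if_neg (by simp; omega)]
    exact h1

/-- A vector has vanishing normal part if and only if it is orthogonal to the normal frame. -/
theorem normalPart_eq_zero_iff {a b : E p} (ha : ‖a‖ = 1) (hb : b ≠ 0) (hab : inner ℝ a b = 0)
    {n : Fin (p - 1) → E p} (hn : Orthonormal ℝ n)
    (hnab : ∀ i, inner ℝ (n i) a = 0 ∧ inner ℝ (n i) b = 0) (X : E p) :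
    normalPart a b X = 0 ↔ ∀ i, inner ℝ (n i) X = 0 := by
  have ha0 : a ≠ 0 := fun h => by simp [h] at ha
  have h1 : ∀ i, inner ℝ (n i) (normalPart a b X) = inner ℝ (n i) X := by
    intro i
    rw [normalPart, inner_sub_right, inner_sub_right, inner_smul_right, inner_smul_right,
      (hnab i).1, (hnab i).2]
    ring
  refine ⟨fun h i => by rw [← h1, h, inner_zero_right], fun h => ?_⟩
  -- The normal part lies in the plane and, by construction, in its orthogonal complement.
  have h2 : normalPart a b X ∈ Submodule.span ℝ {a, b} :=
    mem_span_pair_of_orthogonal ha0 hb hab hn hnab fun i => (h1 i).trans (h i)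
  have h3 : normalPart a b X ∈ (Submodule.span ℝ {a, b})ᗮ := by
    rw [mem_orthogonal_pair]
    have hb' := norm_pos_iff.2 hb
    have hba : inner ℝ b a = 0 := by rw [real_inner_comm, hab]
    constructor
    · rw [normalPart, inner_sub_left, inner_sub_left, inner_smul_left, inner_smul_left,
        real_inner_self_eq_norm_sq, ha, hba, real_inner_comm]
      simp
    · rw [normalPart, inner_sub_left, inner_sub_left, inner_smul_left, inner_smul_left,
        real_inner_self_eq_norm_sq, hab, real_inner_comm]
      simp only [conj_trivial]
      field_simp
      ring
  have h4 : normalPart a b X ∈ Submodule.span ℝ {a, b} ⊓ (Submodule.span ℝ {a, b})ᗮ := ⟨h2, h3⟩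
  rwa [Submodule.inf_orthogonal_eq_bot, Submodule.mem_bot] at h4

/-! ### Density -/

/-- The right-hand side involves only initial spans, so the condition survives rescaling of the
curve by a nonvanishing function. -/
theorem frameDet_ne_zero_or_iff (v : ℕ → E p) :
    (frameDet v ≠ 0 ∨ frameDetSucc v ≠ 0) ↔
      (initSpan v (1 + p) = ⊤ ∨ (initSpan v (1 + p) = initSpan v p ∧ initSpan v (2 + p) = ⊤)) := by
  rw [frameDet_ne_zero_iff, frameDetSucc_ne_zero_iff]
  have h2 : initSpan v (2 + p) = initSpan v (1 + p) ⊔ Submodule.span ℝ {v (p + 1)} := by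
    rw [show 2 + p = (1 + p) + 1 by omega, initSpan_succ,
      congrArg v (show 1 + p = p + 1 by omega)]
  have hle : initSpan v p ≤ initSpan v (1 + p) := initSpan_mono v (by omega)
  constructor
  · rintro (h | h)
    · exact Or.inl h
    · by_cases htop : initSpan v (1 + p) = ⊤
      · exact Or.inl htop
      · refine Or.inr ⟨?_, ?_⟩
        · have h3 := finrank_sup_span_singleton_le (initSpan v p) (v (p + 1))
          rw [h, finrank_top, finrank_euclideanSpace_fin] at h3
          refine (Submodule.eq_of_le_of_finrank_le hle ?_).symm
          by_contra hlt
          refine htop (Submodule.eq_top_of_finrank_eq (le_antisymm (Submodule.finrank_le _) ?_))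
          rw [finrank_euclideanSpace_fin]
          omega
        · rw [h2, eq_top_iff, ← h]
          exact sup_le_sup_right hle _
  · rintro (h | ⟨h, h'⟩)
    · exact Or.inl h
    · right
      rw [← h, ← h2, h']

/-- The perturbation `σ` leaves the sphere and is then normalised; division by `‖σ‖` does not change
the initial spans of the derivatives. -/
theorem dense_detGeneric (hI : IsOpen I) (hp : 1 ≤ p) : Dense (detGeneric I p) := by
  obtain ⟨k, rfl⟩ : ∃ k, p = k + 1 := ⟨p - 1, by omega⟩
  refine dense_of_forall_whitneyNhd isOpen_univ dense_univ fun x _ m ε hε hpos _ => ?_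
  obtain ⟨y, hy, σ, hσ, hσ0, hyσ, hav⟩ := exists_perturbation_tangent hI (by omega)
    (isThin_frameDet hI k) x m hε hpos
  refine ⟨y, hy, fun t ht => ?_⟩
  have h1 : frameDet (derivSeq σ t) ≠ 0 ∨ frameDetSucc (derivSeq σ t) ≠ 0 := by
    have h2 := hav t ht
    rw [mem_ofPred_eq, frameDet_ofJet_jet _ _ le_rfl, frameDetSucc_ofJet_jet _ _ le_rfl] at h2
    tauto
  have hinv : ContDiffOn ℝ ∞ (fun s => ‖σ s‖⁻¹) I :=
    (hσ.norm ℝ hσ0).inv fun t ht => norm_ne_zero_iff.2 (hσ0 t ht)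
  have h3 : ∀ n, initSpan (derivSeq y.τ t) n = initSpan (derivSeq σ t) n := by
    intro n
    rw [hyσ]
    exact initSpan_smul (d := 0) hI ht hinv hσ (by simp) (by simpa using hσ0 t ht) n
  rw [frameDet_ne_zero_or_iff] at h1 ⊢
  rwa [h3, h3, h3]

end Generic

/-! ### The genericity conditions in terms of a parallel frame -/

section Frame

variable {I : Set ℝ} {p : ℕ} {t : ℝ} {τ : ℝ → E p} {n : Fin (p - 1) → ℝ → E p}

theorem normalPart_smul_sub (x y X Y : E p) (α β : ℝ) :
    normalPart x y (α • X - β • Y) = α • normalPart x y X - β • normalPart x y Y := by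
  simp only [normalPart, inner_sub_right, inner_smul_right]
  module

theorem normalPart_jet_eq_zero_iff (hI : IsOpen I) (hτ : ContDiffOn ℝ ∞ τ I)
    (hn : ∀ t ∈ I, ‖τ t‖ = 1) (hd : ∀ t ∈ I, deriv τ t ≠ 0) (hpar : ∀ i, IsParallelNormal I τ (n i))
    (hon : ∀ t ∈ I, Orthonormal ℝ fun i => n i t) (ht : t ∈ I) (X : E p) :
    normalPart (jet (p + 6) τ t 0) (jet (p + 6) τ t 1) X = 0 ↔ ∀ i, inner ℝ (n i t) X = 0 := by
  rw [jet_zero (p + 4), jet_one (p + 4)]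
  exact normalPart_eq_zero_iff (hn t ht) (hd t ht) (inner_deriv_of_norm_eq_one hI hτ hn ht)
    (hon t ht) (fun i => ⟨(hpar i).inner_curve t ht, (hpar i).inner_deriv t ht⟩) X

theorem jet_mem_regularJets (hI : IsOpen I) (hτ : ContDiffOn ℝ ∞ τ I)
    (hn : ∀ t ∈ I, ‖τ t‖ = 1) (hd : ∀ t ∈ I, deriv τ t ≠ 0) (ht : t ∈ I) (α : Fin (p + 6) → ℝ) :
    (α, jet (p + 6) τ t) ∈ regularJets p :=
  ⟨(isRegularAt_of_norm_eq_one hI hτ hn ht (hd t ht)).isRegularJet (p + 4),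
    (jet_one (p + 4) τ t).trans_ne (hd t ht)⟩

/-- Passes from conditions on jets, for which openness is clear, to conditions on the components in
an arbitrary parallel frame, whose derivatives are known. -/
theorem mem_curvGeneric_iff (hI : IsOpen I) {x : FrontalData I p} (hd : ∀ t ∈ I, deriv x.τ t ≠ 0)
    (hpar : ∀ i, IsParallelNormal I x.τ (n i)) (hon : ∀ t ∈ I, Orthonormal ℝ fun i => n i t) :
    x ∈ curvGeneric I p ↔ ∀ t ∈ I, (∃ i, normalComp normalCurvDeriv x.τ (n i) t ≠ 0) ∨
      ∃ i, normalComp normalCurvDeriv₂ x.τ (n i) t ≠ 0 := by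
  refine forall₂_congr fun t ht => ?_
  have hr := jet_mem_regularJets hI x.contDiffOn_τ x.norm_τ hd ht (jet (p + 6) x.a t)
  have h := normalPart_jet_eq_zero_iff hI x.contDiffOn_τ x.norm_τ hd hpar hon ht
  simp only [mem_ofPred_eq, hr, true_and, ne_eq, normalJet₁, normalJet₂, h, not_forall]
  rfl

theorem mem_factorGeneric_iff (hI : IsOpen I) {x : FrontalData I p}
    (hd : ∀ t ∈ I, deriv x.τ t ≠ 0)
    (hpar : ∀ i, IsParallelNormal I x.τ (n i)) (hon : ∀ t ∈ I, Orthonormal ℝ fun i => n i t) :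
    x ∈ factorGeneric I p ↔ ∀ t ∈ I,
      (frameDet (derivSeq x.τ t) ≠ 0 ∨ ∃ i, x.a t * normalComp normalCurvDeriv₂ x.τ (n i) t -
        deriv x.a t * normalComp normalCurvDeriv x.τ (n i) t ≠ 0) ∧
      (x.a t ≠ 0 ∨ deriv x.a t ≠ 0) ∧
      (x.a t ≠ 0 ∨ ∃ i, normalComp normalCurvDeriv x.τ (n i) t ≠ 0) ∧
      ((∃ i, x.a t * normalComp normalCurvDeriv₂ x.τ (n i) t -
        deriv x.a t * normalComp normalCurvDeriv x.τ (n i) t ≠ 0) ∨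
      ∃ i, x.a t * normalComp normalCurvDeriv₃ x.τ (n i) t -
        deriv (deriv x.a) t * normalComp normalCurvDeriv x.τ (n i) t ≠ 0) := by
  refine forall₂_congr fun t ht => ?_
  have hr := jet_mem_regularJets hI x.contDiffOn_τ x.norm_τ hd ht (jet (p + 6) x.a t)
  have h := normalPart_jet_eq_zero_iff hI x.contDiffOn_τ x.norm_τ hd hpar hon ht
  have h0 := jet_zero (p + 4) x.a t
  have h1 := jet_one (p + 4) x.a t
  have h2 : jet (p + 6) x.a t 2 = deriv (deriv x.a) t := by
    simp [jet, Nat.mod_eq_of_lt (show 2 < p + 6 by omega), iteratedDeriv_succ]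
  simp only [mem_inter_iff, mem_ofPred_eq, hr, true_and, ne_eq, normalJet₁, normalJet₂, normalJet₃,
    ← normalPart_smul_sub, h, not_forall, inner_sub_right, inner_smul_right, h0, h1, h2,
    frameDet_ofJet_jet x.τ t (show p + 2 ≤ p + 6 by omega), and_assoc]
  rfl

/-! ### Normal components do not depend on the scaling of the curve -/

theorem IsParallelNormal.of_normalize {σ ν : ℝ → E p} (hI : IsOpen I) (hσ : ContDiffOn ℝ ∞ σ I)
    (h0 : ∀ t ∈ I, σ t ≠ 0) (h : IsParallelNormal I (normalize σ) ν) : IsParallelNormal I σ ν := by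
  have hu : ∀ t ∈ I, deriv (normalize σ) t = unitDeriv (σ t) (deriv σ t) := fun t ht =>
    (hasDerivAt_normalize (hasDerivAt_of_contDiffOn hI hσ ht) (h0 t ht)).deriv
  have hc : ∀ t ∈ I, inner ℝ (ν t) (σ t) = 0 := fun t ht => by
    have := h.inner_curve t ht
    rw [normalize, inner_smul_right] at this
    exact (mul_eq_zero.1 this).resolve_left (inv_ne_zero (norm_ne_zero_iff.2 (h0 t ht)))
  have hn : ∀ t ∈ I, ‖normalize σ t‖ = 1 := fun t ht => by
    rw [normalize, norm_smul, norm_inv, norm_norm, inv_mul_cancel₀ (norm_ne_zero_iff.2 (h0 t ht))]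
  refine ⟨h.contDiffOn, hc, fun t ht => ?_, fun t ht => ?_⟩
  · have h1 := h.inner_deriv t ht
    rw [hu t ht] at h1
    rw [eq_unitDeriv (h0 t ht) (deriv σ t), inner_add_right, inner_smul_right, inner_smul_right,
      h1, hc t ht]
    simp
  · obtain ⟨x, hx⟩ := h.exists_hasDerivAt t ht
    rw [unitDeriv_of_norm_eq_one hI (contDiffOn_normalize hσ h0) hn ht, hu t ht] at hx
    exact ⟨x, hx⟩

theorem normalComp_normalDeriv_congr {σ ν : ℝ → E p} (hI : IsOpen I) (hσ : ContDiffOn ℝ ∞ σ I)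
    (hτ : ContDiffOn ℝ ∞ τ I) (hrσ : ∀ t ∈ I, IsRegularAt σ t) (hrτ : ∀ t ∈ I, IsRegularAt τ t)
    (hνσ : IsParallelNormal I σ ν) (hντ : IsParallelNormal I τ ν) {K : ℕ}
    {T : (Fin (K + 3) → E p) → E p} (hT : ∀ z, IsRegularJet z → ContDiffAt ℝ ∞ T z)
    (h : EqOn (normalComp T σ ν) (normalComp T τ ν) I) :
    EqOn (normalComp (normalDeriv T) σ ν) (normalComp (normalDeriv T) τ ν) I := fun t ht =>
  (hνσ.hasDerivAt_normalComp hI hσ ht (hrσ t ht) hT).unique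
    ((hντ.hasDerivAt_normalComp hI hτ ht (hrτ t ht) hT).congr_of_eventuallyEq
      (Filter.eventually_of_mem (hI.mem_nhds ht) h))

/-- The derivative of the normalised curve is `unitDeriv σ σ'`, so both curves give the same
equation `ν' = -h u` and hence the same `h`; the normal derivatives agree because they are the
derivatives of `h`. -/
theorem normalComp_normalize {σ ν : ℝ → E p} (hI : IsOpen I) (hσ : ContDiffOn ℝ ∞ σ I)
    (h0 : ∀ t ∈ I, σ t ≠ 0) (hd : ∀ t ∈ I, deriv (normalize σ) t ≠ 0)
    (h : IsParallelNormal I (normalize σ) ν) :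
    EqOn (normalComp normalCurvDeriv σ ν) (normalComp normalCurvDeriv (normalize σ) ν) I ∧
    EqOn (normalComp normalCurvDeriv₂ σ ν) (normalComp normalCurvDeriv₂ (normalize σ) ν) I := by
  have hu : ∀ t ∈ I, deriv (normalize σ) t = unitDeriv (σ t) (deriv σ t) := fun t ht =>
    (hasDerivAt_normalize (hasDerivAt_of_contDiffOn hI hσ ht) (h0 t ht)).deriv
  have hn : ∀ t ∈ I, ‖normalize σ t‖ = 1 := fun t ht => by
    rw [normalize, norm_smul, norm_inv, norm_norm, inv_mul_cancel₀ (norm_ne_zero_iff.2 (h0 t ht))]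
  have hτ := contDiffOn_normalize hσ h0
  have hrτ : ∀ t ∈ I, IsRegularAt (normalize σ) t := fun t ht =>
    isRegularAt_of_norm_eq_one hI hτ hn ht (hd t ht)
  have hrσ : ∀ t ∈ I, IsRegularAt σ t := fun t ht => ⟨h0 t ht, hu t ht ▸ hd t ht⟩
  have hν := h.of_normalize hI hσ h0
  have e1 : EqOn (normalComp normalCurv σ ν) (normalComp normalCurv (normalize σ) ν) I := by
    intro t ht
    have h1 := (hν.hasDerivAt hI hσ ht (hrσ t ht)).unique (h.hasDerivAt hI hτ ht (hrτ t ht))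
    rw [unitDeriv_of_norm_eq_one hI hτ hn ht, ← hu t ht] at h1
    exact neg_injective (smul_left_injective ℝ (hd t ht) h1)
  have e2 := normalComp_normalDeriv_congr (K := 0) hI hσ hτ hrσ hrτ hν h
    (fun _ => contDiffAt_normalCurv) e1
  exact ⟨e2, normalComp_normalDeriv_congr (K := 1) hI hσ hτ hrσ hrτ hν h
    contDiffAt_normalCurvDeriv e2⟩

/-- If all components of the first two normal derivatives vanished at a point, these vectors would
lie in the plane of `σ` and `σ'`, and the jet of `σ` would belong to the thin set it avoids. Staying
in `detGeneric` keeps `τ' ≠ 0`, which the parallel frame requires. -/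
theorem dense_curvGeneric (hI : IsOpen I) (hIc : I.OrdConnected) (hne : I.Nonempty) (hp : 2 ≤ p) :
    Dense (detGeneric I p ∩ curvGeneric I p) := by
  refine dense_of_forall_whitneyNhd (isOpen_detGeneric hI) (dense_detGeneric hI (by omega))
    fun x _ m ε hε hpos hsub => ?_
  obtain ⟨y, hy, σ, hσ, hσ0, hyσ, hav⟩ := exists_perturbation_tangent hI (by omega)
    (isThin_normalCurvDeriv hI hp) x m hε hpos
  have hyd := hsub hy
  refine ⟨y, hy, hyd, ?_⟩
  have hd : ∀ t ∈ I, deriv y.τ t ≠ 0 := fun t ht => deriv_ne_zero_of_detGeneric hp hyd ht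
  obtain ⟨n, hpar, hon⟩ := exists_parallel_frame hI hIc hne y.contDiffOn_τ y.norm_τ hd
  rw [mem_curvGeneric_iff hI hd hpar hon]
  intro t ht
  by_contra! hcon
  rw [hyσ] at hcon hpar hd
  have hu : deriv (normalize σ) t = unitDeriv (σ t) (deriv σ t) :=
    (hasDerivAt_normalize (hasDerivAt_of_contDiffOn hI hσ ht) (hσ0 t ht)).deriv
  have hu0 : unitDeriv (σ t) (deriv σ t) ≠ 0 := hu ▸ hd t ht
  have hort : ∀ i, inner ℝ (n i t) (σ t) = 0 ∧
      inner ℝ (n i t) (unitDeriv (σ t) (deriv σ t)) = 0 := fun i =>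
    ⟨((hpar i).of_normalize hI hσ hσ0).inner_curve t ht, hu ▸ (hpar i).inner_deriv t ht⟩
  have hmem : ∀ {X : E p}, (∀ i, inner ℝ (n i t) X = 0) →
      X ∈ Submodule.span ℝ {σ t, unitDeriv (σ t) (deriv σ t)} := fun hX =>
    mem_span_pair_of_orthogonal (hσ0 t ht) hu0 (inner_unitDeriv_left (hσ0 t ht) _) (hon t ht)
      hort hX
  refine hav t ht ⟨IsRegularAt.isRegularJet ⟨hσ0 t ht, hu0⟩ 3, ?_, ?_⟩
  · change normalCurvDeriv (jet 4 σ t) ∈ Submodule.span ℝ {jet 5 σ t 0,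
      unitDeriv (jet 5 σ t 0) (jet 5 σ t 1)}
    rw [jet_zero 3, jet_one 3]
    exact hmem fun i => ((normalComp_normalize hI hσ hσ0 hd (hpar i)).1 ht).trans (hcon.1 i)
  · change normalCurvDeriv₂ (jet 5 σ t) ∈ Submodule.span ℝ {jet 5 σ t 0,
      unitDeriv (jet 5 σ t 0) (jet 5 σ t 1)}
    rw [jet_zero 3, jet_one 3]
    exact hmem fun i => ((normalComp_normalize hI hσ hσ0 hd (hpar i)).2 ht).trans (hcon.2 i)

end Frame

/-! ### The factor of the frontal curve -/

/-- The zeros of a function with nonvanishing derivative form a countable set. -/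
theorem countable_setOf_simple_zero {F : Type*} [NormedAddCommGroup F] [NormedSpace ℝ F]
    {I : Set ℝ} {f f' : ℝ → F} (hf : ∀ t ∈ I, HasDerivAt f (f' t) t)
    (h : ∀ t ∈ I, f t = 0 → f' t ≠ 0) : {t | t ∈ I ∧ f t = 0}.Countable := by
  have hdisc : DiscreteTopology {t | t ∈ I ∧ f t = 0} := by
    rw [discreteTopology_subtype_iff]
    rintro t ⟨ht, h0⟩
    have := (hf t ht).eventually_ne (c := 0) (h t ht h0)
    rw [← _root_.disjoint_iff, Filter.disjoint_principal_right]
    filter_upwards [this] with s hs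
    exact fun hs' => hs hs'.2
  exact countable_coe_iff.1 (countable_of_Lindelof_of_discrete (X := {t | t ∈ I ∧ f t = 0}))

theorem isThin_of_subset_range {I : Set ℝ} (hI : IsOpen I) {φ : ℝ × ℝ → ℝ × (Fin 3 → ℝ)}
    (hφ : ContDiff ℝ ∞ φ) {B : Set (ℝ × (Fin 3 → ℝ))} (hB : B ⊆ range φ) : IsThin I B :=
  IsThin.of_image hI isOpen_univ hφ.contDiffOn
    (by rw [image_univ]; exact inter_subset_left.trans hB) (by simp)

/-- A jet of `a` together with `t` has four coordinates, so thinness requires a description by two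
parameters. The condition `a = a' = 0` leaves `t` and `a''`. Conditions at countably many `t` need
one further equation on the jet. The last pair of equations, where some `c i ≠ 0`, expresses `a'`
and `a''` through `t` and `a`. -/
theorem isThin_factor {I : Set ℝ} (hI : IsOpen I) {q : ℕ} {D : ℝ → ℝ} {c c' c'' : Fin q → ℝ → ℝ}
    (hD : {t | t ∈ I ∧ D t = 0}.Countable) (hc : {t | t ∈ I ∧ ∀ i, c i t = 0}.Countable)
    (hcs : ∀ i, ContDiffOn ℝ ∞ (c i) I) (hcs' : ∀ i, ContDiffOn ℝ ∞ (c' i) I)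
    (hcs'' : ∀ i, ContDiffOn ℝ ∞ (c'' i) I)
    (hcc : ∀ t ∈ I, (∃ i, c i t ≠ 0) ∨ ∃ i, c' i t ≠ 0) :
    IsThin I {u : ℝ × (Fin 3 → ℝ) |
      (D u.1 = 0 ∧ ∀ i, u.2 0 * c' i u.1 - u.2 1 * c i u.1 = 0) ∨ (u.2 0 = 0 ∧ u.2 1 = 0) ∨
      (u.2 0 = 0 ∧ ∀ i, c i u.1 = 0) ∨
      ((∀ i, u.2 0 * c' i u.1 - u.2 1 * c i u.1 = 0) ∧
        ∀ i, u.2 0 * c'' i u.1 - u.2 2 * c i u.1 = 0)} := by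
  have h1 : IsThin I {u : ℝ × (Fin 3 → ℝ) | u.2 0 = 0 ∧ u.2 1 = 0} := by
    refine isThin_of_subset_range hI (φ := fun w => (w.1, ![0, 0, w.2])) ?_ ?_
    · refine contDiff_fst.prodMk (contDiff_pi.2 fun j => ?_)
      fin_cases j <;> simp <;> fun_prop
    · rintro ⟨t, α⟩ ⟨h0, h1⟩
      refine ⟨(t, α 2), Prod.ext rfl (funext fun j => ?_)⟩
      fin_cases j <;> simp_all
  have h2 : IsThin I (⋃ s : {t | t ∈ I ∧ ∀ i, c i t = 0},
      {u : ℝ × (Fin 3 → ℝ) | u.1 = s ∧ u.2 0 = 0}) := by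
    have := hc.to_subtype
    refine IsThin.iUnion fun s => isThin_of_subset_range hI
      (φ := fun w => (s, ![0, w.1, w.2])) ?_ ?_
    · refine contDiff_const.prodMk (contDiff_pi.2 fun j => ?_)
      fin_cases j <;> simp <;> fun_prop
    · rintro ⟨t, α⟩ ⟨h0, h1⟩
      refine ⟨(α 1, α 2), Prod.ext h0.symm (funext fun j => ?_)⟩
      fin_cases j <;> simp_all
  have h3 : IsThin I (⋃ s : {t | t ∈ I ∧ D t = 0},
      {u : ℝ × (Fin 3 → ℝ) | u.1 = s ∧ ∀ i, u.2 0 * c' i u.1 - u.2 1 * c i u.1 = 0}) := by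
    have := hD.to_subtype
    refine IsThin.iUnion fun ⟨s, hs⟩ => ?_
    rcases hcc s hs.1 with ⟨i, hi⟩ | ⟨i, hi⟩
    · refine isThin_of_subset_range hI
        (φ := fun w => (s, ![w.1, w.1 * (c' i s / c i s), w.2])) ?_ ?_
      · refine contDiff_const.prodMk (contDiff_pi.2 fun j => ?_)
        fin_cases j <;> simp <;> fun_prop
      · rintro ⟨t, α⟩ ⟨h0, h1⟩
        refine ⟨(α 0, α 2), Prod.ext h0.symm (funext fun j => ?_)⟩
        have := h1 i
        simp only at h0 this
        subst h0
        fin_cases j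
        · rfl
        · simp only [Fin.mk_one, Matrix.cons_val_one, Matrix.cons_val_zero]
          field_simp
          linarith
        · rfl
    · refine isThin_of_subset_range hI
        (φ := fun w => (s, ![w.1 * (c i s / c' i s), w.1, w.2])) ?_ ?_
      · refine contDiff_const.prodMk (contDiff_pi.2 fun j => ?_)
        fin_cases j <;> simp <;> fun_prop
      · rintro ⟨t, α⟩ ⟨h0, h1⟩
        refine ⟨(α 1, α 2), Prod.ext h0.symm (funext fun j => ?_)⟩
        have := h1 i
        simp only at h0 this
        subst h0
        fin_cases j
        · simp only [Fin.zero_eta, Matrix.cons_val_zero]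
          field_simp
          linarith
        · rfl
        · rfl
  have h4 : IsThin I (⋃ i, {u : ℝ × (Fin 3 → ℝ) | (u.1 ∈ I ∧ c i u.1 ≠ 0) ∧
      u.2 0 * c' i u.1 - u.2 1 * c i u.1 = 0 ∧ u.2 0 * c'' i u.1 - u.2 2 * c i u.1 = 0}) := by
    refine IsThin.iUnion fun i => ?_
    have hS : IsOpen (I ∩ c i ⁻¹' {0}ᶜ) :=
      (hcs i).continuousOn.isOpen_inter_preimage hI isOpen_compl_singleton
    refine IsThin.of_image hI (hS.prod (isOpen_univ (X := ℝ)))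
      (φ := fun w => (w.1, ![w.2, w.2 * (c' i w.1 / c i w.1), w.2 * (c'' i w.1 / c i w.1)]))
      ?_ ?_ (by simp)
    · have hm : MapsTo Prod.fst ((I ∩ c i ⁻¹' {0}ᶜ) ×ˢ (univ : Set ℝ)) I := fun w hw => hw.1.1
      have hq : ∀ {e : ℝ → ℝ}, ContDiffOn ℝ ∞ e I →
          ContDiffOn ℝ ∞ (fun w : ℝ × ℝ => w.2 * (e w.1 / c i w.1))
            ((I ∩ c i ⁻¹' {0}ᶜ) ×ˢ (univ : Set ℝ)) := fun he =>
        contDiff_snd.contDiffOn.mul ((he.comp contDiff_fst.contDiffOn hm).div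
          ((hcs i).comp contDiff_fst.contDiffOn hm) fun w hw => hw.1.2)
      refine contDiff_fst.contDiffOn.prodMk (contDiffOn_pi.2 fun j => ?_)
      fin_cases j
      · exact contDiff_snd.contDiffOn
      · exact hq (hcs' i)
      · exact hq (hcs'' i)
    · rintro ⟨t, α⟩ ⟨⟨⟨ht, h0⟩, h1, h2⟩, -⟩
      refine ⟨(t, α 0), ⟨⟨ht, h0⟩, mem_univ _⟩, Prod.ext rfl (funext fun j => ?_)⟩
      simp only at ht h0 h1 h2
      fin_cases j
      · rfl
      · simp only [Fin.mk_one, Matrix.cons_val_one, Matrix.cons_val_zero]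
        field_simp
        linarith
      · simp only [Fin.reduceFinMk, Matrix.cons_val]
        field_simp
        linarith
  refine (h1.union (h2.union (h3.union h4))).mono ?_
  rintro ⟨t, α⟩ ⟨h, ht, -⟩
  simp only [mem_ofPred_eq] at h ht
  simp only [mem_union, mem_iUnion, mem_ofPred_eq, Subtype.exists]
  rcases h with ⟨hD, h⟩ | h | ⟨h0, h⟩ | ⟨h, h'⟩
  · exact Or.inr (Or.inr (Or.inl ⟨t, ⟨ht, hD⟩, rfl, h⟩))
  · exact Or.inl h
  · exact Or.inr (Or.inl ⟨t, ⟨ht, h⟩, rfl, h0⟩)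
  -- Where all `c i` vanish, the equations reduce to `a * c' i = 0` with some `c' i ≠ 0`; this
  -- forces `a = 0`, a case already covered.
  · by_cases hc0 : ∀ i, c i t = 0
    · obtain ⟨i, hi⟩ := (hcc t ht).resolve_left (by push Not; exact hc0)
      refine Or.inr (Or.inl ⟨t, ⟨ht, hc0⟩, rfl, ?_⟩)
      have := h i
      rw [hc0 i, mul_zero, sub_zero] at this
      exact (mul_eq_zero.1 this).resolve_right hi
    · push Not at hc0
      obtain ⟨i, hi⟩ := hc0
      exact Or.inr (Or.inr (Or.inr ⟨i, ⟨ht, hi⟩, h i, h' i⟩))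

theorem contDiffOn_frameComp {I : Set ℝ} {p : ℕ} (hI : IsOpen I) {τ ν : ℝ → E p}
    (hτ : ContDiffOn ℝ ∞ τ I) (hn : ∀ t ∈ I, ‖τ t‖ = 1) (hd : ∀ t ∈ I, deriv τ t ≠ 0)
    (hν : ContDiffOn ℝ ∞ ν I) :
    ContDiffOn ℝ ∞ (normalComp normalCurv τ ν) I ∧
    ContDiffOn ℝ ∞ (normalComp normalCurvDeriv τ ν) I ∧
    ContDiffOn ℝ ∞ (normalComp normalCurvDeriv₂ τ ν) I ∧
    ContDiffOn ℝ ∞ (normalComp normalCurvDeriv₃ τ ν) I := by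
  have hr : ∀ t ∈ I, IsRegularAt τ t := fun t ht =>
    isRegularAt_of_norm_eq_one hI hτ hn ht (hd t ht)
  exact ⟨contDiffOn_normalComp (K := 1) hν hI hτ hr fun _ => contDiffAt_normalCurv,
    contDiffOn_normalComp (K := 2) hν hI hτ hr contDiffAt_normalCurvDeriv,
    contDiffOn_normalComp (K := 3) hν hI hτ hr contDiffAt_normalCurvDeriv₂,
    contDiffOn_normalComp (K := 4) hν hI hτ hr contDiffAt_normalCurvDeriv₃⟩

theorem hasDerivAt_frameComp {I : Set ℝ} {p : ℕ} {t : ℝ} (hI : IsOpen I) {τ ν : ℝ → E p}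
    (hτ : ContDiffOn ℝ ∞ τ I) (hn : ∀ t ∈ I, ‖τ t‖ = 1) (ht : t ∈ I) (hd : deriv τ t ≠ 0)
    (hν : IsParallelNormal I τ ν) :
    HasDerivAt (normalComp normalCurv τ ν) (normalComp normalCurvDeriv τ ν t) t ∧
    HasDerivAt (normalComp normalCurvDeriv τ ν) (normalComp normalCurvDeriv₂ τ ν t) t ∧
    HasDerivAt (normalComp normalCurvDeriv₂ τ ν) (normalComp normalCurvDeriv₃ τ ν t) t := by
  have hr := isRegularAt_of_norm_eq_one hI hτ hn ht hd
  exact ⟨hν.hasDerivAt_normalComp (K := 0) hI hτ ht hr fun _ => contDiffAt_normalCurv,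
    hν.hasDerivAt_normalComp (K := 1) hI hτ ht hr contDiffAt_normalCurvDeriv,
    hν.hasDerivAt_normalComp (K := 2) hI hτ ht hr contDiffAt_normalCurvDeriv₂⟩

theorem countable_frameDet_zero {I : Set ℝ} {p : ℕ} (hI : IsOpen I) {x : FrontalData I p}
    (hx : x ∈ detGeneric I p) : {t | t ∈ I ∧ frameDet (derivSeq x.τ t) = 0}.Countable :=
  countable_setOf_simple_zero (fun _ ht => hasDerivAt_frameDet hI x.contDiffOn_τ ht)
    fun t ht h => (hx t ht).resolve_left (not_not.2 h)

/-- The set of generic frontal data. -/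
def genericData (I : Set ℝ) (p : ℕ) : Set (FrontalData I p) :=
  detGeneric I p ∩ curvGeneric I p ∩ factorGeneric I p

theorem isOpen_genericData {I : Set ℝ} {p : ℕ} (hI : IsOpen I) : IsOpen (genericData I p) :=
  ((isOpen_detGeneric hI).inter (isOpen_curvGeneric hI)).inter (isOpen_factorGeneric hI)

/-- Only `a` is perturbed here. Thus the parallel frame, the determinant and the functions `c i`
stay fixed and enter the bad set of jets of `a` as given functions of `t`. -/
theorem dense_genericData {I : Set ℝ} {p : ℕ} (hI : IsOpen I) (hIc : I.OrdConnected)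
    (hne : I.Nonempty) (hp : 2 ≤ p) : Dense (genericData I p) := by
  refine dense_of_forall_whitneyNhd ((isOpen_detGeneric hI).inter (isOpen_curvGeneric hI))
    (dense_curvGeneric hI hIc hne hp) fun x hx m ε hε hpos hsub => ?_
  have hd : ∀ t ∈ I, deriv x.τ t ≠ 0 := fun t ht => deriv_ne_zero_of_detGeneric hp hx.1 ht
  obtain ⟨n, hpar, hon⟩ := exists_parallel_frame hI hIc hne x.contDiffOn_τ x.norm_τ hd
  have hcc := (mem_curvGeneric_iff hI hd hpar hon).1 hx.2
  have hs := fun i => contDiffOn_frameComp hI x.contDiffOn_τ x.norm_τ hd (hpar i).contDiffOn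
  have hD := fun i t ht => hasDerivAt_frameComp hI x.contDiffOn_τ x.norm_τ ht (hd t ht) (hpar i)
  have hc : {t | t ∈ I ∧ ∀ i, normalComp normalCurvDeriv x.τ (n i) t = 0}.Countable := by
    have := countable_setOf_simple_zero (I := I)
      (f := fun t i => normalComp normalCurvDeriv x.τ (n i) t)
      (f' := fun t i => normalComp normalCurvDeriv₂ x.τ (n i) t)
      (fun t ht => hasDerivAt_pi.2 fun i => (hD i t ht).2.1) (fun t ht h h' => by
        rcases hcc t ht with ⟨i, hi⟩ | ⟨i, hi⟩
        · exact hi (congrFun h i)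
        · exact hi (congrFun h' i))
    simpa only [funext_iff, Pi.zero_apply] using this
  obtain ⟨y, hy, hyτ, hav⟩ := exists_perturbation_factor hI (by omega)
    (isThin_factor hI (countable_frameDet_zero hI hx.1) hc (fun i => (hs i).2.1)
      (fun i => (hs i).2.2.1) (fun i => (hs i).2.2.2) hcc) x m hε hpos
  refine ⟨y, hy, hsub hy, ?_⟩
  rw [← hyτ] at hd hpar
  rw [mem_factorGeneric_iff hI hd hpar hon]
  intro t ht
  have h := hav t ht
  have h2 : jet 3 y.a t 2 = deriv (deriv y.a) t := by simp [jet, iteratedDeriv_succ]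
  simp only [mem_ofPred_eq, jet_zero 1, jet_one 1, h2, not_or, not_and, not_forall] at h
  rw [hyτ]
  refine ⟨or_iff_not_imp_left.2 fun hh => h.1 (not_not.1 hh),
    or_iff_not_imp_left.2 fun hh => h.2.1 (not_not.1 hh),
    or_iff_not_imp_left.2 fun hh => h.2.2.1 (not_not.1 hh),
    or_iff_not_imp_left.2 fun hh => h.2.2.2 ?_⟩
  push Not at hh
  exact hh

/-! ### Generic parameters -/

section Parameters

variable {q : ℕ}

/-- A closed null set has empty interior, so residuality comes together with full measure. -/
theorem isGeneric_of_isClosed_null {ι : Type*} [Countable ι] {B : ι → Set (Fin q → ℝ)}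
    {S : Set (Fin q → ℝ)} (hc : ∀ i, IsClosed (B i)) (h0 : ∀ i, volume (B i) = 0)
    (h : Sᶜ ⊆ ⋃ i, B i) : IsGeneric S := by
  have hS : ⋂ i, (B i)ᶜ ⊆ S := by rwa [← compl_iUnion, compl_subset_comm]
  refine ⟨mem_of_superset (countable_iInter_mem.2 fun i =>
    residual_of_dense_open (hc i).isOpen_compl ?_) hS, ?_⟩
  · exact interior_eq_empty_iff_dense_compl.1 (Measure.interior_eq_empty_of_null (h0 i))
  · exact measure_mono_null h (measure_iUnion_null h0)

theorem isClosed_setOf_sum_eq_zero (v : Fin q → ℝ) :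
    IsClosed {R : Fin q → ℝ | ∑ i, R i * v i = 0} :=
  isClosed_eq (by fun_prop) continuous_const

theorem volume_setOf_sum_eq_zero {v : Fin q → ℝ} (h : ∃ i, v i ≠ 0) :
    volume {R : Fin q → ℝ | ∑ i, R i * v i = 0} = 0 := by
  obtain ⟨i, hi⟩ := h
  let L : (Fin q → ℝ) →ₗ[ℝ] ℝ := ∑ i, v i • LinearMap.proj i
  have hL : ∀ R, L R = ∑ i, R i * v i := fun R => by simp [L, mul_comm]
  have := Measure.addHaar_submodule (volume : Measure (Fin q → ℝ)) (LinearMap.ker L) fun htop => by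
    have h1 : (Pi.single i 1 : Fin q → ℝ) ∈ LinearMap.ker L := htop ▸ Submodule.mem_top
    rw [LinearMap.mem_ker, hL] at h1
    simp [Pi.single_apply] at h1
    exact hi h1
  convert this using 2
  ext R
  simp [hL]

/-- The parameters with which a smooth family of hyperplanes is critical form a null set. -/
theorem volume_critical_eq_zero {I : Set ℝ} {w w' : Fin q → ℝ → ℝ}
    (hw : ∀ i, ∀ t ∈ I, HasDerivAt (w i) (w' i t) t) (i : Fin q) :
    volume {R : Fin q → ℝ | ∃ t ∈ I, w i t ≠ 0 ∧ ∑ j, R j * w j t = 0 ∧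
      ∑ j, R j * w' j t = 0} = 0 := by
  classical
  -- Where `w i ≠ 0`, the hyperplane equation is solved for `R i` as `ψ`. The map `Φ` takes the
  -- remaining parameters and the time, stored in the free coordinate `x i`, to the resulting `R`.
  -- Critical parameters are critical values of `Φ`, a map between spaces of equal dimension, and
  -- form a null set by Sard.
  set ψ : (Fin q → ℝ) → ℝ → ℝ := fun x s =>
    -(∑ j ∈ Finset.univ.erase i, x j * w j s) / w i s with hψ
  set Φ : (Fin q → ℝ) → (Fin q → ℝ) := fun x => Function.update x i (ψ x (x i)) with hΦ
  set S : Set (Fin q → ℝ) := {x | x i ∈ I ∧ w i (x i) ≠ 0 ∧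
    HasDerivAt (ψ x) 0 (x i)} with hS
  have hdiff : ∀ x ∈ S, DifferentiableAt ℝ Φ x := by
    rintro x ⟨hx, h0, -⟩
    have hwd : ∀ j, DifferentiableAt ℝ (fun y : Fin q → ℝ => w j (y i)) x := fun j =>
      DifferentiableAt.comp x (f := fun y : Fin q → ℝ => y i) (hw j _ hx).differentiableAt
        (by fun_prop)
    refine differentiableAt_pi.2 fun j => ?_
    by_cases hj : j = i
    · subst hj
      simp only [hΦ, hψ, Function.update_self]
      have hsum : DifferentiableAt ℝ (fun y : Fin q → ℝ =>
          ∑ k ∈ Finset.univ.erase j, y k * w k (y j)) x :=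
        DifferentiableAt.fun_sum fun k _ => (differentiableAt_apply k x).fun_mul (hwd k)
      simp only [div_eq_mul_inv]
      exact hsum.fun_neg.fun_mul ((hwd j).fun_inv h0)
    · simp only [hΦ, Function.update_of_ne hj]
      fun_prop
  -- Moving the coordinate `i` moves the time alone, and `ψ` is stationary in time on `S`; so the
  -- `i`-th basis vector lies in the kernel of the differential.
  have hdet : ∀ x ∈ S, (fderiv ℝ Φ x).det = 0 := by
    intro x hx
    have h1 : HasDerivAt (fun s => Φ (Function.update x i s))
        (fderiv ℝ Φ x (Pi.single i 1)) (x i) :=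
      HasFDerivAt.comp_hasDerivAt (x i) (f := Function.update x i) (l := Φ)
        (l' := fderiv ℝ Φ x) (by rw [Function.update_eq_self]; exact (hdiff x hx).hasFDerivAt)
        (hasDerivAt_update x i _)
    have h2 : (fun s => Φ (Function.update x i s)) = fun s => Function.update x i (ψ x s) := by
      funext s
      simp only [hΦ, Function.update_idem, Function.update_self]
      congr 1
      simp only [hψ]
      congr 2
      exact Finset.sum_congr rfl fun j hj => by
        rw [Function.update_of_ne (Finset.ne_of_mem_erase hj)]
    have h3 : HasDerivAt (fun s => Function.update x i (ψ x s)) 0 (x i) := by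
      refine hasDerivAt_pi.2 fun j => ?_
      by_cases hj : j = i
      · subst hj
        simpa using hx.2.2
      · simpa [Function.update_of_ne hj] using hasDerivAt_const (x i) (x j)
    rw [h2] at h1
    have h4 := h1.unique h3
    refine LinearMap.det_eq_zero_iff_ker_ne_bot.2 fun hb => ?_
    have h5 : (Pi.single i 1 : Fin q → ℝ) ∈ LinearMap.ker (fderiv ℝ Φ x).toLinearMap := h4
    rw [hb, Submodule.mem_bot] at h5
    simpa using congrFun h5 i
  refine measure_mono_null ?_ (addHaar_image_eq_zero_of_det_fderivWithin_eq_zero volume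
    (fun x hx => (hdiff x hx).hasFDerivAt.hasFDerivWithinAt) hdet)
  rintro R ⟨t, ht, h0, h1, h2⟩
  rw [← Finset.add_sum_erase _ _ (Finset.mem_univ i)] at h1 h2
  have hs : ∀ u : Fin q → ℝ → ℝ, ∀ s, ∑ j ∈ Finset.univ.erase i, Function.update R i t j * u j s =
      ∑ j ∈ Finset.univ.erase i, R j * u j s := fun u s =>
    Finset.sum_congr rfl fun j hj => by rw [Function.update_of_ne (Finset.ne_of_mem_erase hj)]
  have hψs : ψ (Function.update R i t) = ψ R := by
    funext s
    simp only [hψ, hs]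
  refine ⟨Function.update R i t, ⟨?_, ?_, ?_⟩, ?_⟩
  · simpa using ht
  · simpa using h0
  · rw [hψs, Function.update_self]
    have h3 : HasDerivAt (fun s => ∑ j ∈ Finset.univ.erase i, R j * w j s)
        (∑ j ∈ Finset.univ.erase i, R j * w' j t) t :=
      HasDerivAt.fun_sum fun j _ => (hw j t ht).const_mul (R j)
    refine (h3.neg.div (hw i t ht) h0).congr_deriv ?_
    rw [div_eq_zero_iff]
    left
    simp only [Pi.neg_apply]
    linear_combination (-w i t) * h2 + w' i t * h1
  · simp only [hΦ, Function.update_self, hψs, Function.update_idem]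
    have : ψ R t = R i := by
      simp only [hψ]
      rw [div_eq_iff h0]
      linarith
    rw [this, Function.update_eq_self]

theorem isClosed_setOf_exists_mem {F : ℝ → (Fin q → ℝ) → ℝ × ℝ} {K : Set ℝ}
    (hK : IsCompact K) (hF : ContinuousOn (Function.uncurry F) (K ×ˢ univ)) :
    IsClosed {R : Fin q → ℝ | ∃ t ∈ K, F t R = 0} := by
  have := isCompact_iff_compactSpace.1 hK
  have h1 : Continuous fun u : K × (Fin q → ℝ) => F u.1 u.2 :=
    hF.comp_continuous (f := fun u : K × (Fin q → ℝ) => ((u.1 : ℝ), u.2)) (by fun_prop)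
      fun u => ⟨u.1.2, mem_univ _⟩
  have h2 := isClosedMap_snd_of_compactSpace (X := K) _ (isClosed_eq h1 (continuous_const (y := 0)))
  convert h2 using 1
  ext R
  simp

/-- The first two conditions exclude one hyperplane of parameters for each of countably many points.
For the third, an exhaustion of `I` by compact sets makes the excluded sets closed, and Sard makes
them null. -/
theorem isGeneric_parameters {I : Set ℝ} (hI : IsOpen I) {D a : ℝ → ℝ} {c w w' : Fin q → ℝ → ℝ}
    (hw : ∀ i, ∀ t ∈ I, HasDerivAt (w i) (w' i t) t) (hw' : ∀ i, ContinuousOn (w' i) I)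
    (ha : {t | t ∈ I ∧ a t = 0}.Countable) (hD : {t | t ∈ I ∧ D t = 0}.Countable)
    (hac : ∀ t ∈ I, a t ≠ 0 ∨ ∃ i, c i t ≠ 0) (hDw : ∀ t ∈ I, D t ≠ 0 ∨ ∃ i, w i t ≠ 0)
    (hww : ∀ t ∈ I, (∃ i, w i t ≠ 0) ∨ ∃ i, w' i t ≠ 0) :
    IsGeneric {R : Fin q → ℝ | ∀ t ∈ I, (a t = 0 → ∑ i, R i * c i t ≠ 0) ∧
      (D t = 0 → ∑ i, R i * w i t ≠ 0) ∧ (∑ i, R i * w i t = 0 → ∑ i, R i * w' i t ≠ 0)} := by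
  have := ha.to_subtype
  have := hD.to_subtype
  have := hI.locallyCompactSpace
  have hsurj : ∀ t ∈ I, ∃ k, t ∈ (Subtype.val '' compactCovering I k : Set ℝ) := fun t ht => by
    obtain ⟨k, hk⟩ := mem_iUnion.1 ((iUnion_compactCovering I).ge (mem_univ ⟨t, ht⟩))
    exact ⟨k, ⟨t, ht⟩, hk, rfl⟩
  have hsub : ∀ k, (Subtype.val '' compactCovering I k : Set ℝ) ⊆ I := fun k =>
    Subtype.coe_image_subset I _
  have hwc : ∀ i, ContinuousOn (w i) I := fun i t ht => (hw i t ht).continuousAt.continuousWithinAt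
  refine isGeneric_of_isClosed_null (ι := {t | t ∈ I ∧ a t = 0} ⊕ {t | t ∈ I ∧ D t = 0} ⊕ ℕ)
    (B := Sum.elim (fun t => {R | ∑ i, R i * c i t = 0})
      (Sum.elim (fun t => {R | ∑ i, R i * w i t = 0})
        (fun k => {R | ∃ t ∈ (Subtype.val '' compactCovering I k : Set ℝ),
          (∑ i, R i * w i t, ∑ i, R i * w' i t) = (0 : ℝ × ℝ)}))) ?_ ?_ ?_
  · rintro (t | t | k)
    · exact isClosed_setOf_sum_eq_zero _
    · exact isClosed_setOf_sum_eq_zero _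
    · refine isClosed_setOf_exists_mem
        (F := fun t R => (∑ i, R i * w i t, ∑ i, R i * w' i t))
        ((isCompact_compactCovering I k).image continuous_subtype_val) ?_
      have hf : ∀ {u : Fin q → ℝ → ℝ}, (∀ i, ContinuousOn (u i) I) →
          ContinuousOn (fun z : ℝ × (Fin q → ℝ) => ∑ i, z.2 i * u i z.1)
            ((Subtype.val '' compactCovering I k : Set ℝ) ×ˢ univ) := fun hu =>
        continuousOn_finsetSum _ fun i _ => ContinuousOn.mul (by fun_prop)
          ((hu i).comp continuous_fst.continuousOn fun z hz => hsub k hz.1)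
      exact (hf hwc).prodMk (hf hw')
  · rintro (⟨t, ht⟩ | ⟨t, ht⟩ | k)
    · exact volume_setOf_sum_eq_zero ((hac t ht.1).resolve_left (not_not.2 ht.2))
    · exact volume_setOf_sum_eq_zero ((hDw t ht.1).resolve_left (not_not.2 ht.2))
    · have hz : {t | t ∈ I ∧ ∀ i, w i t = 0}.Countable := by
        have := countable_setOf_simple_zero (f := fun t i => w i t) (f' := fun t i => w' i t)
          (fun t ht => hasDerivAt_pi.2 fun i => hw i t ht) fun t ht h h' => by
            rcases hww t ht with ⟨i, hi⟩ | ⟨i, hi⟩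
            · exact hi (congrFun h i)
            · exact hi (congrFun h' i)
        simpa only [funext_iff, Pi.zero_apply] using this
      have := hz.to_subtype
      -- The points at which the whole vector `w` vanishes are isolated and each gives a proper
      -- hyperplane through `w'`; at the other points some `w i ≠ 0`, and the Sard argument for that
      -- index applies.
      refine measure_mono_null (t := (⋃ t : {t | t ∈ I ∧ ∀ i, w i t = 0},
        {R : Fin q → ℝ | ∑ i, R i * w' i t = 0}) ∪ ⋃ i, {R : Fin q → ℝ | ∃ t ∈ I, w i t ≠ 0 ∧
          ∑ j, R j * w j t = 0 ∧ ∑ j, R j * w' j t = 0}) ?_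
        (measure_union_null (measure_iUnion_null fun t => ?_)
          (measure_iUnion_null fun i => volume_critical_eq_zero hw i))
      · rintro R ⟨t, htk, hR⟩
        have ht := hsub k htk
        obtain ⟨h1, h2⟩ := Prod.ext_iff.1 hR
        by_cases h : ∀ i, w i t = 0
        · exact Or.inl (mem_iUnion.2 ⟨⟨t, ht, h⟩, h2⟩)
        · push Not at h
          obtain ⟨i, hi⟩ := h
          exact Or.inr (mem_iUnion.2 ⟨i, t, ht, hi, h1, h2⟩)
      · exact volume_setOf_sum_eq_zero
          ((hww t t.2.1).resolve_left (by push Not; exact t.2.2))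
  · intro R hR
    simp only [mem_compl_iff, mem_ofPred_eq, not_forall] at hR
    obtain ⟨t, ht, hR⟩ := hR
    rw [mem_iUnion]
    by_cases h1 : a t = 0 → ∑ i, R i * c i t ≠ 0
    · by_cases h2 : D t = 0 → ∑ i, R i * w i t ≠ 0
      · obtain ⟨k, hk⟩ := hsurj t ht
        have h3 : ¬ (∑ i, R i * w i t = 0 → ∑ i, R i * w' i t ≠ 0) := fun h => hR ⟨h1, h2, h⟩
        push Not at h3
        exact ⟨Sum.inr (Sum.inr k), t, hk, Prod.ext h3.1 h3.2⟩
      · push Not at h2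
        exact ⟨Sum.inr (Sum.inl ⟨t, ht, h2.1⟩), h2.2⟩
    · push Not at h1
      exact ⟨Sum.inl ⟨t, ht, h1.1⟩, h1.2⟩

end Parameters

/-! ### Tangent surfaces -/

section Surface

variable {I : Set ℝ} {p : ℕ} {t : ℝ}

theorem FrontalData.IsCurve.contDiffOn {x : FrontalData I p} {f : ℝ → E p} (hf : x.IsCurve f)
    (hI : IsOpen I) : ContDiffOn ℝ ∞ f I := by
  rw [contDiffOn_infty_iff_deriv_of_isOpen hI]
  refine ⟨fun t ht => (hf t ht).differentiableAt.differentiableWithinAt, ?_⟩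
  exact (x.contDiffOn_a.smul x.contDiffOn_τ).congr fun t ht => (hf t ht).deriv

theorem contDiffOn_comp_fst {W : Type*} [NormedAddCommGroup W] [NormedSpace ℝ W] {v : ℝ → W}
    (hv : ContDiffOn ℝ ∞ v I) : ContDiffOn ℝ ∞ (fun u : ℝ × ℝ => v u.1) (I ×ˢ univ) :=
  hv.comp contDiff_fst.contDiffOn fun _ hu => hu.1

theorem contDiffOn_tangentSurface {x : FrontalData I p} {f : ℝ → E p} (hf : x.IsCurve f)
    (hI : IsOpen I) : ContDiffOn ℝ ∞ (tangentSurface f x.τ) (I ×ˢ univ) :=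
  (contDiffOn_comp_fst (hf.contDiffOn hI)).add
    (contDiff_snd.contDiffOn.smul (contDiffOn_comp_fst x.contDiffOn_τ))

theorem hasFDerivAt_comp_fst {W : Type*} [NormedAddCommGroup W] [NormedSpace ℝ W] {v : ℝ → W}
    {v' : W} {u : ℝ × ℝ} (hv : HasDerivAt v v' u.1) :
    HasFDerivAt (fun u : ℝ × ℝ => v u.1) ((ContinuousLinearMap.fst ℝ ℝ ℝ).smulRight v') u := by
  have h := HasFDerivAt.comp u (f := Prod.fst) hv.hasFDerivAt hasFDerivAt_fst
  refine h.congr_fderiv ?_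
  ext <;> simp

theorem fderiv_tangentSurface {x : FrontalData I p} {f : ℝ → E p} (hf : x.IsCurve f)
    (hI : IsOpen I) {u : ℝ × ℝ} (hu : u.1 ∈ I) (v : ℝ × ℝ) :
    fderiv ℝ (tangentSurface f x.τ) u v =
      v.1 • (x.a u.1 • x.τ u.1 + u.2 • deriv x.τ u.1) + v.2 • x.τ u.1 := by
  have h1 := hasFDerivAt_comp_fst (hf u.1 hu)
  have h2 := hasFDerivAt_comp_fst (hasDerivAt_of_contDiffOn hI x.contDiffOn_τ hu)
  have h3 : HasFDerivAt (fun u : ℝ × ℝ => u.2) (ContinuousLinearMap.snd ℝ ℝ ℝ) u := hasFDerivAt_snd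
  have h4 : HasFDerivAt (tangentSurface f x.τ) _ u := h1.add (h3.smul h2)
  rw [h4.fderiv]
  simp only [add_apply, smul_apply, ContinuousLinearMap.smulRight_apply,
    ContinuousLinearMap.coe_fst', ContinuousLinearMap.coe_snd']
  module

/-- The partial derivatives of the surface are `τ` and `a τ + s τ'`, which give orthogonality to
`τ'` only for `s ≠ 0`; continuity along the ruling extends it to `s = 0`. -/
theorem IsNormalField.inner_eq_zero {x : FrontalData I p} {f : ℝ → E p} (hf : x.IsCurve f)
    (hI : IsOpen I) {O : Set (ℝ × ℝ)} (hO : IsOpen O) (hOI : O ⊆ I ×ˢ univ) {ξ : ℝ × ℝ → E p}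
    (hξ : IsNormalField O (tangentSurface f x.τ) ξ) {u : ℝ × ℝ} (hu : u ∈ O) :
    inner ℝ (ξ u) (x.τ u.1) = 0 ∧ inner ℝ (ξ u) (deriv x.τ u.1) = 0 := by
  have h1 : ∀ w ∈ O, inner ℝ (ξ w) (x.τ w.1) = 0 := fun w hw => by
    have := hξ.2 w hw (0, 1)
    rw [fderiv_tangentSurface hf hI (hOI hw).1] at this
    simpa using this
  have h2 : ∀ w ∈ O, w.2 ≠ 0 → inner ℝ (ξ w) (deriv x.τ w.1) = 0 := fun w hw hw0 => by
    have := hξ.2 w hw (1, 0)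
    rw [fderiv_tangentSurface hf hI (hOI hw).1] at this
    simpa [inner_add_right, inner_smul_right, h1 w hw, hw0] using this
  refine ⟨h1 u hu, ?_⟩
  have hl : ContinuousAt (fun s : ℝ => (u.1, s)) u.2 := by fun_prop
  have hc : ContinuousAt (fun s : ℝ => inner ℝ (ξ (u.1, s)) (deriv x.τ u.1)) u.2 :=
    ContinuousAt.inner (𝕜 := ℝ) (ContinuousAt.comp (f := fun s : ℝ => (u.1, s)) (g := ξ)
      (hξ.1.continuousOn.continuousAt (hO.mem_nhds hu)) hl) continuousAt_const
  have hev : ∀ᶠ s in 𝓝[≠] u.2, inner ℝ (ξ (u.1, s)) (deriv x.τ u.1) = 0 := by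
    have hmem : ∀ᶠ s in 𝓝 u.2, (u.1, s) ∈ O := hl.eventually (hO.mem_nhds hu)
    have hne : ∀ᶠ s in 𝓝[≠] u.2, s ≠ 0 := by
      by_cases h : u.2 = 0
      · rw [h]; exact self_mem_nhdsWithin
      · exact eventually_nhdsWithin_of_eventually_nhds (eventually_ne_nhds h)
    filter_upwards [eventually_nhdsWithin_of_eventually_nhds hmem, hne] with s hs hs0
    exact h2 _ hs hs0
  exact tendsto_nhds_unique (hc.tendsto.mono_left nhdsWithin_le_nhds)
    (tendsto_const_nhds.congr' (hev.mono fun s hs => hs.symm))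

theorem IsParallelNormal.isNormalField {x : FrontalData I p} {f : ℝ → E p} (hf : x.IsCurve f)
    (hI : IsOpen I) {n : ℝ → E p} (hn : IsParallelNormal I x.τ n) :
    IsNormalField (I ×ˢ univ) (tangentSurface f x.τ) (fun u => n u.1) := by
  refine ⟨contDiffOn_comp_fst hn.contDiffOn, fun u hu v => ?_⟩
  rw [fderiv_tangentSurface hf hI hu.1]
  simp [inner_add_right, inner_smul_right, hn.inner_curve _ hu.1, hn.inner_deriv _ hu.1]

theorem IsParallelNormal.isNormallyParallel {x : FrontalData I p} {f : ℝ → E p} (hf : x.IsCurve f)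
    (hI : IsOpen I) {n : ℝ → E p} (hn : IsParallelNormal I x.τ n) :
    IsNormallyParallel (I ×ˢ univ) (tangentSurface f x.τ) (fun u => n u.1) := by
  refine ⟨hn.isNormalField hf hI, fun O hOI hO ξ hξ u hu v => ?_⟩
  have ht := (hOI hu).1
  obtain ⟨y, hy⟩ := hn.exists_hasDerivAt u.1 ht
  rw [unitDeriv_of_norm_eq_one hI x.contDiffOn_τ x.norm_τ ht] at hy
  rw [(hasFDerivAt_comp_fst hy).fderiv, ContinuousLinearMap.smulRight_apply, inner_smul_left,
    inner_smul_left, real_inner_comm, (hξ.inner_eq_zero hf hI hO hOI hu).2]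
  simp

/-- The vectors `a τ + s τ'` and `τ` are independent for `s ≠ 0`, so the singular points lie on the
line `s = 0`. -/
theorem isProperFrontal_tangentSurface {x : FrontalData I p} {f : ℝ → E p} (hf : x.IsCurve f)
    (hI : IsOpen I) (hd : ∀ t ∈ I, deriv x.τ t ≠ 0) {n : Fin (p - 1) → ℝ → E p}
    (hpar : ∀ i, IsParallelNormal I x.τ (n i)) (hon : ∀ t ∈ I, Orthonormal ℝ fun i => n i t) :
    IsProperFrontal (p - 1) (I ×ˢ univ) (tangentSurface f x.τ) := by
  refine ⟨contDiffOn_tangentSurface hf hI, fun u hu => ⟨_, subset_rfl, hI.prod isOpen_univ, hu,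
    fun i u => n i u.1, fun i => (hpar i).isNormalField hf hI, fun w hw => hon w.1 hw.1⟩, ?_⟩
  have h0 : IsNowhereDense ((univ : Set ℝ) ×ˢ ({0} : Set ℝ)) := by
    rw [(isClosed_univ.prod isClosed_singleton).isNowhereDense_iff, interior_prod_eq,
      interior_singleton, prod_empty]
  refine h0.mono ?_
  rintro u ⟨hu, hinj⟩
  refine ⟨mem_univ _, ?_⟩
  by_contra hu0
  refine hinj ((injective_iff_map_eq_zero _).2 fun v hv => ?_)
  rw [fderiv_tangentSurface hf hI hu.1] at hv
  have h1 := inner_deriv_of_norm_eq_one hI x.contDiffOn_τ x.norm_τ hu.1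
  have h2 := congrArg (inner ℝ (deriv x.τ u.1)) hv
  simp only [inner_add_right, inner_smul_right, real_inner_comm, h1, inner_zero_right,
    mul_zero, zero_add, add_zero] at h2
  have h3 : v.1 = 0 := by
    rcases mul_eq_zero.1 h2 with h | h
    · exact h
    · rcases mul_eq_zero.1 h with h | h
      · exact absurd h hu0
      · exact absurd (inner_self_eq_zero.1 h) (hd _ hu.1)
  rw [h3, zero_smul, zero_add, smul_eq_zero] at hv
  refine Prod.ext h3 (hv.resolve_right fun h => ?_)
  simpa [h] using x.norm_τ _ hu.1

theorem isBishopFrame_tangentSurface {x : FrontalData I p} {f : ℝ → E p} (hf : x.IsCurve f)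
    (hI : IsOpen I) {n : Fin (p - 1) → ℝ → E p}
    (hpar : ∀ i, IsParallelNormal I x.τ (n i)) (hon : ∀ t ∈ I, Orthonormal ℝ fun i => n i t) :
    IsBishopFrame (I ×ˢ univ) (tangentSurface f x.τ) (fun i u => n i u.1) :=
  ⟨fun i => (hpar i).isNormallyParallel hf hI, fun u hu => hon u.1 hu.1⟩

/-- A vector orthogonal to the normal frame and to `a` is a multiple of `b`. -/
theorem exists_eq_smul_of_orthogonal {a b : E p} (ha : a ≠ 0) (hb : b ≠ 0) (hab : inner ℝ a b = 0)
    {n : Fin (p - 1) → E p} (hn : Orthonormal ℝ n)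
    (hnab : ∀ i, inner ℝ (n i) a = 0 ∧ inner ℝ (n i) b = 0) {X : E p}
    (hX : ∀ i, inner ℝ (n i) X = 0) (hXa : inner ℝ a X = 0) : ∃ y : ℝ, X = y • b := by
  obtain ⟨α, β, rfl⟩ := Submodule.mem_span_pair.1 (mem_span_pair_of_orthogonal ha hb hab hn hnab hX)
  rw [inner_add_right, inner_smul_right, inner_smul_right, hab, mul_zero, add_zero] at hXa
  have : α = 0 := (mul_eq_zero.1 hXa).resolve_right (inner_self_ne_zero.2 ha)
  exact ⟨β, by rw [this, zero_smul, zero_add]⟩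

/-- A derivative of `ν` is orthogonal to the normal frame. Along `t` it is also orthogonal to `τ`,
as one sees by differentiating `⟨τ, ν⟩ = 0`, so it is a multiple of `τ'`. Along `s` the vectors `τ`
and `τ'` are constant, so it is orthogonal to both and vanishes. -/
theorem IsNormallyParallel.eq_comp_fst {x : FrontalData I p} {f : ℝ → E p} (hf : x.IsCurve f)
    (hI : IsOpen I) (hd : ∀ t ∈ I, deriv x.τ t ≠ 0) {n : Fin (p - 1) → ℝ → E p}
    (hpar : ∀ i, IsParallelNormal I x.τ (n i)) (hon : ∀ t ∈ I, Orthonormal ℝ fun i => n i t)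
    {ν : ℝ × ℝ → E p} (hν : IsNormallyParallel (I ×ˢ univ) (tangentSurface f x.τ) ν) :
    IsParallelNormal I x.τ (fun t => ν (t, 0)) ∧ ∀ u ∈ I ×ˢ (univ : Set ℝ), ν u = ν (u.1, 0) := by
  have hΩ : IsOpen (I ×ˢ (univ : Set ℝ)) := hI.prod isOpen_univ
  have hort := fun u hu => hν.1.inner_eq_zero hf hI hΩ subset_rfl (u := u) hu
  have hdν : ∀ u ∈ I ×ˢ (univ : Set ℝ), HasFDerivAt ν (fderiv ℝ ν u) u := fun u hu =>
    ((hν.1.1.contDiffAt (hΩ.mem_nhds hu)).differentiableAt (by simp)).hasFDerivAt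
  have hn0 : ∀ t ∈ I, x.τ t ≠ 0 := fun t ht h => by simpa [h] using x.norm_τ t ht
  have hperp : ∀ u ∈ I ×ˢ (univ : Set ℝ), ∀ v i, inner ℝ (n i u.1) (fderiv ℝ ν u v) = 0 :=
    fun u hu v i => by
      rw [real_inner_comm]
      exact hν.2 _ subset_rfl hΩ _ ((hpar i).isNormalField hf hI) u hu v
  have hmul : ∀ u ∈ I ×ˢ (univ : Set ℝ), ∀ v, inner ℝ (x.τ u.1) (fderiv ℝ ν u v) = 0 →
      ∃ y : ℝ, fderiv ℝ ν u v = y • deriv x.τ u.1 := fun u hu v hv =>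
    exists_eq_smul_of_orthogonal (hn0 _ hu.1) (hd _ hu.1)
      (inner_deriv_of_norm_eq_one hI x.contDiffOn_τ x.norm_τ hu.1) (hon _ hu.1)
      (fun i => ⟨(hpar i).inner_curve _ hu.1, (hpar i).inner_deriv _ hu.1⟩) (hperp u hu v) hv
  constructor
  · have hder : ∀ t ∈ I, HasDerivAt (fun t => ν (t, 0)) (fderiv ℝ ν (t, 0) (1, 0)) t :=
      fun t ht => HasFDerivAt.comp_hasDerivAt t (f := fun t : ℝ => (t, (0 : ℝ)))
        (hdν (t, 0) ⟨ht, mem_univ _⟩) ((hasDerivAt_id t).prodMk (hasDerivAt_const t (0 : ℝ)))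
    refine ⟨hν.1.1.comp (f := fun t : ℝ => (t, (0 : ℝ))) (by fun_prop) fun t ht =>
      ⟨ht, mem_univ _⟩, fun t ht => (hort (t, 0) ⟨ht, mem_univ _⟩).1,
      fun t ht => (hort (t, 0) ⟨ht, mem_univ _⟩).2, fun t ht => ?_⟩
    have hz : HasDerivAt (fun s => inner ℝ (x.τ s) (ν (s, 0))) 0 t :=
      (hasDerivAt_const t (0 : ℝ)).congr_of_eventuallyEq (Filter.eventually_of_mem (hI.mem_nhds ht)
        fun s hs => (real_inner_comm _ _).trans (hort (s, 0) ⟨hs, mem_univ _⟩).1)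
    have h1 := ((hasDerivAt_of_contDiffOn hI x.contDiffOn_τ ht).inner ℝ (hder t ht)).unique hz
    rw [real_inner_comm _ (deriv x.τ t), (hort (t, 0) ⟨ht, mem_univ _⟩).2, add_zero] at h1
    obtain ⟨y, hy⟩ := hmul (t, 0) ⟨ht, mem_univ _⟩ (1, 0) h1
    refine ⟨y, ?_⟩
    rw [unitDeriv_of_norm_eq_one hI x.contDiffOn_τ x.norm_τ ht, ← hy]
    exact hder t ht
  · rintro ⟨t, s⟩ ⟨ht, -⟩
    have hmem : ∀ s : ℝ, (t, s) ∈ I ×ˢ (univ : Set ℝ) := fun s => ⟨ht, mem_univ _⟩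
    have hder : ∀ s : ℝ, HasDerivAt (fun s => ν (t, s)) (fderiv ℝ ν (t, s) (0, 1)) s := fun s =>
      HasFDerivAt.comp_hasDerivAt s (f := fun s : ℝ => (t, s)) (hdν (t, s) (hmem s))
        ((hasDerivAt_const s t).prodMk (hasDerivAt_id s))
    have hconst : ∀ w : E p, (∀ s : ℝ, inner ℝ (ν (t, s)) w = 0) → ∀ s : ℝ,
        inner ℝ w (fderiv ℝ ν (t, s) (0, 1)) = 0 := fun w hw s => by
      have h1 := (hasDerivAt_const s w).inner ℝ (hder s)
      have h2 : (fun s => inner ℝ w (ν (t, s))) = fun _ => (0 : ℝ) := funext fun s => by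
        rw [real_inner_comm, hw]
      rw [h2] at h1
      simpa using (h1.unique (hasDerivAt_const s (0 : ℝ)))
    have hzero : ∀ s : ℝ, HasDerivAt (fun s => ν (t, s)) 0 s := fun s => by
      obtain ⟨y, hy⟩ := hmul (t, s) (hmem s) (0, 1)
        (hconst (x.τ t) (fun s => (hort (t, s) (hmem s)).1) s)
      have h1 := hconst (deriv x.τ t) (fun s => (hort (t, s) (hmem s)).2) s
      rw [hy, inner_smul_right] at h1
      have hy0 : y = 0 := (mul_eq_zero.1 h1).resolve_right (inner_self_ne_zero.2 (hd t ht))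
      have := hder s
      rwa [hy, hy0, zero_smul] at this
    exact eq_of_hasDerivAt_zero isOpen_univ ordConnected_univ (fun s _ => hzero s) (mem_univ s)
      (mem_univ 0)

/-! ### Directrices -/

/-- The directrix of the parallel at distance `r` in the direction of `m`. -/
noncomputable def directrix (f τ m : ℝ → E p) (r t : ℝ) : E p :=
  f t + r • m t + (r * normalComp normalCurv τ m t) • τ t

/-- The term `r h τ` is chosen so that its part `r h τ'` cancels `r m' = -r h τ'`. -/
theorem hasDerivAt_directrix {x : FrontalData I p} {f m : ℝ → E p} (hf : x.IsCurve f)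
    (hI : IsOpen I) (ht : t ∈ I) (hd : deriv x.τ t ≠ 0) (hm : IsParallelNormal I x.τ m) (r : ℝ) :
    HasDerivAt (directrix f x.τ m r)
      ((x.a t + r * normalComp normalCurvDeriv x.τ m t) • x.τ t) t := by
  have hr := isRegularAt_of_norm_eq_one hI x.contDiffOn_τ x.norm_τ ht hd
  have h1 := hm.hasDerivAt hI x.contDiffOn_τ ht hr
  rw [unitDeriv_of_norm_eq_one hI x.contDiffOn_τ x.norm_τ ht] at h1
  have h2 := (hasDerivAt_frameComp hI x.contDiffOn_τ x.norm_τ ht hd hm).1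
  have h3 := hasDerivAt_of_contDiffOn hI x.contDiffOn_τ ht
  refine (((hf t ht).add (h1.const_smul r)).add ((h2.const_mul r).smul h3)).congr_deriv ?_
  module

theorem isDirectrix_directrix {x : FrontalData I p} {f m : ℝ → E p} (hf : x.IsCurve f)
    (hI : IsOpen I) (hd : ∀ t ∈ I, deriv x.τ t ≠ 0) (hm : IsParallelNormal I x.τ m) (r : ℝ)
    {P : ℝ × ℝ → E p} (hP : ∀ u ∈ I ×ˢ (univ : Set ℝ), P u = tangentSurface f x.τ u + r • m u.1) :
    IsDirectrix I P (directrix f x.τ m r) := by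
  have hh := (contDiffOn_frameComp hI x.contDiffOn_τ x.norm_τ hd hm.contDiffOn).1
  have hfs := hf.contDiffOn hI
  have hms := hm.contDiffOn
  have hτs := x.contDiffOn_τ
  have hgs : ContDiffOn ℝ ∞ (directrix f x.τ m r) I := by
    unfold directrix
    fun_prop
  have hφ := contDiffOn_comp_fst hh
  refine ⟨hgs, x.τ, hτs, x.norm_τ,
    fun t ht => ⟨_, (hasDerivAt_directrix hf hI ht (hd t ht) hm r).deriv⟩,
    fun u => u.2 - r * normalComp normalCurv x.τ m u.1, by fun_prop,
    fun t _ => (Equiv.subRight (r * normalComp normalCurv x.τ m t)).bijective,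
    fun t _ s => ?_, fun t ht s => ?_⟩
  · have : HasDerivAt (fun s' => s' - r * normalComp normalCurv x.τ m t) 1 s :=
      (hasDerivAt_id s).sub_const _
    rw [this.deriv]
    exact one_ne_zero
  · rw [hP (t, s) ⟨ht, mem_univ _⟩]
    simp only [tangentSurface, directrix]
    module

/-- Comparing the rulings at `s = 0` and `s = 1` shows that `σ = ±τ` and that `g = f + r m + ψ τ`
with `ψ` smooth. The component of `g'` along `τ'` is `ψ - r h` and has to vanish. -/
theorem IsDirectrix.eq_directrix {x : FrontalData I p} {f m : ℝ → E p} (hf : x.IsCurve f)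
    (hI : IsOpen I) (hd : ∀ t ∈ I, deriv x.τ t ≠ 0) (hm : IsParallelNormal I x.τ m) {r : ℝ}
    {P : ℝ × ℝ → E p} (hP : ∀ u ∈ I ×ˢ (univ : Set ℝ), P u = tangentSurface f x.τ u + r • m u.1)
    {g : ℝ → E p} (hg : IsDirectrix I P g) : EqOn g (directrix f x.τ m r) I := by
  obtain ⟨hgs, σ, hσ, hσn, hgσ, φ, hφ, -, -, hPφ⟩ := hg
  have key : ∀ t ∈ I, ∀ s, f t + s • x.τ t + r • m t = g t + φ (t, s) • σ t := fun t ht s => by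
    have h1 := hPφ t ht s
    rwa [hP (t, s) ⟨ht, mem_univ _⟩] at h1
  have hτσ : ∀ t ∈ I, x.τ t = (φ (t, 1) - φ (t, 0)) • σ t := fun t ht => by
    have h1 := key t ht 1
    have h0 := key t ht 0
    rw [sub_smul, eq_sub_iff_add_eq.2 ((add_comm _ _).trans h1.symm),
      eq_sub_iff_add_eq.2 ((add_comm _ _).trans h0.symm)]
    module
  have hsq : ∀ t ∈ I, (φ (t, 1) - φ (t, 0)) * (φ (t, 1) - φ (t, 0)) = 1 := fun t ht => by
    have h1 := congrArg norm (hτσ t ht)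
    rw [x.norm_τ t ht, norm_smul, hσn t ht, mul_one] at h1
    rw [← abs_mul_abs_self, ← Real.norm_eq_abs, ← h1, one_mul]
  have hστ : ∀ t ∈ I, σ t = (φ (t, 1) - φ (t, 0)) • x.τ t := fun t ht => by
    rw [hτσ t ht, smul_smul, hsq t ht, one_smul]
  have hφs : ∀ s : ℝ, ContDiffOn ℝ ∞ (fun t => φ (t, s)) I := fun s =>
    hφ.comp (f := fun t : ℝ => (t, s)) (by fun_prop) fun t ht => ⟨ht, mem_univ _⟩
  set ψ : ℝ → ℝ := fun t => -φ (t, 0) * (φ (t, 1) - φ (t, 0)) with hψ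
  have hψs : ContDiffOn ℝ ∞ ψ I := (hφs 0).neg.mul ((hφs 1).sub (hφs 0))
  have hgeq : ∀ t ∈ I, g t = f t + r • m t + ψ t • x.τ t := fun t ht => by
    have h0 := key t ht 0
    rw [hστ t ht, smul_smul] at h0
    rw [eq_sub_iff_add_eq.2 h0.symm]
    simp only [hψ]
    module
  intro t ht
  rw [hgeq t ht, directrix]
  congr 2
  have hr := isRegularAt_of_norm_eq_one hI x.contDiffOn_τ x.norm_τ ht (hd t ht)
  have h1 := hm.hasDerivAt hI x.contDiffOn_τ ht hr
  rw [unitDeriv_of_norm_eq_one hI x.contDiffOn_τ x.norm_τ ht] at h1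
  have h2 := hasDerivAt_of_contDiffOn hI hψs ht
  have h3 := hasDerivAt_of_contDiffOn hI x.contDiffOn_τ ht
  have h4 := (((hf t ht).add (h1.const_smul r)).add (h2.smul h3)).congr_of_eventuallyEq
    (Filter.eventually_of_mem (hI.mem_nhds ht) hgeq)
  obtain ⟨b, hb⟩ := hgσ t ht
  rw [h4.deriv, hστ t ht] at hb
  have h5 := congrArg (inner ℝ (deriv x.τ t)) hb
  have h6 : inner ℝ (deriv x.τ t) (x.τ t) = 0 := by
    rw [real_inner_comm]
    exact inner_deriv_of_norm_eq_one hI x.contDiffOn_τ x.norm_τ ht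
  simp only [inner_add_right, inner_smul_right, h6, mul_zero, zero_add, add_zero] at h5
  have h7 : inner ℝ (deriv x.τ t) (deriv x.τ t) ≠ 0 := inner_self_ne_zero.2 (hd t ht)
  have h8 : (ψ t - r * normalComp normalCurv x.τ m t) *
      inner ℝ (deriv x.τ t) (deriv x.τ t) = 0 := by linarith
  exact sub_eq_zero.1 ((mul_eq_zero.1 h8).resolve_right h7)

theorem IsParallelNormal.sum_smul {q : ℕ} {τ : ℝ → E p} {m : Fin q → ℝ → E p}
    (h : ∀ i, IsParallelNormal I τ (m i)) (R : Fin q → ℝ) :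
    IsParallelNormal I τ (fun t => ∑ i, R i • m i t) := by
  refine ⟨ContDiffOn.sum fun i _ => (h i).contDiffOn.const_smul (R i), fun t ht => ?_,
    fun t ht => ?_, fun t ht => ?_⟩
  · rw [sum_inner]
    exact Finset.sum_eq_zero fun i _ => by rw [inner_smul_left, (h i).inner_curve t ht, mul_zero]
  · rw [sum_inner]
    exact Finset.sum_eq_zero fun i _ => by rw [inner_smul_left, (h i).inner_deriv t ht, mul_zero]
  · choose y hy using fun i => (h i).exists_hasDerivAt t ht
    refine ⟨∑ i, R i * y i, (HasDerivAt.fun_sum fun i _ => (hy i).const_smul (R i)).congr_deriv ?_⟩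
    rw [Finset.sum_smul]
    exact Finset.sum_congr rfl fun i _ => smul_smul _ _ _

theorem normalComp_sum_smul {q K : ℕ} (T : (Fin K → E p) → E p) (τ : ℝ → E p)
    (m : Fin q → ℝ → E p) (R : Fin q → ℝ) (t : ℝ) :
    normalComp T τ (fun t => ∑ i, R i • m i t) t = ∑ i, R i * normalComp T τ (m i) t := by
  rw [normalComp, sum_inner]
  exact Finset.sum_congr rfl fun i _ => by rw [real_inner_smul_left, normalComp]

end Surface

/-! ### Types of directrices -/

section Types

variable {I : Set ℝ} {p : ℕ} {t : ℝ}

theorem isOfType_of_order (hI : IsOpen I) (ht : t ∈ I) {τ g : ℝ → E p} {b : ℝ → ℝ}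
    (hb : ContDiffOn ℝ ∞ b I) (hτ : ContDiffOn ℝ ∞ τ I) (hg : ∀ s ∈ I, HasDerivAt g (b s • τ s) s)
    {d : ℕ} (h0 : ∀ i < d, iteratedDeriv i b t = 0) (hd : iteratedDeriv d b t ≠ 0) :
    (frameDet (derivSeq τ t) ≠ 0 → IsOfType g (fun i => i.val + 1 + d) t) ∧
    (frameDet (derivSeq τ t) = 0 → frameDetSucc (derivSeq τ t) ≠ 0 →
      IsOfType g (fun i => if i.val = p then p + 2 + d else i.val + 1 + d) t) := by
  have hrank := rank_wronskianMatrix_of_hasDerivAt hI ht hb hτ hg h0 hd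
  exact ⟨fun h => isOfType_of_initSpan_eq_top hrank ((frameDet_ne_zero_iff _).1 h),
    fun h h' => isOfType_of_initSpan_sup_eq_top hrank ((frameDetSucc_ne_zero_iff _).1 h')
      fun htop => (frameDet_ne_zero_iff _).2 htop h⟩

/-- The type of a curve in terms of the zeros of its factor `b` and of the determinant of the
derivatives of its unit tangent frame. -/
theorem isOfType_iff (hp : 2 ≤ p) (hI : IsOpen I) (ht : t ∈ I) {τ g : ℝ → E p} {b b' b'' : ℝ → ℝ}
    (hb : ContDiffOn ℝ ∞ b I) (hτ : ContDiffOn ℝ ∞ τ I) (hb' : ∀ s ∈ I, HasDerivAt b (b' s) s)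
    (hb'' : ∀ s ∈ I, HasDerivAt b' (b'' s) s) (hg : ∀ s ∈ I, HasDerivAt g (b s • τ s) s)
    (hD : frameDet (derivSeq τ t) ≠ 0 ∨ frameDetSucc (derivSeq τ t) ≠ 0)
    (h : b t = 0 → b' t = 0 → frameDet (derivSeq τ t) ≠ 0 ∧ b'' t ≠ 0) :
    (∃ e ∈ typeTable p, IsOfType g e.1 t) ∧
    (IsOfType g (fun i => i.val + 1) t ↔ b t ≠ 0 ∧ frameDet (derivSeq τ t) ≠ 0) ∧
    (IsOfType g (fun i => if i.val = p then 2 + p else i.val + 1) t ↔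
      b t ≠ 0 ∧ frameDet (derivSeq τ t) = 0) ∧
    (IsOfType g (fun i => i.val + 2) t ↔
      b t = 0 ∧ b' t ≠ 0 ∧ frameDet (derivSeq τ t) ≠ 0) ∧
    (IsOfType g (fun i => if i.val = p then 3 + p else i.val + 2) t ↔
      b t = 0 ∧ b' t ≠ 0 ∧ frameDet (derivSeq τ t) = 0) ∧
    (IsOfType g (fun i => i.val + 3) t ↔ b t = 0 ∧ b' t = 0) := by
  have e1 : iteratedDeriv 1 b t = b' t := by
    rw [iteratedDeriv_succ_of_hasDerivAt hI ht hb' 0, iteratedDeriv_zero]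
  have e2 : iteratedDeriv 2 b t = b'' t := by
    rw [iteratedDeriv_succ_of_hasDerivAt hI ht hb' 1, iteratedDeriv_succ_of_hasDerivAt hI ht hb'' 0,
      iteratedDeriv_zero]
  set D := frameDet (derivSeq τ t)
  have k1 : (fun i : Fin (1 + p) => if i.val = p then p + 2 + 0 else i.val + 1 + 0) =
      fun i => if i.val = p then 2 + p else i.val + 1 := funext fun i => by split_ifs <;> omega
  have k3 : (fun i : Fin (1 + p) => if i.val = p then p + 2 + 1 else i.val + 1 + 1) =
      fun i => if i.val = p then 3 + p else i.val + 2 := funext fun i => by split_ifs <;> omega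
  have c0 : b t ≠ 0 → D ≠ 0 → IsOfType g (fun i => i.val + 1) t := fun h0 =>
    (isOfType_of_order hI ht hb hτ hg (d := 0) (by simp) (by simpa using h0)).1
  have c1 : b t ≠ 0 → D = 0 →
      IsOfType g (fun i => if i.val = p then 2 + p else i.val + 1) t := fun h0 hz =>
    k1 ▸ (isOfType_of_order hI ht hb hτ hg (d := 0) (by simp) (by simpa using h0)).2 hz
      (hD.resolve_left (not_not.2 hz))
  have v1 : b t = 0 → ∀ i < 1, iteratedDeriv i b t = 0 := fun h0 i hi => by
    obtain rfl : i = 0 := by omega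
    simpa using h0
  have c2 : b t = 0 → b' t ≠ 0 → D ≠ 0 → IsOfType g (fun i => i.val + 2) t := fun h0 h1 =>
    (isOfType_of_order hI ht hb hτ hg (d := 1) (v1 h0) (by rwa [e1])).1
  have c3 : b t = 0 → b' t ≠ 0 → D = 0 →
      IsOfType g (fun i => if i.val = p then 3 + p else i.val + 2) t := fun h0 h1 hz =>
    k3 ▸ (isOfType_of_order hI ht hb hτ hg (d := 1) (v1 h0) (by rwa [e1])).2 hz
      (hD.resolve_left (not_not.2 hz))
  have c4 : b t = 0 → b' t = 0 → IsOfType g (fun i => i.val + 3) t := fun h0 h1 => by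
    refine (isOfType_of_order hI ht hb hτ hg (d := 2) (fun i hi => ?_)
      (by rw [e2]; exact (h h0 h1).2)).1 (h h0 h1).1
    interval_cases i
    · simpa using h0
    · rwa [e1]
  -- The first and the last entries, `(1, 1+p)`, `(1, 2+p)`, `(2, 2+p)`, `(2, 3+p)`, `(3, 3+p)`,
  -- already separate the five types. Hence each implication from conditions to type has a converse.
  have hdist : ∀ {A B : Fin (1 + p) → ℕ}, IsOfType g A t → IsOfType g B t →
      A ⟨0, by omega⟩ = B ⟨0, by omega⟩ ∧ A ⟨p, by omega⟩ = B ⟨p, by omega⟩ := fun hA hB => by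
    rw [hA.unique hB]
    exact ⟨rfl, rfl⟩
  have hp0 : (0 : ℕ) ≠ p := by omega
  have hcase : (b t ≠ 0 ∧ D ≠ 0) ∨ (b t ≠ 0 ∧ D = 0) ∨ (b t = 0 ∧ b' t ≠ 0 ∧ D ≠ 0) ∨
      (b t = 0 ∧ b' t ≠ 0 ∧ D = 0) ∨ (b t = 0 ∧ b' t = 0) := by
    rcases eq_or_ne (b t) 0 with hb0 | hb0 <;> rcases eq_or_ne (b' t) 0 with hb1 | hb1 <;>
      rcases eq_or_ne D 0 with hD0 | hD0 <;> simp [hb0, hb1, hD0]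
  refine ⟨?_, ⟨fun hT => ?_, fun h => c0 h.1 h.2⟩, ⟨fun hT => ?_, fun h => c1 h.1 h.2⟩,
    ⟨fun hT => ?_, fun h => c2 h.1 h.2.1 h.2.2⟩, ⟨fun hT => ?_, fun h => c3 h.1 h.2.1 h.2.2⟩,
    ⟨fun hT => ?_, fun h => c4 h.1 h.2⟩⟩
  · simp only [typeTable, List.mem_cons, List.not_mem_nil, or_false, exists_eq_or_imp,
      exists_eq_left]
    rcases hcase with hc | hc | hc | hc | hc
    · exact Or.inl (c0 hc.1 hc.2)
    · exact Or.inr (Or.inl (c1 hc.1 hc.2))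
    · exact Or.inr (Or.inr (Or.inl (c2 hc.1 hc.2.1 hc.2.2)))
    · exact Or.inr (Or.inr (Or.inr (Or.inl (c3 hc.1 hc.2.1 hc.2.2))))
    · exact Or.inr (Or.inr (Or.inr (Or.inr (c4 hc.1 hc.2))))
  all_goals
    have hother := fun {B : Fin (1 + p) → ℕ} (hB : IsOfType g B t) => hdist hT hB
    clear hdist hT
    rcases hcase with hc | hc | hc | hc | hc
    case' inl => have := hother (c0 hc.1 hc.2)
    case' inr.inl => have := hother (c1 hc.1 hc.2)
    case' inr.inr.inl => have := hother (c2 hc.1 hc.2.1 hc.2.2)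
    case' inr.inr.inr.inl => have := hother (c3 hc.1 hc.2.1 hc.2.2)
    case' inr.inr.inr.inr => have := hother (c4 hc.1 hc.2)
    all_goals
      clear hother c0 c1 c2 c3 c4
      simp only [if_neg hp0, if_true] at this
      first
      | exact hc
      | omega

end Types

/-! ### Submanifolds of the plane -/

section Submanifolds

theorem isSubmanifoldOfCodim_of_isOpen {L : Set (ℝ × ℝ)} (hL : IsOpen L) :
    IsSubmanifoldOfCodim 0 L := fun x hx =>
  ⟨L, hL, hx, fun _ => 0, contDiffOn_const, fun _ _ => Function.surjective_to_subsingleton _, by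
    ext y; simp⟩

theorem isSubmanifoldOfCodim_one {O L : Set (ℝ × ℝ)} (hO : IsOpen O) {h : ℝ × ℝ → ℝ}
    (hh : ContDiffOn ℝ ∞ h O) (hL : L = {y | y ∈ O ∧ h y = 0})
    (hd : ∀ y ∈ O, ∃ v, fderiv ℝ h y v ≠ 0) : IsSubmanifoldOfCodim 1 L := by
  intro x hx
  refine ⟨O, hO, (hL ▸ hx).1, fun y _ => h y, contDiffOn_pi.2 fun _ => hh, fun y hy w => ?_, ?_⟩
  · have hdh := ((hh.contDiffAt (hO.mem_nhds hy)).differentiableAt (by simp)).hasFDerivAt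
    rw [(hasFDerivAt_pi.2 fun _ : Fin 1 => hdh).fderiv]
    obtain ⟨v, hv⟩ := hd y hy
    refine ⟨(w 0 / fderiv ℝ h y v) • v, funext fun i => ?_⟩
    rw [Subsingleton.elim i 0, ContinuousLinearMap.pi_apply, map_smul, smul_eq_mul,
      div_mul_cancel₀ _ hv]
  · rw [hL]
    ext y
    simp only [mem_inter_iff, mem_ofPred_eq, funext_iff, Pi.zero_apply, forall_const]
    tauto

theorem isSubmanifoldOfCodim_two {O L : Set (ℝ × ℝ)} (hO : IsOpen O) {h k : ℝ × ℝ → ℝ}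
    (hh : ContDiffOn ℝ ∞ h O) (hk : ContDiffOn ℝ ∞ k O) (hL : L = {y | y ∈ O ∧ h y = 0 ∧ k y = 0})
    (hd : ∀ y ∈ O, fderiv ℝ h y (1, 0) * fderiv ℝ k y (0, 1) -
      fderiv ℝ h y (0, 1) * fderiv ℝ k y (1, 0) ≠ 0) : IsSubmanifoldOfCodim 2 L := by
  intro x hx
  refine ⟨O, hO, (hL ▸ hx).1, fun y => ![h y, k y], contDiffOn_pi.2 fun i => ?_,
    fun y hy w => ?_, ?_⟩
  · fin_cases i
    · exact hh
    · exact hk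
  · have hdh := ((hh.contDiffAt (hO.mem_nhds hy)).differentiableAt (by simp)).hasFDerivAt
    have hdk := ((hk.contDiffAt (hO.mem_nhds hy)).differentiableAt (by simp)).hasFDerivAt
    have hdhk : HasFDerivAt (fun y => ![h y, k y])
        (ContinuousLinearMap.pi ![fderiv ℝ h y, fderiv ℝ k y]) y := by
      refine hasFDerivAt_pi.2 fun i => ?_
      fin_cases i
      · exact hdh
      · exact hdk
    rw [hdhk.fderiv]
    have hΔ := hd y hy
    set Δ := fderiv ℝ h y (1, 0) * fderiv ℝ k y (0, 1) -
      fderiv ℝ h y (0, 1) * fderiv ℝ k y (1, 0) with hΔdef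
    -- The preimage of `w` is given by Cramer's rule.
    refine ⟨((w 0 * fderiv ℝ k y (0, 1) - w 1 * fderiv ℝ h y (0, 1)) / Δ) • (1, 0) +
      ((w 1 * fderiv ℝ h y (1, 0) - w 0 * fderiv ℝ k y (1, 0)) / Δ) • (0, 1), funext fun i => ?_⟩
    fin_cases i
    · simp only [Fin.zero_eta, ContinuousLinearMap.pi_apply, Matrix.cons_val_zero, map_add,
        map_smul, smul_eq_mul]
      field_simp
      rw [hΔdef]
      ring
    · simp only [Fin.mk_one, ContinuousLinearMap.pi_apply, Matrix.cons_val_one,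
        Matrix.cons_val_zero, map_add, map_smul, smul_eq_mul]
      field_simp
      rw [hΔdef]
      ring
  · rw [hL]
    ext y
    simp only [mem_inter_iff, mem_ofPred_eq, funext_iff, Fin.forall_fin_two, Pi.zero_apply,
      Matrix.cons_val_zero, Matrix.cons_val_one]
    tauto

variable {I : Set ℝ}

theorem fderiv_add_mul {A C : ℝ → ℝ} {A' C' : ℝ} {z : ℝ × ℝ} (hA : HasDerivAt A A' z.1)
    (hC : HasDerivAt C C' z.1) (v : ℝ × ℝ) :
    fderiv ℝ (fun z : ℝ × ℝ => A z.1 + z.2 * C z.1) z v = v.1 * (A' + z.2 * C') + v.2 * C z.1 := by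
  have h3 : HasFDerivAt (fun u : ℝ × ℝ => u.2) (ContinuousLinearMap.snd ℝ ℝ ℝ) z := hasFDerivAt_snd
  rw [((hasFDerivAt_comp_fst hA).fun_add (h3.fun_mul (hasFDerivAt_comp_fst hC))).fderiv]
  simp only [add_apply, smul_apply, ContinuousLinearMap.smulRight_apply,
    ContinuousLinearMap.coe_fst', ContinuousLinearMap.coe_snd', smul_eq_mul]
  ring

/-- The strata of the plane given by the zeros of `a + r c`, its derivative and `D`. -/
theorem isSubmanifoldOfCodim_strata (hI : IsOpen I) {a a' a'' c c' c'' D D' : ℝ → ℝ}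
    (ha : ContDiffOn ℝ ∞ a I) (ha' : ContDiffOn ℝ ∞ a' I) (ha'' : ContDiffOn ℝ ∞ a'' I)
    (hc : ContDiffOn ℝ ∞ c I) (hc' : ContDiffOn ℝ ∞ c' I) (hc'' : ContDiffOn ℝ ∞ c'' I)
    (hD : ContDiffOn ℝ ∞ D I) (hD' : ContinuousOn D' I)
    (da : ∀ t ∈ I, HasDerivAt a (a' t) t) (da' : ∀ t ∈ I, HasDerivAt a' (a'' t) t)
    (dc : ∀ t ∈ I, HasDerivAt c (c' t) t) (dc' : ∀ t ∈ I, HasDerivAt c' (c'' t) t)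
    (dD : ∀ t ∈ I, HasDerivAt D (D' t) t) (hDD : ∀ t ∈ I, D t ≠ 0 ∨ D' t ≠ 0)
    (hac : ∀ t ∈ I, a t = 0 → c t ≠ 0)
    (hb'' : ∀ t ∈ I, ∀ r, a t + r * c t = 0 → a' t + r * c' t = 0 → a'' t + r * c'' t ≠ 0) :
    IsSubmanifoldOfCodim 0 {z : ℝ × ℝ | z.1 ∈ I ∧ a z.1 + z.2 * c z.1 ≠ 0 ∧ D z.1 ≠ 0} ∧
    IsSubmanifoldOfCodim 1 {z : ℝ × ℝ | z.1 ∈ I ∧ a z.1 + z.2 * c z.1 ≠ 0 ∧ D z.1 = 0} ∧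
    IsSubmanifoldOfCodim 1 {z : ℝ × ℝ | z.1 ∈ I ∧ a z.1 + z.2 * c z.1 = 0 ∧
      a' z.1 + z.2 * c' z.1 ≠ 0 ∧ D z.1 ≠ 0} ∧
    IsSubmanifoldOfCodim 2 {z : ℝ × ℝ | z.1 ∈ I ∧ a z.1 + z.2 * c z.1 = 0 ∧
      a' z.1 + z.2 * c' z.1 ≠ 0 ∧ D z.1 = 0} ∧
    IsSubmanifoldOfCodim 2 {z : ℝ × ℝ | z.1 ∈ I ∧ a z.1 + z.2 * c z.1 = 0 ∧
      a' z.1 + z.2 * c' z.1 = 0} := by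
  have hΩ : IsOpen (I ×ˢ (univ : Set ℝ)) := hI.prod isOpen_univ
  have hlin : ∀ {A C : ℝ → ℝ}, ContDiffOn ℝ ∞ A I → ContDiffOn ℝ ∞ C I →
      ContDiffOn ℝ ∞ (fun z : ℝ × ℝ => A z.1 + z.2 * C z.1) (I ×ˢ univ) := fun hA hC =>
    (contDiffOn_comp_fst hA).add (contDiff_snd.contDiffOn.mul (contDiffOn_comp_fst hC))
  have hb := hlin ha hc
  have hb' := hlin ha' hc'
  have hbb := hlin ha'' hc''
  have hDs := contDiffOn_comp_fst hD
  have hDc' : ContinuousOn (fun z : ℝ × ℝ => D' z.1) (I ×ˢ univ) :=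
    hD'.comp continuous_fst.continuousOn fun z hz => hz.1
  have hcs := contDiffOn_comp_fst hc
  have hcs' := contDiffOn_comp_fst hc'
  have hopen : ∀ {u : ℝ × ℝ → ℝ}, ContinuousOn u (I ×ˢ univ) →
      IsOpen {z | z ∈ I ×ˢ (univ : Set ℝ) ∧ u z ≠ 0} := fun hu =>
    hu.isOpen_inter_preimage hΩ isOpen_compl_singleton
  have hne : ∀ {t r}, t ∈ I → a t + r * c t = 0 → c t ≠ 0 := fun {t r} ht h hc0 => by
    rw [hc0, mul_zero, add_zero] at h
    exact hac t ht h hc0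
  have dDf : ∀ z : ℝ × ℝ, z.1 ∈ I → ∀ v : ℝ × ℝ,
      fderiv ℝ (fun z : ℝ × ℝ => D z.1) z v = v.1 * D' z.1 := fun z hz v => by
    rw [(hasFDerivAt_comp_fst (dD _ hz)).fderiv]
    simp
  -- Each `O` is chosen so that the relevant derivative or Jacobian, and any inequality of the
  -- stratum, is nonzero on it. With `b = a + r c` the Jacobian of `(b, D)` is `-c D'`, and that of
  -- `(b, b')` is `b' c' - c b''`, which is `-c b''` on the stratum. Here `c ≠ 0` wherever `b = 0`,
  -- since otherwise `a` and `c` would vanish together.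
  refine ⟨isSubmanifoldOfCodim_of_isOpen ?_,
    isSubmanifoldOfCodim_one (h := fun z => D z.1) (O := {z | z ∈ I ×ˢ (univ : Set ℝ) ∧
      (a z.1 + z.2 * c z.1) * D' z.1 ≠ 0}) (hopen (hb.continuousOn.mul hDc'))
      (hDs.mono fun z hz => hz.1) ?_ fun z hz => ⟨(1, 0), ?_⟩,
    isSubmanifoldOfCodim_one (h := fun z => a z.1 + z.2 * c z.1)
      (O := {z | z ∈ I ×ˢ (univ : Set ℝ) ∧ (a' z.1 + z.2 * c' z.1) * D z.1 ≠ 0})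
      (hopen (hb'.continuousOn.mul hDs.continuousOn))
      (hb.mono fun z hz => hz.1) ?_ fun z hz => ⟨(1, 0), ?_⟩,
    isSubmanifoldOfCodim_two (h := fun z => a z.1 + z.2 * c z.1) (k := fun z => D z.1)
      (O := {z | z ∈ I ×ˢ (univ : Set ℝ) ∧ (a' z.1 + z.2 * c' z.1) * D' z.1 * c z.1 ≠ 0})
      (hopen ((hb'.continuousOn.mul hDc').mul hcs.continuousOn)) (hb.mono fun z hz => hz.1)
      (hDs.mono fun z hz => hz.1) ?_ fun z hz => ?_,
    isSubmanifoldOfCodim_two (h := fun z => a z.1 + z.2 * c z.1)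
      (k := fun z => a' z.1 + z.2 * c' z.1)
      (O := {z | z ∈ I ×ˢ (univ : Set ℝ) ∧ (a' z.1 + z.2 * c' z.1) * c' z.1 -
        c z.1 * (a'' z.1 + z.2 * c'' z.1) ≠ 0})
      (hopen ((hb'.continuousOn.mul hcs'.continuousOn).sub
        (hcs.continuousOn.mul hbb.continuousOn))) (hb.mono fun z hz => hz.1)
      (hb'.mono fun z hz => hz.1) ?_ fun z hz => ?_⟩
  · convert hopen (hb.continuousOn.mul hDs.continuousOn) using 1
    ext z
    simp
  · ext z
    simp only [mem_ofPred_eq, mem_prod, mem_univ, and_true, mul_ne_zero_iff]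
    have := hDD z.1
    tauto
  · rw [dDf z hz.1.1]
    simpa using right_ne_zero_of_mul hz.2
  · ext z
    simp only [mem_ofPred_eq, mem_prod, mem_univ, and_true, mul_ne_zero_iff]
    tauto
  · rw [fderiv_add_mul (da _ hz.1.1) (dc _ hz.1.1)]
    simpa using left_ne_zero_of_mul hz.2
  · ext z
    simp only [mem_ofPred_eq, mem_prod, mem_univ, and_true, mul_ne_zero_iff]
    have := hDD z.1
    have := hne (t := z.1) (r := z.2)
    tauto
  · rw [fderiv_add_mul (da _ hz.1.1) (dc _ hz.1.1), fderiv_add_mul (da _ hz.1.1) (dc _ hz.1.1),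
      dDf z hz.1.1, dDf z hz.1.1]
    have h1 := right_ne_zero_of_mul hz.2
    have h2 := right_ne_zero_of_mul (left_ne_zero_of_mul hz.2)
    simp [h1, h2]
  · ext z
    simp only [mem_ofPred_eq, mem_prod, mem_univ, and_true]
    refine ⟨fun h => ⟨⟨h.1, ?_⟩, h.2⟩, fun h => ⟨h.1.1, h.2⟩⟩
    rw [h.2.2, zero_mul, zero_sub]
    exact neg_ne_zero.2 (mul_ne_zero (hne h.1 h.2.1) (hb'' _ h.1 _ h.2.1 h.2.2))
  · rw [fderiv_add_mul (da _ hz.1.1) (dc _ hz.1.1), fderiv_add_mul (da _ hz.1.1) (dc _ hz.1.1),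
      fderiv_add_mul (da' _ hz.1.1) (dc' _ hz.1.1), fderiv_add_mul (da' _ hz.1.1) (dc' _ hz.1.1)]
    simpa using hz.2

end Submanifolds

/-! ### Generic parallels -/

section Main

variable {I : Set ℝ} {p : ℕ}

theorem IsGeneric.mono {q : ℕ} {S T : Set (Fin q → ℝ)} (h : IsGeneric S) (hST : S ⊆ T) :
    IsGeneric T := ⟨mem_of_superset h.1 hST, h.2.mono hST⟩

/-- For a parallel normal field with generic curvature, the directrices of the parallels have the
types of the table, and the strata are submanifolds. -/
theorem types_of_isDirectrix (hp : 2 ≤ p) (hI : IsOpen I) {x : FrontalData I p}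
    (hx : x ∈ detGeneric I p) {f m : ℝ → E p} (hf : x.IsCurve f) (hm : IsParallelNormal I x.τ m)
    (hR : ∀ t ∈ I, (x.a t = 0 → normalComp normalCurvDeriv x.τ m t ≠ 0) ∧
      (frameDet (derivSeq x.τ t) = 0 → x.a t * normalComp normalCurvDeriv₂ x.τ m t -
        deriv x.a t * normalComp normalCurvDeriv x.τ m t ≠ 0) ∧
      (x.a t * normalComp normalCurvDeriv₂ x.τ m t -
        deriv x.a t * normalComp normalCurvDeriv x.τ m t = 0 →
        x.a t * normalComp normalCurvDeriv₃ x.τ m t -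
        deriv (deriv x.a) t * normalComp normalCurvDeriv x.τ m t ≠ 0))
    {g : ℝ → ℝ → E p} (hg : ∀ r, EqOn (g r) (directrix f x.τ m r) I) :
    (∀ t ∈ I, ∀ r : ℝ, ∃ e ∈ typeTable p, IsOfType (g r) e.1 t) ∧
      ∀ e ∈ typeTable p,
        IsSubmanifoldOfCodim e.2 {z : ℝ × ℝ | z.1 ∈ I ∧ IsOfType (g z.2) e.1 z.1} := by
  have hd : ∀ t ∈ I, deriv x.τ t ≠ 0 := fun t ht => deriv_ne_zero_of_detGeneric hp hx ht
  have ha := x.contDiffOn_a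
  have ha' := contDiffOn_deriv hI ha
  have ha'' := contDiffOn_deriv hI ha'
  obtain ⟨-, hc, hc', hc''⟩ := contDiffOn_frameComp hI x.contDiffOn_τ x.norm_τ hd hm.contDiffOn
  have hder := fun t ht => hasDerivAt_frameComp hI x.contDiffOn_τ x.norm_τ ht (hd t ht) hm
  have dc := fun t ht => (hder t ht).2.1
  have dc' := fun t ht => (hder t ht).2.2
  have da := fun t ht => hasDerivAt_of_contDiffOn (t := t) hI ha ht
  have da' := fun t ht => hasDerivAt_of_contDiffOn (t := t) hI ha' ht
  set c := normalComp normalCurvDeriv x.τ m with hcdef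
  set c' := normalComp normalCurvDeriv₂ x.τ m
  set c'' := normalComp normalCurvDeriv₃ x.τ m
  -- Elimination of `r`: two of the equations `b = 0`, `b' = 0`, `b'' = 0` with the same `r` make a
  -- two-by-two determinant in the derivatives of `a` and `c` vanish.
  have hord : ∀ t ∈ I, ∀ r, x.a t + r * c t = 0 → deriv x.a t + r * c' t = 0 →
      frameDet (derivSeq x.τ t) ≠ 0 ∧ deriv (deriv x.a) t + r * c'' t ≠ 0 := by
    intro t ht r h0 h1
    obtain ⟨-, h2, h3⟩ := hR t ht
    have h4 : x.a t * c' t - deriv x.a t * c t = 0 := by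
      linear_combination c' t * h0 - c t * h1
    refine ⟨fun h => h2 h h4, fun h => h3 h4 ?_⟩
    linear_combination c'' t * h0 - c t * h
  have htype := fun t ht r => isOfType_iff (t := t) (g := g r) hp hI ht
    (b := fun s => x.a s + r * c s) (b' := fun s => deriv x.a s + r * c' s)
    (b'' := fun s => deriv (deriv x.a) s + r * c'' s) (by fun_prop) x.contDiffOn_τ
    (fun s hs => (da s hs).add ((dc s hs).const_mul r))
    (fun s hs => (da' s hs).add ((dc' s hs).const_mul r))
    (fun s hs => (hasDerivAt_directrix hf hI hs (hd s hs) hm r).congr_of_eventuallyEq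
      (Filter.eventually_of_mem (hI.mem_nhds hs) (hg r))) (hx t ht) (hord t ht r)
  have hDs : ContDiffOn ℝ ∞ (fun t => frameDet (derivSeq x.τ t)) I :=
    (frameForm p).contDiff.comp_contDiffOn
      (contDiffOn_pi.2 fun j => contDiffOn_iteratedDeriv hI x.contDiffOn_τ j)
  have hD's : ContinuousOn (fun t => frameDetSucc (derivSeq x.τ t)) I :=
    ((contDiffOn_deriv hI hDs).continuousOn).congr fun t ht =>
      (hasDerivAt_frameDet hI x.contDiffOn_τ ht).deriv.symm
  have hsub := isSubmanifoldOfCodim_strata hI ha ha' ha'' hc hc' hc'' hDs hD's da da' dc dc'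
    (fun t ht => hasDerivAt_frameDet hI x.contDiffOn_τ ht) hx (fun t ht => (hR t ht).1)
    fun t ht r h0 h1 => (hord t ht r h0 h1).2
  refine ⟨fun t ht r => (htype t ht r).1, fun e he => ?_⟩
  simp only [typeTable, List.mem_cons, List.not_mem_nil, or_false] at he
  rcases he with rfl | rfl | rfl | rfl | rfl
  · exact (congrArg (IsSubmanifoldOfCodim _) (ext fun z => and_congr_right fun hz =>
      (htype z.1 hz z.2).2.1)).mpr hsub.1
  · exact (congrArg (IsSubmanifoldOfCodim _) (ext fun z => and_congr_right fun hz =>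
      (htype z.1 hz z.2).2.2.1)).mpr hsub.2.1
  · exact (congrArg (IsSubmanifoldOfCodim _) (ext fun z => and_congr_right fun hz =>
      (htype z.1 hz z.2).2.2.2.1)).mpr hsub.2.2.1
  · exact (congrArg (IsSubmanifoldOfCodim _) (ext fun z => and_congr_right fun hz =>
      (htype z.1 hz z.2).2.2.2.2.1)).mpr hsub.2.2.2.1
  · exact (congrArg (IsSubmanifoldOfCodim _) (ext fun z => and_congr_right fun hz =>
      (htype z.1 hz z.2).2.2.2.2.2)).mpr hsub.2.2.2.2

theorem isGeneric_directrix_types (hp : 2 ≤ p) (hI : IsOpen I) {x : FrontalData I p}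
    (hx : x ∈ genericData I p) {f : ℝ → E p} (hf : x.IsCurve f) {n : Fin (p - 1) → ℝ → E p}
    (hpar : ∀ i, IsParallelNormal I x.τ (n i)) (hon : ∀ t ∈ I, Orthonormal ℝ fun i => n i t)
    {ν : Fin (p - 1) → ℝ × ℝ → E p}
    (hν : IsBishopFrame (I ×ˢ (univ : Set ℝ)) (tangentSurface f x.τ) ν) :
    IsGeneric {R : Fin (p - 1) → ℝ |
      (∀ r : ℝ, ∃ g : ℝ → E p,
        IsDirectrix I (fun u => tangentSurface f x.τ u + r • ∑ i, R i • ν i u) g) ∧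
      ∀ g : ℝ → ℝ → E p,
        (∀ r : ℝ,
          IsDirectrix I (fun u => tangentSurface f x.τ u + r • ∑ i, R i • ν i u) (g r)) →
        (∀ t ∈ I, ∀ r : ℝ, ∃ e ∈ typeTable p, IsOfType (g r) e.1 t) ∧
        ∀ e ∈ typeTable p,
          IsSubmanifoldOfCodim e.2 {z : ℝ × ℝ | z.1 ∈ I ∧ IsOfType (g z.2) e.1 z.1}} := by
  have hd : ∀ t ∈ I, deriv x.τ t ≠ 0 := fun t ht => deriv_ne_zero_of_detGeneric hp hx.1.1 ht
  -- The given Bishop frame is constant along the rulings, so its restriction to `s = 0` is a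
  -- parallel frame along `τ`, and all genericity conditions may be read in this frame.
  set m : Fin (p - 1) → ℝ → E p := fun i t => ν i (t, 0)
  have hm : ∀ i, IsParallelNormal I x.τ (m i) := fun i =>
    ((hν.1 i).eq_comp_fst hf hI hd hpar hon).1
  have hmon : ∀ t ∈ I, Orthonormal ℝ fun i => m i t := fun t ht => hν.2 (t, 0) ⟨ht, mem_univ _⟩
  have hνm : ∀ (R : Fin (p - 1) → ℝ) (r : ℝ), ∀ u ∈ I ×ˢ (univ : Set ℝ),
      tangentSurface f x.τ u + r • ∑ i, R i • ν i u =
        tangentSurface f x.τ u + r • ∑ i, R i • m i u.1 := fun R r u hu => by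
    congr 2
    exact Finset.sum_congr rfl fun i _ => by
      rw [((hν.1 i).eq_comp_fst hf hI hd hpar hon).2 u hu]
  have hfac := (mem_factorGeneric_iff hI hd hm hmon).1 hx.2
  have hs := fun i => contDiffOn_frameComp hI x.contDiffOn_τ x.norm_τ hd (hm i).contDiffOn
  have hD := fun i t ht => hasDerivAt_frameComp hI x.contDiffOn_τ x.norm_τ ht (hd t ht) (hm i)
  have ha := x.contDiffOn_a
  have ha' := contDiffOn_deriv hI ha
  have ha'' := contDiffOn_deriv hI ha'
  have hgen := isGeneric_parameters hI (D := fun t => frameDet (derivSeq x.τ t)) (a := x.a)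
    (c := fun i => normalComp normalCurvDeriv x.τ (m i))
    (w := fun i t => x.a t * normalComp normalCurvDeriv₂ x.τ (m i) t -
      deriv x.a t * normalComp normalCurvDeriv x.τ (m i) t)
    (w' := fun i t => x.a t * normalComp normalCurvDeriv₃ x.τ (m i) t -
      deriv (deriv x.a) t * normalComp normalCurvDeriv x.τ (m i) t)
    -- The two products of `a'` with the derivative of `c i` cancel, so `w' i` contains no mixed
    -- term.
    (fun i t ht => by
      refine (((hasDerivAt_of_contDiffOn hI ha ht).mul (hD i t ht).2.2).sub
        ((hasDerivAt_of_contDiffOn hI ha' ht).mul (hD i t ht).2.1)).congr_deriv ?_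
      ring)
    (fun i => (ha.continuousOn.mul (hs i).2.2.2.continuousOn).sub
      (ha''.continuousOn.mul (hs i).2.1.continuousOn))
    (countable_setOf_simple_zero (fun t ht => hasDerivAt_of_contDiffOn hI ha ht)
      fun t ht h => (hfac t ht).2.1.resolve_left (not_not.2 h))
    (countable_frameDet_zero hI hx.1.1) (fun t ht => (hfac t ht).2.2.1)
    (fun t ht => (hfac t ht).1) (fun t ht => (hfac t ht).2.2.2)
  have hsum : ∀ (R : Fin (p - 1) → ℝ) (α β : ℝ) (u v : Fin (p - 1) → ℝ),
      ∑ i, R i * (α * u i - β * v i) = α * ∑ i, R i * u i - β * ∑ i, R i * v i :=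
    fun R α β u v => by
      rw [Finset.mul_sum, Finset.mul_sum, ← Finset.sum_sub_distrib]
      exact Finset.sum_congr rfl fun i _ => by ring
  simp only [hsum, ← normalComp_sum_smul] at hgen
  exact hgen.mono fun R hR =>
    ⟨fun r => ⟨_, isDirectrix_directrix hf hI hd (IsParallelNormal.sum_smul hm R) r (hνm R r)⟩,
      fun g hg => types_of_isDirectrix hp hI hx.1.1 hf (IsParallelNormal.sum_smul hm R) hR
        fun r => (hg r).eq_directrix hf hI hd (IsParallelNormal.sum_smul hm R) (hνm R r)⟩

end Main

end TangentParallel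
open TangentParallel in
theorem theorem3p5 (p : ℕ) (hp : 2 ≤ p) (I : Set ℝ) (hI_open : IsOpen I)
    (hI_conn : I.OrdConnected) (hI_ne : I.Nonempty) :
    ∃ U : Set (FrontalData I p), IsOpen U ∧ Dense U ∧
      ∀ x ∈ U, ∀ f : ℝ → E p, x.IsCurve f →
        IsProperFrontal (p - 1) (I ×ˢ (univ : Set ℝ)) (tangentSurface f x.τ) ∧
        (∃ ν : Fin (p - 1) → ℝ × ℝ → E p,
          IsBishopFrame (I ×ˢ (univ : Set ℝ)) (tangentSurface f x.τ) ν) ∧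
        ∀ ν : Fin (p - 1) → ℝ × ℝ → E p,
          IsBishopFrame (I ×ˢ (univ : Set ℝ)) (tangentSurface f x.τ) ν →
          IsGeneric {R : Fin (p - 1) → ℝ |
            (∀ r : ℝ, ∃ g : ℝ → E p,
              IsDirectrix I (fun u => tangentSurface f x.τ u + r • ∑ i, R i • ν i u) g) ∧
            ∀ g : ℝ → ℝ → E p,
              (∀ r : ℝ,
                IsDirectrix I (fun u => tangentSurface f x.τ u + r • ∑ i, R i • ν i u) (g r)) →
              (∀ t ∈ I, ∀ r : ℝ, ∃ e ∈ typeTable p, IsOfType (g r) e.1 t) ∧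
              ∀ e ∈ typeTable p,
                IsSubmanifoldOfCodim e.2 {z : ℝ × ℝ | z.1 ∈ I ∧ IsOfType (g z.2) e.1 z.1}} := by
  refine ⟨genericData I p, isOpen_genericData hI_open,
    dense_genericData hI_open hI_conn hI_ne hp, fun x hx f hf => ?_⟩
  have hd : ∀ t ∈ I, deriv x.τ t ≠ 0 := fun t ht => deriv_ne_zero_of_detGeneric hp hx.1.1 ht
  obtain ⟨n, hpar, hon⟩ := exists_parallel_frame hI_open hI_conn hI_ne x.contDiffOn_τ x.norm_τ hd
  exact ⟨isProperFrontal_tangentSurface hf hI_open hd hpar hon,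
    ⟨_, isBishopFrame_tangentSurface hf hI_open hpar hon⟩,
    fun ν hν => isGeneric_directrix_types hp hI_open hx hf hpar hon hν⟩
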